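/- **Setting.** A *stabilizer state* of $n$ qubits is $U|0\rangle^{\otimes n}$ with $U$ a Clifford unitary, i.e. a unitary that conjugates Pauli strings (with phases $\pm1,\pm i$) to Pauli strings. A *local circuit of depth $D$* on a ring of qubits is $Q=V_D\cdots V_1$, where every layer $V_i$ is a product of two-qubit unitaries acting on pairwise disjoint pairs of neighbouring qubits. Put $\Delta(\psi,\phi)=\sqrt{1-|\langle\psi|\phi\rangle|^2}$. A family $(|\psi_N\rangle)_N$ of states of $N$ sites has *short-range nonstabilizerness* if for all $\varepsilon_0>0$ and $\alpha>0$ there are local circuits $Q_N$ of depth $D_N=O(\operatorname{polylog} N)$ and stabilizer states $|S_N\rangle$ with $\Delta(Q_N|\psi_N\rangle,|S_N\rangle)\le\varepsilon_0/N^{\alpha}$ for all large $N$; otherwise it has *long-range nonstabilizerness*. A chain of $N$ sites with local dimension $d$ is regarded as a ring of $Nq$ qubits through an isometry $\mathbb C^d\to(\mathbb C^2)^{\otimes q}$, the same on every site ($q$ and the isometry are fixed but arbitrary). **RG fixed points.** Let every site $n$ of a ring of $N$ sites consist of a left and a right qudit $L_n,R_n$, with orthonormal bases $|m_j\rangle$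 ($1\le j\le b$, $1\le m_j\le d_j$), so that $\langle m_j|m'_{j'}\rangle=0$ for $j\ne j'$ (local orthogonality). An RG fixed point is $$|\tilde\phi_N\rangle=\sum_{j=1}^b\alpha_j^{(N)}|\Omega_j\rangle,\qquad |\Omega_j\rangle=\bigotimes_{n=1}^N|\omega_j\rangle_{R_n,L_{n+1}},\qquad |\omega_j\rangle=\sum_{m_j=1}^{d_j}\sqrt{\lambda_{m_j}}\,|m_j\rangle|m_j\rangle,$$ with $\lambda_{m_j}>0$, $\sum_{m_j}\lambda_{m_j}=1$, and $\sum_j|\alpha_j^{(N)}|^2=1$ for all large $N$; up to a site-independent isometry acting on the span of the vectors $|m_j\rangle_{L_n}|m'_j\rangle_{R_n}$. **MPSs.** A tensor $A=(A^i)_{i=1}^d$ of square matrices generates $|v^{(N)}(A)\rangle=\sum_{i_1,\dots,i_N}\operatorname{tr}(A^{i_1}\cdots A^{i_N})|i_1\dots i_N\rangle$. It is *normal* if the $A^i$ have no common nontrivial invariant subspace and $\mathbb E_A=\sum_iA^i\otimes A^{i*}$ has the simple eigenvalue $1$, all other eigenvalues having modulus $<1$. Let the MPS be generated by a tensor in canonical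 form $\bigoplus_{j=1}^b\operatorname{diag}(\mu_{j,1},\dots,\mu_{j,m_j})\otimes A_j^i$ (every tensor is of this kind after blocking), or by any tensor generating the same states, where the $A_j$ are normal, $\langle v^{(N)}(A_j)|v^{(N)}(A_k)\rangle\to0$ for $j\neq k$, $|\mu_{j,k}|\le1$, and some $|\mu_{j,k}|=1$. Let $|\phi_N\rangle\propto|v^{(N)}(A)\rangle$ be normalized for all large $N$. Its RG fixed point is the state $|\tilde\phi_N\rangle$ as above for which, up to gauge transformations of the individual blocks, $\big(\sum_iA_j^i\otimes A_k^{i*}\big)^n$ converges for $n\to\infty$ to the mixed transfer matrix of the tensors generating $|\Omega_j\rangle$ and $|\Omega_k\rangle$, for all $j,k$, and for which, for all large $N$, $\alpha_j^{(N)}=c_N\sum_{k:\,|\mu_{j,k}|=1}\mu_{j,k}^N$ with a normalization $c_N$ independent of $j$. **Theorem.** Let $H(\{p_j\})=-\sum_jp_j\log_2p_j$, and suppose that $\lim_{N\to\infty}H(\{|\alpha_j^{(N)}|^2\})$ exists and is not a natural number ($0$ included). Then 1. every MPS $(|\phi_N\rangle)_N$ with RG fixed point $\sum_j\alpha_j^{(N)}|\Omega_j\rangle$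 has long-range nonstabilizerness; 2. the RG fixed point $(|\tilde\phi_N\rangle)_N$ itself has long-range nonstabilizerness, here for arbitrary normalized coefficients $\alpha_j^{(N)}$, whether or not they come from an MPS. -/

import Mathlib

open Filter Topology Matrix
open scoped Kronecker BigOperators

noncomputable section

namespace LRN

/-! ## Qubits, Pauli strings, Clifford unitaries, stabilizer states -/

/-- Computational basis labels of `n` qubits. -/
abbrev Bits (n : ℕ) : Type := Fin n → Fin 2

/-- State vectors (amplitudes in the computational basis) of `n` qubits. -/
abbrev QState (n : ℕ) : Type := Bits n → ℂ

/-- Linear operators on `n` qubits. -/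
abbrev QOp (n : ℕ) : Type := Matrix (Bits n) (Bits n) ℂ

/-- The Pauli matrices `σ⁰ = 1, σ¹, σ², σ³`. -/
def pauli : Fin 4 → Matrix (Fin 2) (Fin 2) ℂ :=
  ![1, !![0, 1; 1, 0], !![0, -Complex.I; Complex.I, 0], !![1, 0; 0, -1]]

/-- The tensor product `σ^{a 0} ⊗ ⋯ ⊗ σ^{a (n-1)}`. -/
def pauliString {n : ℕ} (a : Fin n → Fin 4) : QOp n :=
  fun x y => ∏ k, pauli (a k) (x k) (y k)

/-- Pauli strings with a global phase in `{1, i, -1, -i}`. -/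
def IsPauli {n : ℕ} (P : QOp n) : Prop :=
  ∃ (t : Fin 4) (a : Fin n → Fin 4), P = (Complex.I ^ (t : ℕ)) • pauliString a

/-- Clifford unitaries. -/
def IsClifford {n : ℕ} (U : QOp n) : Prop :=
  U ∈ Matrix.unitaryGroup (Bits n) ℂ ∧ ∀ P : QOp n, IsPauli P → IsPauli (U * P * Uᴴ)

/-- Pure stabilizer states: Clifford unitaries applied to `|0…0⟩`. -/
def IsStabilizerState {n : ℕ} (ψ : QState n) : Prop :=
  ∃ U : QOp n, IsClifford U ∧ ψ = U *ᵥ Pi.single (0 : Bits n) 1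

/-! ## Local quantum circuits on a ring of qubits -/

/-- The right neighbour of a qubit on the ring of `n` qubits. -/
def next {n : ℕ} (k : Fin n) : Fin n := finRotate n k

/-- The two-qubit operator `u` acting on the neighbouring qubits `k`, `k + 1`. -/
def gate {n : ℕ} (k : Fin n) (u : Matrix (Fin 2 × Fin 2) (Fin 2 × Fin 2) ℂ) : QOp n :=
  fun x y =>
    if ∀ j, j ≠ k → j ≠ next k → x j = y j then u (x k, x (next k)) (y k, y (next k)) else 0

/-- A layer: a product of two-qubit unitary gates on pairwise disjoint pairs of neighbouring
qubits. -/
def IsLayer {n : ℕ} (V : QOp n) : Prop :=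
  ∃ g : List (Fin n × Matrix (Fin 2 × Fin 2) (Fin 2 × Fin 2) ℂ),
    (∀ p ∈ g, next p.1 ≠ p.1 ∧ p.2 ∈ Matrix.unitaryGroup (Fin 2 × Fin 2) ℂ) ∧
    g.Pairwise (fun p p' => Disjoint ({p.1, next p.1} : Set (Fin n)) {p'.1, next p'.1}) ∧
    V = (g.map fun p => gate p.1 p.2).prod

/-- `IsCircuit D Q`: `Q = V_D ⋯ V_2 V_1` is a local quantum circuit of depth `D`. -/
inductive IsCircuit {n : ℕ} : ℕ → QOp n → Prop
  | nil : IsCircuit 0 1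
  | layer {D : ℕ} {V Q : QOp n} : IsLayer V → IsCircuit D Q → IsCircuit (D + 1) (V * Q)

/-! ## Short- and long-range nonstabilizerness -/

/-- The trace distance `√(1 - |⟨ψ|φ⟩|²)` of two pure states. -/
def pureDist {n : ℕ} (ψ φ : QState n) : ℝ := Real.sqrt (1 - ‖star ψ ⬝ᵥ φ‖ ^ 2)

/-- `D_N = O(polylog N)`. -/
def IsPolylog (D : ℕ → ℕ) : Prop :=
  ∃ k : ℕ, (fun N => (D N : ℝ)) =O[atTop] fun N : ℕ => Real.log (N : ℝ) ^ k

/-- Short-range nonstabilizerness of a family of states on rings of `N` sites of `q` qubits. -/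
def ShortRangeNonstab {q : ℕ} (Ψ : ∀ N : ℕ, QState (N * q)) : Prop :=
  ∀ ε₀ : ℝ, 0 < ε₀ → ∀ a : ℝ, 0 < a →
    ∃ (D : ℕ → ℕ) (Q : ∀ N : ℕ, QOp (N * q)) (S : ∀ N : ℕ, QState (N * q)),
      IsPolylog D ∧ (∀ N, IsCircuit (D N) (Q N)) ∧ (∀ N, IsStabilizerState (S N)) ∧
      ∀ᶠ N : ℕ in atTop, pureDist (Q N *ᵥ Ψ N) (S N) ≤ ε₀ / (N : ℝ) ^ a

/-- Long-range nonstabilizerness. -/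
def LongRangeNonstab {q : ℕ} (Ψ : ∀ N : ℕ, QState (N * q)) : Prop := ¬ ShortRangeNonstab Ψ

/-- Encoding of a chain of `N` sites, with local basis labelled by `ι`, into `N * q` qubits: the
local basis vector `i` of each site is replaced by the state `V i` of `q` consecutive qubits. -/
def encode {ι : Type} [Fintype ι] [DecidableEq ι] {q N : ℕ} (V : ι → QState q)
    (ψ : (Fin N → ι) → ℂ) : QState (N * q) :=
  fun x => ∑ i : Fin N → ι, ψ i * ∏ n, V (i n) (fun k => x (finProdFinEquiv (n, k)))

/-! ## Matrix product states -/

section MPS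

variable {ι κ κ' : Type} [Fintype ι] [DecidableEq ι] [Fintype κ] [DecidableEq κ]
  [Fintype κ'] [DecidableEq κ']

/-- The (unnormalized) matrix product state `∑ tr(A^{i_1} ⋯ A^{i_N}) |i_1 … i_N⟩`. -/
def mps (A : ι → Matrix κ κ ℂ) (N : ℕ) : (Fin N → ι) → ℂ :=
  fun i => ((List.ofFn fun n => A (i n)).prod).trace

/-- The mixed transfer matrix `∑ᵢ A^i ⊗ (B^i)^*`. -/
def transfer (A : ι → Matrix κ κ ℂ) (B : ι → Matrix κ' κ' ℂ) : Matrix (κ × κ') (κ × κ') ℂ :=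
  ∑ i, A i ⊗ₖ (B i).map star

/-- Normal tensors. Eigenvalues are counted with algebraic multiplicity. -/
structure IsNormal (A : ι → Matrix κ κ ℂ) : Prop where
  irreducible : ∀ W : Submodule ℂ (κ → ℂ), (∀ i, ∀ w ∈ W, A i *ᵥ w ∈ W) → W = ⊥ ∨ W = ⊤
  one_simple : (transfer A A).charpoly.roots.count 1 = 1
  others_lt : ∀ z ∈ (transfer A A).charpoly.roots, z ≠ 1 → ‖z‖ < 1

end MPS

/-- The data of a tensor in canonical form `⨁ⱼ diag(μ_{j,1}, …, μ_{j,m_j}) ⊗ A_j^i`, where the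
`A_j` are normal and generate states that are mutually orthogonal in the thermodynamic limit. -/
structure CanonicalForm (d b : ℕ) where
  bond : Fin b → ℕ
  A : ∀ j, Fin d → Matrix (Fin (bond j)) (Fin (bond j)) ℂ
  mult : Fin b → ℕ
  μ : ∀ j, Fin (mult j) → ℂ
  normal : ∀ j, IsNormal (A j)
  orthogonal : ∀ j k, j ≠ k →
    Tendsto (fun N => star (mps (A j) N) ⬝ᵥ mps (A k) N) atTop (𝓝 0)
  norm_le : ∀ j k, ‖μ j k‖ ≤ 1
  norm_eq : ∃ j k, ‖μ j k‖ = 1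

/-- The tensor in canonical form. -/
def CanonicalForm.tensor {d b : ℕ} (F : CanonicalForm d b) (i : Fin d) :
    Matrix (Σ j, Fin (F.mult j) × Fin (F.bond j)) (Σ j, Fin (F.mult j) × Fin (F.bond j)) ℂ :=
  Matrix.blockDiagonal' fun j => Matrix.diagonal (F.μ j) ⊗ₖ F.A j i

/-! ## Renormalization-group fixed points -/

/-- An RG fixed point `∑ⱼ α_j^{(N)} |Ω_j⟩`. Each qudit has the orthonormal basis `|m_j⟩`, labelled
by pairs `⟨j, m⟩`; `wt ⟨j, m⟩` is the Schmidt weight of `|m_j⟩|m_j⟩` in `|ω_j⟩`. -/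
structure RGFixedPoint (b : ℕ) where
  dim : Fin b → ℕ
  wt : (Σ j, Fin (dim j)) → ℝ
  wt_pos : ∀ m, 0 < wt m
  wt_sum : ∀ j, ∑ m, wt ⟨j, m⟩ = 1
  α : ℕ → Fin b → ℂ
  normalized : ∀ᶠ N in atTop, ∑ j, ‖α N j‖ ^ 2 = 1

namespace RGFixedPoint

variable {b : ℕ} (P : RGFixedPoint b)

/-- Basis labels of a qudit. -/
abbrev Qudit : Type := Σ j, Fin (P.dim j)

/-- Basis labels of a site, which consists of a left and a right qudit `(L, R)`. -/
abbrev Site : Type := P.Qudit × P.Qudit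

/-- `|ω_j⟩ = ∑ₘ √(λ_{m_j}) |m_j⟩_R |m_j⟩_L`, on the right qudit of a site and the left qudit of
the next site. -/
def ω (j : Fin b) (r l : P.Qudit) : ℂ :=
  if r = l ∧ r.1 = j then ((Real.sqrt (P.wt r) : ℝ) : ℂ) else 0

/-- `|Ω_j⟩ = ⨂ₙ |ω_j⟩_{Rₙ, Lₙ₊₁}` on the ring of `N` sites. -/
def Ω (j : Fin b) (N : ℕ) : (Fin N → P.Site) → ℂ :=
  fun i => ∏ n, P.ω j (i n).2 (i (next n)).1

/-- The fixed-point state `∑ⱼ α_j^{(N)} |Ω_j⟩`. -/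
def state (N : ℕ) : (Fin N → P.Site) → ℂ :=
  fun i => ∑ j, P.α N j * P.Ω j N i

/-- The tensor generating `|Ω_j⟩` as a matrix product state. -/
def tensor (j : Fin b) (s : P.Site) : Matrix (Fin (P.dim j)) (Fin (P.dim j)) ℂ :=
  fun a c => if s = (⟨j, a⟩, ⟨j, c⟩) then ((Real.sqrt (P.wt ⟨j, c⟩) : ℝ) : ℂ) else 0

end RGFixedPoint

/-- `P` is the RG fixed point of the canonical form `F`. Blocking `n` sites raises the transfer
matrices to the `n`-th power, and a tensor is determined by its transfer matrix up to an isometry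
on the physical index; so, up to gauge transformations `X j`, the normal blocks flow to the tensors
of the `|Ω_j⟩`. Only the `μ_{j,k}` of modulus one survive, and the coefficients are their power
sums up to normalization. -/
def CanonicalForm.HasRGFixedPoint {d b : ℕ} (F : CanonicalForm d b) (P : RGFixedPoint b) : Prop :=
  (∃ (X : ∀ j, Matrix (Fin (F.bond j)) (Fin (P.dim j)) ℂ)
      (Y : ∀ j, Matrix (Fin (P.dim j)) (Fin (F.bond j)) ℂ),
    (∀ j, X j * Y j = 1 ∧ Y j * X j = 1) ∧
    ∀ j k, Tendsto (fun n : ℕ => transfer (F.A j) (F.A k) ^ n) atTop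
      (𝓝 (transfer (fun s => X j * P.tensor j s * Y j) (fun s => X k * P.tensor k s * Y k)))) ∧
  ∀ᶠ N : ℕ in atTop, ∃ c : ℂ, ∀ j,
    P.α N j = c * ∑ k, if ‖F.μ j k‖ = 1 then F.μ j k ^ N else 0

/-- The Shannon entropy `-∑ⱼ pⱼ log₂ pⱼ`. -/
def shannon {b : ℕ} (p : Fin b → ℝ) : ℝ := -∑ j, p j * Real.logb 2 (p j)

end LRN

end

/-!
A family with short-range nonstabilizerness forces the limiting weights of the blocks, along a
suitable sequence of system sizes, to be uniform on a set of `2 ^ k` blocks. Their entropy is then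
the natural number `k`, and by continuity of the entropy it equals the limit `l`.

Both families are superpositions `∑ⱼ γⱼ |Bⱼ⟩` of matrix product states whose transfer matrices
`E_{jk}` satisfy `E_{jk} ^ n → G_{jk}`, where `G_{jk} = 0` for `j ≠ k` and `G_{jj}` is a projection of
rank one (`RGFixedPoint.IsLimitOf`). Hence distinct blocks are asymptotically orthogonal, no operator
on distant intervals connects them, the single blocks have no correlations between distant intervals
(`RGFixedPoint.IsLimitOf.eventually_factor`), and local operators distinguish the blocks
(`RGFixedPoint.IsLimitOf.exists_probe`). A circuit `Q` of polylogarithmic depth has light cones much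
shorter than these intervals, so if `Q` maps the state close to a stabilizer state `S`, the
correlations of `S` between two distant intervals `A` and `C` are nearly those of the mixture of the
states `Q|Bⱼ⟩` with the weights `pⱼ = lim |γⱼ|²`, which are uncorrelated between `A` and `C`
(`RGFixedPoint.IsLimitOf.eventually_correlations`).

The heart of the matter is `exists_sign_group`. For Pauli strings `a` on `A` and `c` on `C`, the
expectation value `⟨a c⟩_S` has modulus `0` or `1`. If it is not `0`, then `∑ⱼ pⱼ ⟨a⟩ⱼ ⟨c⟩ⱼ` nearly has
modulus one, so every `⟨a⟩ⱼ` is nearly `±1`. The signs, up to a global sign for each `a`, form a group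
of vectors in `{±1}^J`. On the one hand, a nontrivial sign vector has mean nearly `0` in `p`, because
`⟨a⟩_S` has modulus `0` or `1` and modulus one would require a constant sign. On the other hand, two
strings with the same sign vector act on `S` in the same way up to a phase, so the matrix of the
correlations in `S` of operators on `A` that distinguish the blocks with such operators on `C`
factors through a space whose dimension is the number of sign vectors; it has full rank, so there are
at least as many sign vectors as blocks. Since the possible means form a finite set, there is a group
of at least `|J|` sign vectors whose nontrivial elements have mean exactly `0`
(`uniform_of_approx_sign_group`). They are an orthonormal basis of `L²(p)`, so that
`pⱼ = 1 / |J|`, where `|J|` is the order of an elementary abelian `2`-group.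

Only the sequence of system sizes depends on the family. For a fixed point with arbitrary
coefficients it comes from compactness. For a matrix product state it is chosen such that the powers
of all `μ j k` of modulus one tend to `1`, where the weights both of the state and of its fixed point
converge to the same limit.
-/

set_option linter.unusedSectionVars false

namespace LRN

/-! ### Norms and bounded operators -/

section Norms

variable {X Y : Type*} [Fintype X] [Fintype Y]

/-- The Hilbert space norm of a vector of amplitudes. -/
noncomputable def nrm (u : X → ℂ) : ℝ := ‖(WithLp.toLp 2 u : EuclideanSpace ℂ X)‖

lemma nrm_nonneg (u : X → ℂ) : 0 ≤ nrm u := norm_nonneg _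

lemma star_dotProduct_eq_inner (u w : X → ℂ) :
    star u ⬝ᵥ w = inner ℂ (WithLp.toLp 2 u : EuclideanSpace ℂ X) (WithLp.toLp 2 w) := by
  rw [EuclideanSpace.inner_eq_star_dotProduct, dotProduct_comm]

lemma norm_star_dotProduct_le (u w : X → ℂ) : ‖star u ⬝ᵥ w‖ ≤ nrm u * nrm w := by
  rw [star_dotProduct_eq_inner]; exact norm_inner_le_norm _ _

lemma star_dotProduct_self (u : X → ℂ) : star u ⬝ᵥ u = ((nrm u ^ 2 : ℝ) : ℂ) := by
  rw [star_dotProduct_eq_inner, inner_self_eq_norm_sq_to_K]; simp [nrm]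

lemma nrm_sub_sq (u w : X → ℂ) :
    nrm (u - w) ^ 2 = nrm u ^ 2 - 2 * (star u ⬝ᵥ w).re + nrm w ^ 2 := by
  rw [star_dotProduct_eq_inner]
  exact @norm_sub_sq ℂ _ _ _ _ (WithLp.toLp 2 u : EuclideanSpace ℂ X) (WithLp.toLp 2 w)

lemma nrm_smul (c : ℂ) (u : X → ℂ) : nrm (c • u) = ‖c‖ * nrm u := by
  simp [nrm, WithLp.toLp_smul, norm_smul]

lemma eq_zero_of_nrm {u : X → ℂ} (h : nrm u = 0) : u = 0 := by
  simpa [nrm] using h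

lemma star_dotProduct_mulVec (X' : Matrix X X ℂ) (u w : X → ℂ) :
    star u ⬝ᵥ (X' *ᵥ w) = star (X'ᴴ *ᵥ u) ⬝ᵥ w := by
  rw [star_mulVec, conjTranspose_conjTranspose, dotProduct_mulVec]

lemma nrm_mulVec_of_conjTranspose_mul [DecidableEq X] {U : Matrix X X ℂ} (hU : Uᴴ * U = 1) (u : X → ℂ) :
    nrm (U *ᵥ u) = nrm u := by
  have h : ((nrm (U *ᵥ u) ^ 2 : ℝ) : ℂ) = ((nrm u ^ 2 : ℝ) : ℂ) := by
    rw [← star_dotProduct_self, ← star_dotProduct_self, star_dotProduct_mulVec, mulVec_mulVec, hU,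
      one_mulVec]
  exact (pow_left_inj₀ (nrm_nonneg _) (nrm_nonneg _) two_ne_zero).1 (by exact_mod_cast h)

/-- `OpBound c T`: the operator norm of `T` is at most `c`. -/
def OpBound (c : ℝ) (T : Matrix X X ℂ) : Prop := ∀ w : X → ℂ, nrm (T *ᵥ w) ≤ c * nrm w

lemma OpBound.norm_le {c : ℝ} {T : Matrix X X ℂ} (hT : OpBound c T) (u w : X → ℂ) :
    ‖star u ⬝ᵥ (T *ᵥ w)‖ ≤ nrm u * (c * nrm w) :=
  (norm_star_dotProduct_le _ _).trans (mul_le_mul_of_nonneg_left (hT w) (nrm_nonneg _))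

lemma OpBound.mul {c c' : ℝ} (hc : 0 ≤ c) {T T' : Matrix X X ℂ} (hT : OpBound c T)
    (hT' : OpBound c' T') : OpBound (c * c') (T * T') := fun w => by
  rw [← mulVec_mulVec, mul_assoc]
  exact (hT _).trans (mul_le_mul_of_nonneg_left (hT' w) hc)

lemma OpBound.mono {c c' : ℝ} (h : c ≤ c') {T : Matrix X X ℂ} (hT : OpBound c T) : OpBound c' T :=
  fun w => (hT w).trans (mul_le_mul_of_nonneg_right h (nrm_nonneg _))

lemma opBound_of_conjTranspose_mul [DecidableEq X] {U : Matrix X X ℂ} (hU : Uᴴ * U = 1) :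
    OpBound 1 U := fun w => by rw [nrm_mulVec_of_conjTranspose_mul hU, one_mul]

/-- Positive multiples of orthogonal projections. -/
lemma opBound_of_mul_self {c : ℝ} (hc : 0 ≤ c) {T : Matrix X X ℂ} (hT : Tᴴ = T)
    (h : T * T = (c : ℂ) • T) : OpBound c T := fun w => by
  rcases (nrm_nonneg (T *ᵥ w)).eq_or_lt with h0 | h0
  · rw [← h0]; exact mul_nonneg hc (nrm_nonneg _)
  have h1 : star (T *ᵥ w) ⬝ᵥ (T *ᵥ w) = (c : ℂ) * (star w ⬝ᵥ (T *ᵥ w)) := by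
    conv_lhs => rw [star_mulVec, hT, ← dotProduct_mulVec, mulVec_mulVec, h, smul_mulVec,
      dotProduct_smul, smul_eq_mul]
  have h2 := congrArg norm h1
  rw [star_dotProduct_self, Complex.norm_real, norm_mul, Complex.norm_real, Real.norm_of_nonneg hc,
    Real.norm_of_nonneg (sq_nonneg _)] at h2
  have h3 := mul_le_mul_of_nonneg_left (norm_star_dotProduct_le w (T *ᵥ w)) hc
  rw [← h2, sq, ← mul_assoc] at h3
  exact le_of_mul_le_mul_right h3 h0

section Equiv

variable (e : X ≃ Y) (u w : Y → ℂ)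

lemma star_comp_dotProduct_mulVec (T : Matrix X X ℂ) :
    star (u ∘ e) ⬝ᵥ (T *ᵥ (w ∘ e)) = star u ⬝ᵥ (T.submatrix e.symm e.symm *ᵥ w) := by
  rw [Matrix.submatrix_mulVec_equiv, Equiv.symm_symm, dotProduct, dotProduct,
    ← e.sum_comp]
  simp

lemma nrm_comp : nrm (u ∘ e) = nrm u := by
  have h : star (u ∘ e) ⬝ᵥ (u ∘ e) = star u ⬝ᵥ u := by
    rw [dotProduct, dotProduct, ← e.sum_comp]; rfl
  rw [star_dotProduct_self, star_dotProduct_self] at h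
  exact (pow_left_inj₀ (nrm_nonneg _) (nrm_nonneg _) two_ne_zero).1 (by exact_mod_cast h)

variable {e} in
lemma OpBound.submatrix_symm {c : ℝ} {T : Matrix X X ℂ} (hT : OpBound c T) :
    OpBound c (T.submatrix e.symm e.symm) := fun w => by
  rw [Matrix.submatrix_mulVec_equiv, Equiv.symm_symm, nrm_comp, ← nrm_comp e w]
  exact hT _

end Equiv

end Norms

/-! ### Product operators and local operators -/

section Local

variable {ι β : Type*} [Fintype ι] [Fintype β] [DecidableEq β]

/-- The tensor product of the one-site operators `M k`. -/
def prodOp (M : ι → Matrix β β ℂ) : Matrix (ι → β) (ι → β) ℂ :=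
  fun x y => ∏ k, M k (x k) (y k)

lemma prodOp_one : prodOp (fun _ : ι => (1 : Matrix β β ℂ)) = 1 := by
  ext x y
  simp only [prodOp, Matrix.one_apply, Finset.prod_ite_zero, funext_iff]
  simp

lemma prodOp_mul [DecidableEq ι] (M M' : ι → Matrix β β ℂ) :
    prodOp M * prodOp M' = prodOp (fun k => M k * M' k) := by
  ext x z
  simp only [prodOp, Matrix.mul_apply, Finset.prod_univ_sum, Fintype.piFinset_univ,
    Finset.prod_mul_distrib]

lemma prodOp_conjTranspose (M : ι → Matrix β β ℂ) :
    (prodOp M)ᴴ = prodOp (fun k => (M k)ᴴ) := by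
  ext x z
  simp [prodOp, Matrix.conjTranspose_apply]

/-- The operators supported on the region `R`: the span of the product operators that are trivial
outside of `R`. -/
def Loc (R : Set ι) : Submodule ℂ (Matrix (ι → β) (ι → β) ℂ) :=
  Submodule.span ℂ {T | ∃ M : ι → Matrix β β ℂ, (∀ k ∉ R, M k = 1) ∧ T = prodOp M}

lemma prodOp_mem_Loc {R : Set ι} {M : ι → Matrix β β ℂ} (h : ∀ k ∉ R, M k = 1) :
    prodOp M ∈ Loc R := Submodule.subset_span ⟨M, h, rfl⟩

lemma Loc_mono {R R' : Set ι} (h : R ⊆ R') : Loc (β := β) R ≤ Loc R' := by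
  refine Submodule.span_mono ?_
  rintro _ ⟨M, hM, rfl⟩
  exact ⟨M, fun k hk => hM k fun hk' => hk (h hk'), rfl⟩

lemma Loc_mul [DecidableEq ι] {R : Set ι} {T T' : Matrix (ι → β) (ι → β) ℂ} (hT : T ∈ Loc R)
    (hT' : T' ∈ Loc R) : T * T' ∈ Loc R := by
  induction hT, hT' using Submodule.span_induction₂ with
  | mem_mem x y hx hy =>
    obtain ⟨M, hM, rfl⟩ := hx
    obtain ⟨M', hM', rfl⟩ := hy
    rw [prodOp_mul]
    exact prodOp_mem_Loc fun k hk => by rw [hM k hk, hM' k hk, one_mul]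
  | zero_left y hy => simp
  | zero_right x hx => simp
  | add_left x y z _ _ _ h1 h2 => rw [add_mul]; exact add_mem h1 h2
  | add_right x y z _ _ _ h1 h2 => rw [mul_add]; exact add_mem h1 h2
  | smul_left r x y _ _ h => rw [smul_mul_assoc]; exact Submodule.smul_mem _ _ h
  | smul_right r x y _ _ h => rw [mul_smul_comm]; exact Submodule.smul_mem _ _ h

lemma Loc_commute [DecidableEq ι] {R R' : Set ι} (hd : Disjoint R R')
    {T T' : Matrix (ι → β) (ι → β) ℂ} (hT : T ∈ Loc R) (hT' : T' ∈ Loc R') : T * T' = T' * T := by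
  induction hT, hT' using Submodule.span_induction₂ with
  | mem_mem x y hx hy =>
    obtain ⟨M, hM, rfl⟩ := hx
    obtain ⟨M', hM', rfl⟩ := hy
    rw [prodOp_mul, prodOp_mul]
    congr 1
    funext k
    by_cases hk : k ∈ R
    · rw [hM' k (Set.disjoint_left.1 hd hk), one_mul, mul_one]
    · rw [hM k hk, one_mul, mul_one]
  | zero_left y hy => simp
  | zero_right x hx => simp
  | add_left x y z _ _ _ h1 h2 => rw [add_mul, mul_add, h1, h2]
  | add_right x y z _ _ _ h1 h2 => rw [add_mul, mul_add, h1, h2]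
  | smul_left r x y _ _ h => rw [smul_mul_assoc, mul_smul_comm, h]
  | smul_right r x y _ _ h => rw [smul_mul_assoc, mul_smul_comm, h]

/-- Locality in terms of the entries: the operator is diagonal outside of `R`, and its entries depend
on the labels in `R` only. -/
def IsEntryLocal (R : Set ι) (T : Matrix (ι → β) (ι → β) ℂ) : Prop :=
  (∀ x y, (∃ k ∉ R, x k ≠ y k) → T x y = 0) ∧
  ∀ x y x' y', (∀ k ∈ R, x k = x' k ∧ y k = y' k) →
    (∀ k ∉ R, x k = y k ∧ x' k = y' k) → T x y = T x' y'

lemma IsEntryLocal.mem_Loc [Inhabited β] {R : Set ι} {T : Matrix (ι → β) (ι → β) ℂ}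
    (h : IsEntryLocal R T) : T ∈ Loc R := by
  obtain ⟨h0, h1⟩ := h
  classical
  let M : (ι → β) → (ι → β) → ι → Matrix β β ℂ :=
    fun s t k => if k ∈ R then Matrix.single (s k) (t k) 1 else 1
  let r : (ι → β) → ι → β := fun x k => if k ∈ R then x k else default
  have hT : T = ∑ s, ∑ t, (if s = r s ∧ t = r t then T s t else 0) • prodOp (M s t) := by
    ext x y
    simp only [Matrix.sum_apply, Matrix.smul_apply, smul_eq_mul]
    rw [Finset.sum_eq_single (r x), Finset.sum_eq_single (r y)]
    · have hr : ∀ x, r (r x) = r x := fun x => by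
        funext k; by_cases hk : k ∈ R <;> simp [r, hk]
      rw [if_pos ⟨(hr x).symm, (hr y).symm⟩]
      by_cases hxy : ∃ k ∉ R, x k ≠ y k
      · obtain ⟨k, hk, hne⟩ := hxy
        rw [h0 x y ⟨k, hk, hne⟩, prodOp, Finset.prod_eq_zero (Finset.mem_univ k), mul_zero]
        simp [M, hk, hne]
      · push Not at hxy
        rw [h1 x y (r x) (r y) (fun k hk => by simp [r, hk])
          (fun k hk => ⟨hxy k hk, by simp [r, hk]⟩), prodOp, Finset.prod_eq_one, mul_one]
        intro k _
        by_cases hk : k ∈ R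
        · simp [M, r, hk]
        · simp [M, hk, hxy k hk]
    · intro t _ ht
      by_cases h : r x = r (r x) ∧ t = r t
      · have : ∃ k ∈ R, t k ≠ y k := by
          by_contra! hc
          apply ht
          rw [h.2]
          funext k
          by_cases hk : k ∈ R <;> simp [r, hk, hc]
        obtain ⟨k, hk, hne⟩ := this
        rw [prodOp, Finset.prod_eq_zero (Finset.mem_univ k), mul_zero]
        simp [M, hk, hne]
      · rw [if_neg h, zero_mul]
    · simp
    · intro s _ hs
      refine Finset.sum_eq_zero fun t _ => ?_
      by_cases h : s = r s ∧ t = r t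
      · have : ∃ k ∈ R, s k ≠ x k := by
          by_contra! hc
          apply hs
          rw [h.1]
          funext k
          by_cases hk : k ∈ R <;> simp [r, hk, hc]
        obtain ⟨k, hk, hne⟩ := this
        rw [prodOp, Finset.prod_eq_zero (Finset.mem_univ k), mul_zero]
        simp [M, hk, hne]
      · rw [if_neg h, zero_mul]
    · simp
  rw [hT]
  refine sum_mem fun s _ => sum_mem fun t _ => Submodule.smul_mem _ _ (prodOp_mem_Loc ?_)
  intro k hk
  simp [M, hk]

end Local

/-! ### Light cones of local circuits -/

section LightCone

variable {n : ℕ}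

/-- The pair of qubits on which a gate acts. -/
def pair (k : Fin n) : Set (Fin n) := {k, next k}

lemma gate_mem_Loc (k : Fin n) (u : Matrix (Fin 2 × Fin 2) (Fin 2 × Fin 2) ℂ) :
    gate k u ∈ Loc (β := Fin 2) (pair k) := by
  refine IsEntryLocal.mem_Loc ⟨?_, ?_⟩
  · rintro x y ⟨j, hj, hne⟩
    simp only [pair, Set.mem_insert_iff, Set.mem_singleton_iff, not_or] at hj
    exact if_neg fun h => hne (h j hj.1 hj.2)
  · intro x y x' y' hR hR'
    have h1 : ∀ j, j ≠ k → j ≠ next k → x j = y j := fun j h h' => (hR' j (by simp [pair, h, h'])).1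
    have h2 : ∀ j, j ≠ k → j ≠ next k → x' j = y' j :=
      fun j h h' => (hR' j (by simp [pair, h, h'])).2
    have hk := hR k (by simp [pair])
    have hk' := hR (next k) (by simp [pair])
    simp only [gate]
    rw [if_pos h1, if_pos h2, hk.1, hk.2, hk'.1, hk'.2]

lemma gate_mul (k : Fin n) (hk : next k ≠ k) (u u' : Matrix (Fin 2 × Fin 2) (Fin 2 × Fin 2) ℂ) :
    gate k u * gate k u' = gate k (u * u') := by
  ext x z
  rw [Matrix.mul_apply]
  let f : Fin 2 × Fin 2 → Bits n := fun a => Function.update (Function.update x k a.1) (next k) a.2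
  have f1 : ∀ a, f a k = a.1 := fun a => by simp [f, Function.update_of_ne hk.symm]
  have f2 : ∀ a, f a (next k) = a.2 := fun a => by simp [f]
  have f3 : ∀ a j, j ≠ k → j ≠ next k → f a j = x j := fun a j h h' => by
    simp [f, Function.update_of_ne h, Function.update_of_ne h']
  have hf : Function.Injective f := fun a a' h =>
    Prod.ext (by rw [← f1 a, h, f1]) (by rw [← f2 a, h, f2])
  rw [← Fintype.sum_of_injective f hf (fun a => gate k u x (f a) * gate k u' (f a) z) _ ?_
    (fun _ => rfl)]
  · have e1 : ∀ a, gate k u x (f a) = u (x k, x (next k)) a := fun a => by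
      rw [gate, if_pos (fun j h h' => (f3 a j h h').symm), f1, f2]
    have e2 : ∀ a, gate k u' (f a) z =
        if ∀ j, j ≠ k → j ≠ next k → x j = z j then u' a (z k, z (next k)) else 0 := fun a => by
      rw [gate, f1, f2]
      refine if_congr (forall_congr' fun j => forall_congr' fun h => forall_congr' fun h' => ?_)
        rfl rfl
      rw [f3 a j h h']
    simp only [e1, e2]
    rw [gate]
    split_ifs <;> simp [Matrix.mul_apply]
  · intro y hy
    rw [gate, if_neg, zero_mul]
    intro h
    refine hy ⟨(y k, y (next k)), ?_⟩
    funext j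
    by_cases hj : j = next k
    · rw [hj, f2]
    by_cases hj' : j = k
    · rw [hj', f1]
    rw [f3 _ _ hj' hj, h j hj' hj]

lemma gate_one (k : Fin n) : gate k 1 = 1 := by
  ext x y
  rw [gate, Matrix.one_apply, Matrix.one_apply]
  by_cases h : x = y
  · subst h; simp
  · rw [if_neg h]
    split_ifs with h1 h2
    · exact absurd (funext fun j => by
        simp only [Prod.mk.injEq] at h2
        by_cases hj : j = k
        · rw [hj, h2.1]
        by_cases hj' : j = next k
        · rw [hj', h2.2]
        exact h1 j hj hj') h
    · rfl
    · rfl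

lemma gate_conjTranspose (k : Fin n) (u : Matrix (Fin 2 × Fin 2) (Fin 2 × Fin 2) ℂ) :
    (gate k u)ᴴ = gate k uᴴ := by
  ext x y
  simp only [gate, Matrix.conjTranspose_apply]
  by_cases h : ∀ j, j ≠ k → j ≠ next k → x j = y j
  · rw [if_pos h, if_pos fun j h1 h2 => (h j h1 h2).symm]
  · rw [if_neg h, if_neg fun h' => h fun j h1 h2 => (h' j h1 h2).symm, star_zero]

lemma gate_mul_conjTranspose {k : Fin n} (hk : next k ≠ k)
    {u : Matrix (Fin 2 × Fin 2) (Fin 2 × Fin 2) ℂ} (hu : u ∈ Matrix.unitaryGroup (Fin 2 × Fin 2) ℂ) :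
    gate k u * (gate k u)ᴴ = 1 := by
  rw [gate_conjTranspose, gate_mul k hk, ← gate_one k]
  congr 1
  exact Matrix.mem_unitaryGroup_iff.1 hu

lemma IsLayer.conjTranspose {V : QOp n} (hV : IsLayer V) : IsLayer Vᴴ := by
  obtain ⟨g, hg, hd, rfl⟩ := hV
  refine ⟨(g.map fun p => (p.1, p.2ᴴ)).reverse, ?_, ?_, ?_⟩
  · intro p hp
    simp only [List.mem_reverse, List.mem_map] at hp
    obtain ⟨p', hp', rfl⟩ := hp
    exact ⟨(hg p' hp').1, Unitary.star_mem (hg p' hp').2⟩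
  · rw [List.pairwise_reverse, List.pairwise_map]
    exact hd.imp fun h => h.symm
  · rw [Matrix.conjTranspose_list_prod, List.map_map, List.map_reverse, List.map_map]
    congr 2
    refine List.map_congr_left fun p _ => ?_
    exact gate_conjTranspose _ _

lemma IsLayer.mul_conjTranspose {V : QOp n} (hV : IsLayer V) : V * Vᴴ = 1 := by
  obtain ⟨g, hg, -, rfl⟩ := hV
  refine Matrix.mem_unitaryGroup_iff.1 (Submonoid.list_prod_mem _ ?_)
  intro V hV
  obtain ⟨p, hp, rfl⟩ := List.mem_map.1 hV
  exact Matrix.mem_unitaryGroup_iff.2 (gate_mul_conjTranspose (hg p hp).1 (hg p hp).2)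

/-- Conjugating by a layer enlarges the support by the pairs that meet it. -/
lemma conj_gates_mem_Loc (g : List (Fin n × Matrix (Fin 2 × Fin 2) (Fin 2 × Fin 2) ℂ))
    (hg : ∀ p ∈ g, next p.1 ≠ p.1 ∧ p.2 ∈ Matrix.unitaryGroup (Fin 2 × Fin 2) ℂ)
    (hd : g.Pairwise (fun p p' => Disjoint (pair p.1) (pair p'.1)))
    {R : Set (Fin n)} {T : QOp n} (hT : T ∈ Loc R) :
    (g.map fun p => gate p.1 p.2).prod * T * ((g.map fun p => gate p.1 p.2).prod)ᴴ ∈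
      Loc (R ∪ {k | ∃ p ∈ g, k ∈ pair p.1 ∧ ¬ Disjoint (pair p.1) R}) := by
  induction g with
  | nil => simpa using hT
  | cons p g ih =>
    rw [List.pairwise_cons] at hd
    have ih' := ih (fun p hp => hg p (List.mem_cons_of_mem _ hp)) hd.2
    rw [List.map_cons, List.prod_cons, Matrix.conjTranspose_mul]
    set V := (g.map fun p => gate p.1 p.2).prod
    have hp := hg p List.mem_cons_self
    have hre : gate p.1 p.2 * V * T * (Vᴴ * (gate p.1 p.2)ᴴ) =
        gate p.1 p.2 * (V * T * Vᴴ) * (gate p.1 p.2)ᴴ := by simp only [Matrix.mul_assoc]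
    rw [hre]
    have hmono : R ∪ {k | ∃ p ∈ g, k ∈ pair p.1 ∧ ¬ Disjoint (pair p.1) R} ⊆
        R ∪ {k | ∃ p' ∈ p :: g, k ∈ pair p'.1 ∧ ¬ Disjoint (pair p'.1) R} := by
      rintro k (hk | ⟨p', hp', hk⟩)
      · exact Or.inl hk
      · exact Or.inr ⟨p', List.mem_cons_of_mem _ hp', hk⟩
    by_cases hpR : Disjoint (pair p.1) R
    · have hdis : Disjoint (pair p.1)
          (R ∪ {k | ∃ p ∈ g, k ∈ pair p.1 ∧ ¬ Disjoint (pair p.1) R}) := by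
        rw [Set.disjoint_union_right]
        refine ⟨hpR, Set.disjoint_left.2 ?_⟩
        rintro k hk ⟨p', hp', hk', -⟩
        exact Set.disjoint_left.1 (hd.1 p' hp') hk hk'
      rw [Loc_commute hdis (gate_mem_Loc _ _) ih', Matrix.mul_assoc, gate_mul_conjTranspose hp.1 hp.2,
        Matrix.mul_one]
      exact Loc_mono hmono ih'
    · have hsub : pair p.1 ⊆ R ∪ {k | ∃ p' ∈ p :: g, k ∈ pair p'.1 ∧ ¬ Disjoint (pair p'.1) R} :=
        fun k hk => Or.inr ⟨p, List.mem_cons_self, hk, hpR⟩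
      refine Loc_mul (Loc_mul (Loc_mono hsub (gate_mem_Loc _ _)) (Loc_mono hmono ih')) ?_
      rw [gate_conjTranspose]
      exact Loc_mono hsub (gate_mem_Loc _ _)

/-- The qubits `s, …, t - 1`. -/
def interval (n s t : ℕ) : Set (Fin n) := {k | s ≤ k.val ∧ k.val < t}

lemma next_val (k : Fin n) : (next k).val = if k.val + 1 = n then 0 else k.val + 1 := by
  cases n with
  | zero => exact k.elim0
  | succ m =>
    rw [next]
    split_ifs with h
    · have : k = Fin.last m := Fin.ext (by simpa using h)
      subst this; simp
    · rw [coe_finRotate_of_ne_last]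
      rintro rfl
      simp at h

/-- Intervals away from the cut of the ring grow by one qubit at each end under a layer. -/
lemma IsLayer.conj_mem_Loc {V : QOp n} (hV : IsLayer V) {s t : ℕ} (hs : 1 ≤ s) (ht : t + 1 ≤ n)
    {T : QOp n} (hT : T ∈ Loc (interval n s t)) :
    V * T * Vᴴ ∈ Loc (interval n (s - 1) (t + 1)) := by
  obtain ⟨g, hg, hd, rfl⟩ := hV
  refine Loc_mono ?_ (conj_gates_mem_Loc g hg hd hT)
  rintro k (⟨h1, h2⟩ | ⟨p, -, hk, hnd⟩)
  · exact ⟨by omega, by omega⟩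
  · obtain ⟨j, hj, hjs, hjt⟩ := Set.not_disjoint_iff.1 hnd
    have hn := next_val p.1
    simp only [pair, Set.mem_insert_iff, Set.mem_singleton_iff, Fin.ext_iff] at hk hj
    simp only [interval, Set.mem_ofPred_eq]
    split_ifs at hn <;> omega

lemma IsCircuit.mul_conjTranspose {D : ℕ} {Q : QOp n} (hQ : IsCircuit D Q) : Q * Qᴴ = 1 := by
  induction hQ with
  | nil => simp
  | @layer D V Q hV _ ih =>
    rw [Matrix.conjTranspose_mul, Matrix.mul_assoc, ← Matrix.mul_assoc Q, ih, Matrix.one_mul,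
      hV.mul_conjTranspose]

lemma IsCircuit.conjTranspose_mul {D : ℕ} {Q : QOp n} (hQ : IsCircuit D Q) : Qᴴ * Q = 1 :=
  mul_eq_one_comm.1 hQ.mul_conjTranspose

lemma IsCircuit.conj_mem_Loc {D : ℕ} {Q : QOp n} (hQ : IsCircuit D Q) {s t : ℕ} (hs : D ≤ s)
    (ht : t + D ≤ n) {T : QOp n} (hT : T ∈ Loc (interval n s t)) :
    Q * T * Qᴴ ∈ Loc (interval n (s - D) (t + D)) := by
  induction hQ with
  | nil => simpa using hT
  | @layer D V Q hV _ ih =>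
    have h := hV.conj_mem_Loc (by omega) (by omega) (ih (by omega) (by omega))
    have e : V * Q * T * (V * Q)ᴴ = V * (Q * T * Qᴴ) * Vᴴ := by
      simp only [Matrix.conjTranspose_mul, Matrix.mul_assoc]
    rw [e]
    convert h using 3 <;> omega

lemma IsCircuit.conjTranspose_conj_mem_Loc {D : ℕ} {Q : QOp n} (hQ : IsCircuit D Q) {s t : ℕ}
    (hs : D ≤ s) (ht : t + D ≤ n) {T : QOp n} (hT : T ∈ Loc (interval n s t)) :
    Qᴴ * T * Q ∈ Loc (interval n (s - D) (t + D)) := by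
  induction hQ generalizing s t T with
  | nil => simpa using hT
  | @layer D V Q hV _ ih =>
    have h1 := hV.conjTranspose.conj_mem_Loc (by omega) (by omega) hT
    rw [Matrix.conjTranspose_conjTranspose] at h1
    have h2 := ih (by omega) (by omega) h1
    have e : (V * Q)ᴴ * T * (V * Q) = Qᴴ * (Vᴴ * T * V) * Q := by
      simp only [Matrix.conjTranspose_mul, Matrix.mul_assoc]
    rw [e]
    convert h2 using 3 <;> omega

end LightCone

/-! ### Pauli strings -/

section Pauli

lemma pauli_mul (a b : Fin 4) : ∃ (z : ℂ) (c : Fin 4), ‖z‖ = 1 ∧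
    pauli a * pauli b = z • pauli c ∧ (a = 0 → b = 0 → c = 0) := by
  refine ⟨(![![1, 1, 1, 1], ![1, 1, Complex.I, -Complex.I], ![1, -Complex.I, 1, Complex.I],
    ![1, Complex.I, -Complex.I, 1]] : Fin 4 → Fin 4 → ℂ) a b,
    (![![0, 1, 2, 3], ![1, 0, 3, 2], ![2, 3, 0, 1], ![3, 2, 1, 0]] : Fin 4 → Fin 4 → Fin 4) a b,
    ?_, ?_, ?_⟩
  · fin_cases a <;> fin_cases b <;> simp
  · fin_cases a <;> fin_cases b <;> ext i j <;> fin_cases i <;> fin_cases j <;>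
      simp [pauli, Matrix.mul_apply, Fin.sum_univ_two]
  · rintro rfl rfl; rfl

lemma pauli_conjTranspose (a : Fin 4) : (pauli a)ᴴ = pauli a := by
  fin_cases a <;> ext i j <;> fin_cases i <;> fin_cases j <;>
    simp [pauli, Matrix.conjTranspose_apply]

lemma pauli_mul_self (a : Fin 4) : pauli a * pauli a = 1 := by
  fin_cases a <;> ext i j <;> fin_cases i <;> fin_cases j <;>
      simp [pauli, Matrix.mul_apply, Fin.sum_univ_two]

/-- Every operator on a qubit is a combination of Pauli matrices; the identity needs `σ⁰` only. -/
lemma exists_pauli_expansion (M : Matrix (Fin 2) (Fin 2) ℂ) : ∃ c : Fin 4 → ℂ,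
    M = ∑ a, c a • pauli a ∧ (M = 1 → ∀ a, a ≠ 0 → c a = 0) := by
  refine ⟨![(M 0 0 + M 1 1) / 2, (M 0 1 + M 1 0) / 2, Complex.I * (M 0 1 - M 1 0) / 2,
    (M 0 0 - M 1 1) / 2], ?_, ?_⟩
  · ext i j
    fin_cases i <;> fin_cases j <;> simp [pauli, Fin.sum_univ_four] <;> ring_nf <;> simp <;> ring
  · rintro rfl a ha
    fin_cases a <;> simp at ha ⊢

variable {n : ℕ}

/-- The Pauli string labelled by `a` acts trivially outside of `R`. -/
def SuppIn (R : Set (Fin n)) (a : Fin n → Fin 4) : Prop := ∀ k ∉ R, a k = 0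

lemma pauliString_eq_prodOp (a : Fin n → Fin 4) : pauliString a = prodOp fun k => pauli (a k) := rfl

lemma SuppIn.mem_Loc {R : Set (Fin n)} {a : Fin n → Fin 4} (h : SuppIn R a) :
    pauliString a ∈ Loc (β := Fin 2) R :=
  prodOp_mem_Loc fun k hk => by rw [h k hk]; rfl

lemma pauliString_zero : pauliString (0 : Fin n → Fin 4) = 1 := by
  rw [pauliString_eq_prodOp, ← prodOp_one]; rfl

lemma pauliString_conjTranspose (a : Fin n → Fin 4) : (pauliString a)ᴴ = pauliString a := by
  simp only [pauliString_eq_prodOp, prodOp_conjTranspose, pauli_conjTranspose]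

lemma pauliString_mul_self (a : Fin n → Fin 4) : pauliString a * pauliString a = 1 := by
  simp only [pauliString_eq_prodOp, prodOp_mul, pauli_mul_self, prodOp_one]

lemma pauliString_conjTranspose_mul (a : Fin n → Fin 4) :
    (pauliString a)ᴴ * pauliString a = 1 := by
  rw [pauliString_conjTranspose, pauliString_mul_self]

lemma pauliString_mul (a b : Fin n → Fin 4) : ∃ (z : ℂ) (c : Fin n → Fin 4), ‖z‖ = 1 ∧
    pauliString a * pauliString b = z • pauliString c ∧
    ∀ R : Set (Fin n), SuppIn R a → SuppIn R b → SuppIn R c := by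
  choose z c h1 h2 h3 using pauli_mul
  refine ⟨∏ k, z (a k) (b k), fun k => c (a k) (b k), ?_, ?_, ?_⟩
  · rw [norm_prod]; exact Finset.prod_eq_one fun k _ => h1 _ _
  · simp only [pauliString_eq_prodOp, prodOp_mul, h2]
    ext x y
    simp [prodOp, Finset.prod_mul_distrib]
  · exact fun R ha hb k hk => h3 _ _ (ha k hk) (hb k hk)

/-- A local operator is a combination of Pauli strings supported on the same region. -/
lemma exists_pauliString_expansion {R : Set (Fin n)} {T : QOp n} (hT : T ∈ Loc (β := Fin 2) R) :
    ∃ x : (Fin n → Fin 4) → ℂ, T = ∑ a, x a • pauliString a ∧ ∀ a, ¬ SuppIn R a → x a = 0 := by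
  induction hT using Submodule.span_induction with
  | mem T hT =>
    obtain ⟨M, hM, rfl⟩ := hT
    choose c hc hc' using exists_pauli_expansion
    refine ⟨fun a => ∏ k, c (M k) (a k), ?_, ?_⟩
    · ext x y
      have h : ∀ k, M k (x k) (y k) = ∑ a, c (M k) a * pauli a (x k) (y k) := fun k => by
        conv_lhs => rw [hc (M k)]
        simp [Matrix.sum_apply]
      simp only [prodOp, h, Finset.prod_univ_sum, Fintype.piFinset_univ, Matrix.sum_apply,
        Matrix.smul_apply, pauliString, smul_eq_mul, Finset.prod_mul_distrib]
    · intro a ha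
      simp only [SuppIn, not_forall] at ha
      obtain ⟨k, hk, hne⟩ := ha
      exact Finset.prod_eq_zero (Finset.mem_univ k) (hc' _ (hM k hk) _ hne)
  | zero => exact ⟨0, by simp, fun _ _ => rfl⟩
  | add T T' _ _ h h' =>
    obtain ⟨x, rfl, hx⟩ := h
    obtain ⟨y, rfl, hy⟩ := h'
    exact ⟨x + y, by simp [add_smul, Finset.sum_add_distrib],
      fun a ha => by simp [hx a ha, hy a ha]⟩
  | smul r T _ h =>
    obtain ⟨x, rfl, hx⟩ := h
    exact ⟨r • x, by simp [Finset.smul_sum, mul_smul], fun a ha => by simp [hx a ha]⟩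

end Pauli

/-! ### Expectation values in stabilizer states -/

section Stabilizer

variable {n : ℕ}

/-- The expectation value `⟨ψ|T|ψ⟩`. -/
def expv {X : Type*} [Fintype X] (ψ : X → ℂ) (T : Matrix X X ℂ) : ℂ := star ψ ⬝ᵥ (T *ᵥ ψ)

section expv

variable {X : Type*} [Fintype X] (ψ : X → ℂ)

lemma expv_smul (c : ℂ) (T : Matrix X X ℂ) : expv ψ (c • T) = c * expv ψ T := by
  simp [expv, Matrix.smul_mulVec]

lemma expv_sum {ι : Type*} (s : Finset ι) (T : ι → Matrix X X ℂ) :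
    expv ψ (∑ i ∈ s, T i) = ∑ i ∈ s, expv ψ (T i) := by
  simp [expv, Matrix.sum_mulVec, dotProduct_sum]

lemma expv_mul (T T' : Matrix X X ℂ) :
    expv ψ (T * T') = star (Tᴴ *ᵥ ψ) ⬝ᵥ (T' *ᵥ ψ) := by
  rw [expv, ← mulVec_mulVec, star_dotProduct_mulVec]

lemma expv_one [DecidableEq X] : expv ψ 1 = ((nrm ψ ^ 2 : ℝ) : ℂ) := by
  rw [expv, one_mulVec, star_dotProduct_self]

lemma expv_im {T : Matrix X X ℂ} (hT : Tᴴ = T) : (expv ψ T).im = 0 := by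
  rw [← Complex.conj_eq_iff_im]
  change star (expv ψ T) = expv ψ T
  rw [expv, ← star_dotProduct, star_dotProduct_mulVec, hT]

lemma expv_conj (U T : Matrix X X ℂ) : expv (U *ᵥ ψ) T = expv ψ (Uᴴ * T * U) := by
  rw [Matrix.mul_assoc, expv_mul, Matrix.conjTranspose_conjTranspose, ← mulVec_mulVec, expv]

/-- Equality in the Cauchy–Schwarz inequality. -/
lemma mulVec_eq_smul_of_norm_expv [DecidableEq X] {ψ : X → ℂ} (hψ : nrm ψ = 1)
    {T : Matrix X X ℂ} (hT : Tᴴ * T = 1) (h : ‖expv ψ T‖ = 1) : T *ᵥ ψ = expv ψ T • ψ := by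
  have h1 : nrm (expv ψ T • ψ - T *ᵥ ψ) ^ 2 = 0 := by
    rw [nrm_sub_sq, nrm_smul, nrm_mulVec_of_conjTranspose_mul hT, h, hψ, star_smul, smul_dotProduct,
      ← expv, smul_eq_mul, ← starRingEnd_apply, ← Complex.normSq_eq_conj_mul_self,
      Complex.ofReal_re, Complex.normSq_eq_norm_sq, h]
    norm_num
  exact (sub_eq_zero.1 (eq_zero_of_nrm (pow_eq_zero_iff two_ne_zero |>.1 h1))).symm

end expv

lemma finite_setOf_isPauli : {P : QOp n | IsPauli P}.Finite := by
  have : {P : QOp n | IsPauli P} =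
      Set.range fun q : Fin 4 × (Fin n → Fin 4) => (Complex.I ^ (q.1 : ℕ)) • pauliString q.2 := by
    ext P
    simp only [IsPauli, Set.mem_ofPred_eq, Set.mem_range, Prod.exists, eq_comm]
  rw [this]
  exact Set.finite_range _

lemma IsClifford.conjTranspose_conj {U : QOp n} (hU : IsClifford U) {P : QOp n} (hP : IsPauli P) :
    IsPauli (Uᴴ * P * U) := by
  have hU1 : U * Uᴴ = 1 := Matrix.mem_unitaryGroup_iff.1 hU.1
  have hU2 : Uᴴ * U = 1 := mul_eq_one_comm.1 hU1
  have hinv : ∀ P : QOp n, Uᴴ * (U * P * Uᴴ) * U = P := fun P => by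
    rw [Matrix.mul_assoc, Matrix.mul_assoc, Matrix.mul_assoc, hU2, Matrix.mul_one,
      ← Matrix.mul_assoc, hU2, Matrix.one_mul]
  -- conjugation by `U` is an injection of the finite set of Pauli operators into itself
  have hinj : Set.InjOn (fun P : QOp n => U * P * Uᴴ) {P | IsPauli P} := fun P _ P' _ h => by
    rw [← hinv P, ← hinv P']
    exact congrArg (fun T => Uᴴ * T * U) h
  obtain ⟨P', hP', rfl⟩ :=
    ((finite_setOf_isPauli.injOn_iff_bijOn_of_mapsTo fun P hP => hU.2 P hP).1 hinj).surjOn hP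
  rw [show Uᴴ * (fun P : QOp n => U * P * Uᴴ) P' * U = P' from hinv P']
  exact hP'

lemma IsStabilizerState.nrm_eq_one {S : QState n} (hS : IsStabilizerState S) : nrm S = 1 := by
  obtain ⟨U, hU, rfl⟩ := hS
  rw [nrm_mulVec_of_conjTranspose_mul (mul_eq_one_comm.1 (Matrix.mem_unitaryGroup_iff.1 hU.1))]
  simp [nrm]

/-- The expectation values of Pauli strings in stabilizer states have modulus `0` or `1`. -/
lemma IsStabilizerState.norm_expv {S : QState n} (hS : IsStabilizerState S) (a : Fin n → Fin 4) :
    ‖expv S (pauliString a)‖ = 0 ∨ ‖expv S (pauliString a)‖ = 1 := by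
  obtain ⟨U, hU, rfl⟩ := hS
  obtain ⟨t, b, hb⟩ := hU.conjTranspose_conj (P := pauliString a) ⟨0, a, by simp⟩
  rw [expv_conj, hb, expv_smul, norm_mul, norm_pow, Complex.norm_I, one_pow, one_mul]
  have h : expv (Pi.single (0 : Bits n) 1) (pauliString b) = ∏ k, pauli (b k) 0 0 := by
    simp [expv, pauliString]
  rw [h, norm_prod]
  by_cases hk : ∃ k, pauli (b k) 0 0 = 0
  · obtain ⟨k, hk⟩ := hk
    exact Or.inl (Finset.prod_eq_zero (Finset.mem_univ k) (by rw [hk, norm_zero]))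
  · push Not at hk
    refine Or.inr (Finset.prod_eq_one fun k _ => ?_)
    have := hk k
    generalize b k = c at this
    fin_cases c <;> simp [pauli] at this ⊢

end Stabilizer

/-! ### Distributions orthogonal to a large group of sign vectors -/

section SignGroup

variable {J : Type*} [Fintype J] [DecidableEq J]

/-- If a distribution `p` on `J` gives mean zero to all nontrivial elements of a group of at least
`|J|` sign vectors, then these form an orthonormal basis of `L²(p)`, so that `p` is uniform. -/
lemma uniform_of_sign_group {p : J → ℝ} (hp : ∀ j, 0 < p j) (hsum : ∑ j, p j = 1)
    {G : Finset (J → ℤˣ)} (h1 : 1 ∈ G) (hmul : ∀ σ ∈ G, ∀ τ ∈ G, σ * τ ∈ G)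
    (hcard : Fintype.card J ≤ G.card)
    (h0 : ∀ σ ∈ G, σ ≠ 1 → ∑ j, p j * ((σ j : ℤ) : ℝ) = 0) :
    ∃ k : ℕ, Fintype.card J = 2 ^ k ∧ ∀ j, p j = 1 / 2 ^ k := by
  have hsq : ∀ σ : J → ℤˣ, σ * σ = 1 := fun σ => funext fun j => Int.units_mul_self (σ j)
  let O : Matrix G J ℝ := fun σ j => ((σ.1 j : ℤ) : ℝ) * Real.sqrt (p j)
  have hOT : ∀ σ j, Oᵀ j σ = ((σ.1 j : ℤ) : ℝ) * Real.sqrt (p j) := fun _ _ => rfl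
  have hO : O * Oᵀ = 1 := by
    ext σ τ
    have e : (O * Oᵀ) σ τ = ∑ j, p j * (((σ.1 * τ.1) j : ℤ) : ℝ) := by
      rw [Matrix.mul_apply]
      refine Finset.sum_congr rfl fun j _ => ?_
      have := Real.mul_self_sqrt (hp j).le
      rw [hOT, Pi.mul_apply, Units.val_mul, Int.cast_mul]
      simp only [O]
      conv_rhs => rw [← this]
      ring
    rw [e, Matrix.one_apply]
    split_ifs with h
    · subst h
      simp [hsum]
    · refine h0 _ (hmul _ σ.2 _ τ.2) fun h' => h (Subtype.ext ?_)
      calc σ.1 = σ.1 * (τ.1 * τ.1) := by rw [hsq, mul_one]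
        _ = τ.1 := by rw [← mul_assoc, h', one_mul]
  have hle : Fintype.card G ≤ Fintype.card J := by
    have h2 : Fintype.card G = (O * Oᵀ).rank := by rw [hO, Matrix.rank_one]
    rw [h2]
    exact (Matrix.rank_mul_le_left _ _).trans (Matrix.rank_le_card_width _)
  have hGc : Fintype.card G = G.card := Fintype.card_coe G
  have hJ : Fintype.card J = G.card := le_antisymm hcard (hGc ▸ hle)
  have hO' : Oᵀ * O = 1 :=
    (Matrix.mul_eq_one_comm_of_card_eq _ _ _ (by rw [hGc, hJ])).1 hO
  have hpj : ∀ j, (G.card : ℝ) * p j = 1 := fun j => by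
    have h2 := congrFun (congrFun hO' j) j
    rw [Matrix.mul_apply, Matrix.one_apply_eq] at h2
    rw [← h2, ← hGc]
    have h3 : ∀ σ : G, Oᵀ j σ * O σ j = p j := fun σ => by
      have h4 : ((σ.1 j : ℤ) : ℝ) * ((σ.1 j : ℤ) : ℝ) = 1 := by
        rw [← Int.cast_mul, ← Units.val_mul, Int.units_mul_self]; simp
      have := Real.mul_self_sqrt (hp j).le
      rw [hOT]
      calc _ = (((σ.1 j : ℤ) : ℝ) * ((σ.1 j : ℤ) : ℝ)) * (Real.sqrt (p j) * Real.sqrt (p j)) := by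
            ring
        _ = p j := by rw [h4, this, one_mul]
    rw [Finset.sum_congr rfl fun σ _ => h3 σ]
    simp
  let K : Subgroup (J → ℤˣ) :=
    { carrier := G
      mul_mem' := fun {a b} ha hb => hmul a ha b hb
      one_mem' := h1
      inv_mem' := fun {a} ha => by rwa [inv_eq_of_mul_eq_one_left (hsq a)] }
  have hK : IsPGroup 2 K := fun g => ⟨1, Subtype.ext (by
    rw [pow_one, pow_two]; exact hsq g.1)⟩
  obtain ⟨k, hk⟩ := IsPGroup.iff_card.1 hK
  have hkG : G.card = 2 ^ k := by
    rw [← hk, ← hGc, ← Nat.card_eq_fintype_card]; rfl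
  refine ⟨k, hJ.trans hkG, fun j => ?_⟩
  have := hpj j
  rw [hkG] at this
  push_cast at this
  rw [eq_div_iff (by positivity), mul_comm]; exact this

/-- The sums over `p` in `uniform_of_sign_group` take finitely many values, so that it suffices to
have them arbitrarily small. -/
lemma uniform_of_approx_sign_group {p : J → ℝ} (hp : ∀ j, 0 < p j) (hsum : ∑ j, p j = 1)
    (h : ∀ ε : ℝ, 0 < ε → ∃ G : Finset (J → ℤˣ), 1 ∈ G ∧ (∀ σ ∈ G, ∀ τ ∈ G, σ * τ ∈ G) ∧
      Fintype.card J ≤ G.card ∧ ∀ σ ∈ G, σ ≠ 1 → |∑ j, p j * ((σ j : ℤ) : ℝ)| ≤ ε) :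
    ∃ k : ℕ, Fintype.card J = 2 ^ k ∧ ∀ j, p j = 1 / 2 ^ k := by
  have hε : ∃ ε : ℝ, 0 < ε ∧ ∀ σ : J → ℤˣ, ∑ j, p j * ((σ j : ℤ) : ℝ) ≠ 0 →
      ε < |∑ j, p j * ((σ j : ℤ) : ℝ)| := by
    have := Filter.eventually_all.2 fun σ : J → ℤˣ =>
      (show ∀ᶠ ε : ℝ in 𝓝[>] 0, ∑ j, p j * ((σ j : ℤ) : ℝ) ≠ 0 →
        ε < |∑ j, p j * ((σ j : ℤ) : ℝ)| by
        by_cases hσ : ∑ j, p j * ((σ j : ℤ) : ℝ) = 0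
        · simp [hσ]
        · filter_upwards [nhdsWithin_le_nhds (Iio_mem_nhds (abs_pos.2 hσ))] with ε h _ using h)
    obtain ⟨ε, h1, h2⟩ := (this.and self_mem_nhdsWithin).exists
    exact ⟨ε, h2, h1⟩
  obtain ⟨ε, hε0, hε⟩ := hε
  obtain ⟨G, h1, hmul, hcard, hG⟩ := h ε hε0
  refine uniform_of_sign_group hp hsum h1 hmul hcard fun σ hσ hσ1 => ?_
  by_contra hne
  exact absurd (hε σ hne) (not_lt.2 (hG σ hσ hσ1))

end SignGroup

section Shannon

variable {b : ℕ}

lemma continuous_shannon : Continuous fun p : Fin b → ℝ => shannon p := by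
  unfold shannon Real.logb
  refine (continuous_finsetSum _ fun j _ => ?_).neg
  simp only [← mul_div_assoc]
  exact (Real.continuous_mul_log.comp (continuous_apply j)).div_const _

lemma shannon_of_uniform {p : Fin b → ℝ} {k : ℕ}
    (hcard : Fintype.card {j // 0 < p j} = 2 ^ k) (hp0 : ∀ j, 0 ≤ p j)
    (h : ∀ j, 0 < p j → p j = 1 / 2 ^ k) : shannon p = k := by
  have e : ∀ j, p j * Real.logb 2 (p j) = if 0 < p j then -(k / 2 ^ k : ℝ) else 0 := fun j => by
    split_ifs with hj
    · rw [h j hj, one_div, Real.logb_inv, Real.logb_pow, Real.logb_self_eq_one (by norm_num)]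
      ring
    · rw [le_antisymm (not_lt.1 hj) (hp0 j), zero_mul]
  simp only [shannon, e]
  rw [← Finset.sum_filter, Finset.sum_const, ← Fintype.card_subtype, hcard]
  simp only [nsmul_eq_mul, Nat.cast_pow, Nat.cast_ofNat, mul_neg, neg_neg]
  field_simp

end Shannon

section Recurrence

/-- The powers of finitely many phases return to `1`. -/
lemma exists_tendsto_pow_one {ι : Type*} [Finite ι] (z : ι → ℂ) (hz : ∀ i, ‖z i‖ = 1) :
    ∃ φ : ℕ → ℕ, Tendsto φ atTop atTop ∧ ∀ i, Tendsto (fun n => z i ^ φ n) atTop (𝓝 1) := by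
  have hK : IsCompact (Set.pi Set.univ fun _ : ι => Metric.sphere (0 : ℂ) 1) :=
    isCompact_univ_pi fun _ => isCompact_sphere _ _
  obtain ⟨w, hw, ψ, hψ, hlim⟩ := hK.tendsto_subseq (x := fun n i => z i ^ n)
    (fun n i _ => by simp [hz])
  rw [tendsto_pi_nhds] at hlim
  have hg : Tendsto (fun n => n + ψ n + n) atTop atTop :=
    tendsto_atTop_mono (fun n => by change n ≤ _; omega) tendsto_id
  refine ⟨fun n => ψ (n + ψ n + n) - ψ n, ?_, fun i => ?_⟩
  · refine tendsto_atTop_mono (fun n => ?_) tendsto_id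
    have := hψ.le_apply (x := n + ψ n + n)
    change n ≤ _
    omega
  · have hwi : ‖w i‖ = 1 := by simpa using hw i trivial
    have hwi0 : w i ≠ 0 := fun h => by simp [h] at hwi
    have hzi0 : z i ≠ 0 := fun h => by simpa [h] using hz i
    have h1 := ((hlim i).comp hg).div (hlim i) hwi0
    rw [div_self hwi0] at h1
    refine h1.congr fun n => ?_
    simp only [Function.comp, Pi.div_apply]
    rw [pow_sub₀ _ hzi0 (hψ.monotone (by omega)), div_eq_mul_inv]

end Recurrence

/-! ### Stabilizer states close to a superposition of uncorrelated states -/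

section Core

variable {n : ℕ}

lemma norm_expv_le {X : Type*} [Fintype X] [DecidableEq X] (ψ : X → ℂ) {T : Matrix X X ℂ}
    (hT : Tᴴ * T = 1) : ‖expv ψ T‖ ≤ nrm ψ ^ 2 := by
  refine (norm_star_dotProduct_le _ _).trans_eq ?_
  rw [nrm_mulVec_of_conjTranspose_mul hT, sq]

/-- Approximate eigenvectors: the vector is moved little by `T - χ` if the expectation value of `T`
is close to the sign `χ`. -/
lemma nrm_mulVec_sub_le {X : Type*} [Fintype X] [DecidableEq X] {ψ : X → ℂ} {T : Matrix X X ℂ}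
    (hT : Tᴴ * T = 1) {χ : ℝ} (hχ : χ = 1 ∨ χ = -1) {r e : ℝ} (hr : 0 ≤ r)
    (he : expv ψ T = (e : ℂ)) (h : 2 * nrm ψ ^ 2 - 2 * (χ * e) ≤ r ^ 2) :
    nrm (T *ᵥ ψ - (χ : ℂ) • ψ) ≤ r := by
  have hχ2 : χ ^ 2 = 1 := by rcases hχ with rfl | rfl <;> norm_num
  have h1 : nrm ((χ : ℂ) • ψ - T *ᵥ ψ) ^ 2 = 2 * nrm ψ ^ 2 - 2 * (χ * e) := by
    rw [nrm_sub_sq, nrm_smul, nrm_mulVec_of_conjTranspose_mul hT, star_smul, smul_dotProduct,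
      ← expv, he, mul_pow, Complex.norm_real, Real.norm_eq_abs, sq_abs, hχ2]
    simp
    ring
  have h2 : nrm (T *ᵥ ψ - (χ : ℂ) • ψ) = nrm ((χ : ℂ) • ψ - T *ᵥ ψ) := by
    rw [nrm, nrm, WithLp.toLp_sub, WithLp.toLp_sub, norm_sub_rev]
  rw [h2]
  exact le_of_sq_le_sq (h1.trans_le h) hr
  where le_of_sq_le_sq {a b : ℝ} (h : a ^ 2 ≤ b ^ 2) (hb : 0 ≤ b) : a ≤ b :=
    abs_le_of_sq_le_sq' h hb |>.2

/-- The sign of a real number, with `0` counted as positive. -/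
noncomputable def sgn (x : ℝ) : ℤˣ := if 0 ≤ x then 1 else -1

lemma abs_sub_sgn_le {x η δ : ℝ} (h1 : 1 - η ≤ |x|) (h2 : |x| ≤ 1 + δ) (h : δ ≤ η) :
    |x - ((sgn x : ℤ) : ℝ)| ≤ η := by
  unfold sgn
  split_ifs with hx
  · rw [abs_of_nonneg hx] at h1 h2
    rw [abs_le]; constructor <;> simp <;> linarith
  · rw [abs_of_neg (not_le.1 hx)] at h1 h2
    rw [abs_le]; constructor <;> simp <;> linarith

lemma sgn_cast (u : ℤˣ) : ((u : ℤ) : ℝ) = 1 ∨ ((u : ℤ) : ℝ) = -1 := by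
  rcases Int.units_eq_one_or u with rfl | rfl <;> simp

/-- Each term of a mean of numbers of modulus at most `(1 + δ)²` is close to `1` in modulus if the
mean is. -/
lemma abs_term_ge {J : Type*} [Fintype J] [DecidableEq J] {p x y : J → ℝ} {δ t : ℝ}
    (hsum : ∑ j, p j = 1) (hδ0 : 0 ≤ δ) (hδ : δ ≤ t) (ht : t ≤ 1 / 10) (hp0 : ∀ j, 0 < p j)
    (hp : ∀ j, δ ≤ t * p j)
    (hx : ∀ j, |x j| ≤ 1 + δ) (hy : ∀ j, |y j| ≤ 1 + δ)
    (h : 1 - δ ≤ |∑ j, p j * (x j * y j)|) (j : J) : 1 - 6 * t ≤ |x j| := by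
  have h1 : |∑ j, p j * (x j * y j)| ≤ ∑ j, p j * (|x j| * |y j|) := by
    refine (Finset.abs_sum_le_sum_abs _ _).trans (Finset.sum_le_sum fun j _ => ?_)
    rw [abs_mul, abs_mul, abs_of_pos (hp0 j)]
  have h2 : ∑ i, p i * (|x i| * |y i|) ≤ p j * (|x j| * |y j|) + (1 - p j) * (1 + 3 * δ) := by
    rw [← Finset.add_sum_erase _ _ (Finset.mem_univ j)]
    have h3 : ∑ i ∈ Finset.univ.erase j, p i = 1 - p j := by
      rw [← hsum, ← Finset.add_sum_erase _ _ (Finset.mem_univ j)]; ring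
    rw [← h3, Finset.sum_mul]
    refine add_le_add le_rfl (Finset.sum_le_sum fun i _ => ?_)
    refine mul_le_mul_of_nonneg_left ?_ (hp0 i).le
    have := mul_le_mul (hx i) (hy i) (abs_nonneg _) (by linarith)
    nlinarith
  have h4 : p j * (1 - 4 * t) ≤ p j * (|x j| * |y j|) := by
    nlinarith [hp j, hp0 j]
  have h5 := le_of_mul_le_mul_left h4 (hp0 j)
  have h6 : |x j| * |y j| ≤ |x j| * (1 + δ) := mul_le_mul_of_nonneg_left (hy j) (abs_nonneg _)
  nlinarith [hx j, abs_nonneg (x j)]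

/-- Let the correlations of a stabilizer state `S` between the regions `A` and `C` be close to those
of a mixture of states `v j` without correlations, and let the operators `X j`, `Y j` on `A`, `C`
distinguish these states. The Pauli strings on `A` that have a partner on `C` are nearly `±1` in
all `v j`. The resulting sign vectors, normalized at `j₀`, form a group; the nontrivial ones have
mean nearly `0`, because Pauli strings have expectation value `0` or `±1` in `S`. There are at least
as many of them as states `v j`: the matrix of the `⟨S|X j Y k|S⟩` factors through the group. -/
theorem exists_sign_group {J : Type*} [Fintype J] [DecidableEq J] (j₀ : J) {p : J → ℝ} {m δ : ℝ}
    (hm : 0 < m) (hp : ∀ j, m ≤ p j) (hsum : ∑ j, p j = 1) (hδ0 : 0 ≤ δ) (hδ : δ ≤ m ^ 2 / 2400)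
    {v : J → QState n} (hv : ∀ j, |nrm (v j) ^ 2 - 1| ≤ δ) {S : QState n}
    (hS : IsStabilizerState S) {A C : Set (Fin n)} (hAC : Disjoint A C)
    (hfac : ∀ a c, SuppIn A a → SuppIn C c → ‖expv S (pauliString a * pauliString c) -
      ∑ j, (p j : ℂ) * (expv (v j) (pauliString a) * expv (v j) (pauliString c))‖ ≤ δ)
    {X Y : J → QOp n} (hX : ∀ j, X j ∈ Loc (β := Fin 2) A) (hY : ∀ j, Y j ∈ Loc (β := Fin 2) C)
    (hM : ∀ j, ∑ k ∈ Finset.univ.erase j, ‖expv S (X j * Y k)‖ < ‖expv S (X j * Y j)‖) :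
    ∃ G : Finset (J → ℤˣ), 1 ∈ G ∧ (∀ σ ∈ G, ∀ τ ∈ G, σ * τ ∈ G) ∧
      Fintype.card J ≤ G.card ∧
      ∀ σ ∈ G, σ ≠ 1 → |∑ j, p j * ((σ j : ℤ) : ℝ)| ≤ 9 * (δ / m) := by
  classical
  have hp0 : ∀ j, 0 < p j := fun j => hm.trans_le (hp j)
  have hm1 : m ≤ 1 := (hp j₀).trans
    (hsum ▸ Finset.single_le_sum (fun j _ => (hp0 j).le) (Finset.mem_univ j₀))
  -- the unit of all errors below: a term of weight at least `m` deviates by `O(δ / m)` if the mean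
  -- deviates by `δ`
  set t := δ / m with ht
  have htm : t * m = δ := div_mul_cancel₀ _ hm.ne'
  have ht0 : 0 ≤ t := div_nonneg hδ0 hm.le
  have hδt : δ ≤ t := by nlinarith
  have htm' : t ≤ m / 2400 := by rw [ht, div_le_iff₀ hm]; nlinarith
  have ht1 : t ≤ 1 / 2400 := by linarith
  have hnS := hS.nrm_eq_one
  have hPP := fun a : Fin n → Fin 4 => pauliString_conjTranspose_mul a
  -- expectation values of Pauli strings are real and at most `1 + δ` in modulus
  let e : (Fin n → Fin 4) → J → ℝ := fun a j => (expv (v j) (pauliString a)).re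
  have he : ∀ a j, expv (v j) (pauliString a) = (e a j : ℂ) := fun a j =>
    Complex.ext rfl (by rw [expv_im _ (pauliString_conjTranspose a)]; rfl)
  have hnv : ∀ j, nrm (v j) ^ 2 ≤ 1 + δ := fun j => by linarith [(abs_le.1 (hv j)).2]
  have hnv' : ∀ j, nrm (v j) ≤ 11 / 10 := fun j => by
    nlinarith [hnv j, nrm_nonneg (v j)]
  have he1 : ∀ a j, |e a j| ≤ 1 + δ := fun a j => by
    have := norm_expv_le (v j) (hPP a)
    rw [he, Complex.norm_real] at this
    exact this.trans (hnv j)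
  -- products of Pauli strings have expectation value of modulus `0` or `1` in `S`
  have hS2 : ∀ a c : Fin n → Fin 4, expv S (pauliString a * pauliString c) ≠ 0 →
      ‖expv S (pauliString a * pauliString c)‖ = 1 := fun a c h => by
    obtain ⟨z, d, hz, hd, -⟩ := pauliString_mul a c
    rw [hd, expv_smul] at h ⊢
    rw [norm_mul, hz, one_mul]
    rcases hS.norm_expv d with h' | h'
    · exact absurd (by rw [norm_eq_zero.1 h', mul_zero]) h
    · exact h'
  have huni : ∀ a c : Fin n → Fin 4,
      (pauliString a * pauliString c)ᴴ * (pauliString a * pauliString c) = 1 := fun a c => by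
    rw [conjTranspose_mul, Matrix.mul_assoc, ← Matrix.mul_assoc _ (pauliString a), hPP,
      Matrix.one_mul, hPP]
  -- the Pauli strings on `A` with a partner on `C`
  let H : (Fin n → Fin 4) → Prop := fun a => SuppIn A a ∧
    ∃ c, SuppIn C c ∧ expv S (pauliString a * pauliString c) ≠ 0
  have hH : ∀ a, H a → ∀ j, 1 - 6 * t ≤ |e a j| := by
    rintro a ⟨ha, c, hc, hne⟩ j
    refine abs_term_ge (y := e c) hsum hδ0 hδt (by linarith) hp0
      (fun j => by nlinarith [hp j]) (he1 a) (he1 c) ?_ j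
    have h1 := hfac a c ha hc
    simp only [he] at h1
    have h2 : (∑ j, (p j : ℂ) * ((e a j : ℂ) * (e c j : ℂ))) =
        ((∑ j, p j * (e a j * e c j) : ℝ) : ℂ) := by push_cast; rfl
    rw [h2] at h1
    have h3 := norm_sub_norm_le (expv S (pauliString a * pauliString c))
      ((∑ j, p j * (e a j * e c j) : ℝ) : ℂ)
    rw [hS2 a c hne, Complex.norm_real, Real.norm_eq_abs] at h3
    linarith
  -- the signs to which the expectation values are close; `v j` is an approximate eigenvector
  let χ : (Fin n → Fin 4) → J → ℤˣ := fun a j => sgn (e a j)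
  have hχ : ∀ a, H a → ∀ j, |e a j - ((χ a j : ℤ) : ℝ)| ≤ 6 * t := fun a ha j =>
    abs_sub_sgn_le (hH a ha j) (he1 a j) (by linarith)
  have hnear : ∀ a, H a → ∀ j,
      nrm (pauliString a *ᵥ v j - ((((χ a j : ℤ) : ℝ)) : ℂ) • v j) ≤ 1 / 10 := fun a ha j => by
    refine nrm_mulVec_sub_le (hPP a) (sgn_cast _) (by norm_num) (he a j) ?_
    have h1 := abs_le.1 (hχ a ha j)
    have h2 := hnv j
    rcases sgn_cast (χ a j) with h | h <;> rw [h] at h1 ⊢ <;> nlinarith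
  -- a product of Pauli strings is a Pauli string up to a phase, so that the signs are multiplicative
  -- up to a sign independent of `j` only, which drops out after normalization at `j₀`
  let σ : (Fin n → Fin 4) → J → ℤˣ := fun a j => χ a j * χ a j₀
  -- the sign vectors are multiplicative
  have hmul : ∀ a a', H a → H a' → ∃ (z : ℂ) (a'' : Fin n → Fin 4), ‖z‖ = 1 ∧
      pauliString a * pauliString a' = z • pauliString a'' ∧ H a'' ∧ σ a'' = σ a * σ a' := by
    intro a a' ha ha'
    obtain ⟨z, a'', hz, haa, hsupp⟩ := pauliString_mul a a'
    have hz0 : z ≠ 0 := fun h => by simp [h] at hz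
    have ha'' : H a'' := by
      obtain ⟨h1, c, hc, hne⟩ := ha
      obtain ⟨h1', c', hc', hne'⟩ := ha'
      obtain ⟨w, c'', hw, hcc, hsupp'⟩ := pauliString_mul c c'
      refine ⟨hsupp A h1 h1', c'', hsupp' C hc hc', fun h0 => ?_⟩
      have e1 := mulVec_eq_smul_of_norm_expv hnS (huni a c) (hS2 a c hne)
      have e2 := mulVec_eq_smul_of_norm_expv hnS (huni a' c') (hS2 a' c' hne')
      have hcomm : pauliString c * pauliString a' = pauliString a' * pauliString c :=
        Loc_commute hAC.symm hc.mem_Loc h1'.mem_Loc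
      have e3 : (pauliString a * pauliString c) * (pauliString a' * pauliString c') =
          (z * w) • (pauliString a'' * pauliString c'') := by
        calc _ = pauliString a * (pauliString c * pauliString a') * pauliString c' := by
              simp only [Matrix.mul_assoc]
          _ = (pauliString a * pauliString a') * (pauliString c * pauliString c') := by
              rw [hcomm]; simp only [Matrix.mul_assoc]
          _ = _ := by rw [haa, hcc, smul_mul_smul_comm]
      have e4 : expv S ((pauliString a * pauliString c) * (pauliString a' * pauliString c')) =
          expv S (pauliString a' * pauliString c') * expv S (pauliString a * pauliString c) := by
        conv_lhs => rw [expv, ← mulVec_mulVec, e2, mulVec_smul, dotProduct_smul, smul_eq_mul]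
        rfl
      rw [e3, expv_smul, h0, mul_zero] at e4
      exact mul_ne_zero hne' hne e4.symm
    refine ⟨z, a'', hz, haa, ha'', ?_⟩
    have key : ∀ j, ‖z - ((((χ a'' j * χ a j * χ a' j : ℤˣ) : ℤ) : ℝ) : ℂ)‖ ≤ 1 / 4 := by
      intro j
      set s : ℂ := ((((χ a j : ℤ) : ℝ)) : ℂ)
      set s' : ℂ := ((((χ a' j : ℤ) : ℝ)) : ℂ)
      set s'' : ℂ := ((((χ a'' j : ℤ) : ℝ)) : ℂ)
      have hsn : ∀ u : ℤˣ, ‖((((u : ℤ) : ℝ)) : ℂ)‖ = 1 := fun u => by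
        rcases Int.units_eq_one_or u with rfl | rfl <;> simp
      have hss : star s = s := Complex.conj_ofReal _
      have d1 := hnear a ha j
      have d2 := hnear a' ha' j
      have e1 : expv (v j) (pauliString a * pauliString a') = z * (e a'' j : ℂ) := by
        rw [haa, expv_smul, he]
      rw [expv_mul, pauliString_conjTranspose] at e1
      have e2 : z * (e a'' j : ℂ) - s * s' =
          star (pauliString a *ᵥ v j - s • v j) ⬝ᵥ (pauliString a' *ᵥ v j) +
          star (s • v j) ⬝ᵥ (pauliString a' *ᵥ v j - s' • v j) +
          s * s' * ((nrm (v j) ^ 2 - 1 : ℝ) : ℂ) := by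
        have h3 : star (s • v j) ⬝ᵥ (s' • v j) = s * s' * ((nrm (v j) ^ 2 : ℝ) : ℂ) := by
          rw [star_smul, hss, smul_dotProduct, dotProduct_smul, star_dotProduct_self]
          simp only [smul_eq_mul, mul_assoc]
        rw [star_sub, sub_dotProduct, dotProduct_sub, e1, h3]
        push_cast; ring
      have e3 : ‖z * (e a'' j : ℂ) - s * s'‖ ≤ 1 / 10 * (11 / 10) + 11 / 10 * (1 / 10) + δ := by
        rw [e2]
        refine (norm_add_le _ _).trans (add_le_add ((norm_add_le _ _).trans (add_le_add ?_ ?_)) ?_)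
        · refine (norm_star_dotProduct_le _ _).trans
            (mul_le_mul d1 ?_ (nrm_nonneg _) (by norm_num))
          rw [nrm_mulVec_of_conjTranspose_mul (hPP a')]
          exact hnv' j
        · refine (norm_star_dotProduct_le _ _).trans
            (mul_le_mul ?_ d2 (nrm_nonneg _) (by norm_num))
          rw [nrm_smul, hsn, one_mul]
          exact hnv' j
        · rw [norm_mul, norm_mul, hsn, hsn, one_mul, one_mul, Complex.norm_real]
          exact hv j
      have e4 : ‖z * ((e a'' j : ℂ) - s'')‖ ≤ 6 * t := by
        rw [norm_mul, hz, one_mul, ← Complex.ofReal_sub, Complex.norm_real]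
        exact hχ a'' ha'' j
      have hs2 : s'' * s'' = 1 := by
        simp only [s'']
        rcases Int.units_eq_one_or (χ a'' j) with h | h <;> rw [h] <;> simp
      have e5 : z - ((((χ a'' j * χ a j * χ a' j : ℤˣ) : ℤ) : ℝ) : ℂ) =
          s'' * ((z * (e a'' j : ℂ) - s * s') - z * ((e a'' j : ℂ) - s'')) := by
        have : ((((χ a'' j * χ a j * χ a' j : ℤˣ) : ℤ) : ℝ) : ℂ) = s'' * s * s' := by
          simp only [s, s', s'']; push_cast; rfl
        rw [this]
        linear_combination (-z) * hs2
      rw [e5, norm_mul, hsn, one_mul]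
      refine (norm_sub_le _ _).trans ?_
      linarith
    funext j
    have k1 := key j
    have k2 := key j₀
    have k3 : χ a'' j * χ a j * χ a' j = χ a'' j₀ * χ a j₀ * χ a' j₀ := by
      by_contra hne
      have h := norm_sub_le_norm_sub_add_norm_sub
        ((((χ a'' j * χ a j * χ a' j : ℤˣ) : ℤ) : ℝ) : ℂ) z
        ((((χ a'' j₀ * χ a j₀ * χ a' j₀ : ℤˣ) : ℤ) : ℝ) : ℂ)
      rw [norm_sub_rev _ z] at h
      generalize χ a'' j * χ a j * χ a' j = u at *
      generalize χ a'' j₀ * χ a j₀ * χ a' j₀ = u' at *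
      rcases Int.units_eq_one_or u with rfl | rfl <;>
        rcases Int.units_eq_one_or u' with rfl | rfl
      · exact hne rfl
      · norm_num at h k1 k2; linarith
      · norm_num at h k1 k2; linarith
      · exact hne rfl
    have k4 : ∀ x y z x' y' z' : ℤˣ, x * y * z = x' * y' * z' → x * x' = y * y' * (z * z') := by
      decide
    exact k4 _ _ _ _ _ _ k3
  -- the mean of a sign vector is the expectation value in `S`, by the factorization with `c = 0`
  have hmean : ∀ a, H a →
      |‖expv S (pauliString a)‖ - abs (∑ j, p j * ((σ a j : ℤ) : ℝ))| ≤ 9 * t := by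
    intro a ha
    have h1 := hfac a 0 ha.1 (fun _ _ => rfl)
    rw [pauliString_zero, Matrix.mul_one] at h1
    have h2 : |∑ j, p j * ((σ a j : ℤ) : ℝ)| = ‖∑ j, (p j : ℂ) * ((((χ a j : ℤ) : ℝ)) : ℂ)‖ := by
      have : ∑ j, p j * ((σ a j : ℤ) : ℝ) =
          ((χ a j₀ : ℤ) : ℝ) * ∑ j, p j * ((χ a j : ℤ) : ℝ) := by
        rw [Finset.mul_sum]
        refine Finset.sum_congr rfl fun j _ => ?_
        simp only [σ]; push_cast; ring
      rw [this, abs_mul]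
      have h3 : |((χ a j₀ : ℤ) : ℝ)| = 1 := by
        rcases sgn_cast (χ a j₀) with h | h <;> rw [h] <;> norm_num
      rw [h3, one_mul, ← Real.norm_eq_abs, ← Complex.norm_real]
      push_cast; rfl
    rw [h2]
    refine (abs_norm_sub_norm_le _ _).trans ?_
    have h4 : ‖∑ j, (p j : ℂ) * (expv (v j) (pauliString a) * expv (v j) 1) -
        ∑ j, (p j : ℂ) * ((((χ a j : ℤ) : ℝ)) : ℂ)‖ ≤ 8 * t := by
      rw [← Finset.sum_sub_distrib]
      calc _ ≤ ∑ j, p j * (8 * t) := norm_sum_le_of_le _ fun j _ => ?_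
        _ = 8 * t := by rw [← Finset.sum_mul, hsum, one_mul]
      rw [← mul_sub, norm_mul, Complex.norm_real, Real.norm_eq_abs, abs_of_pos (hp0 j)]
      refine mul_le_mul_of_nonneg_left ?_ (hp0 j).le
      rw [he, expv_one, ← Complex.ofReal_mul, ← Complex.ofReal_sub, Complex.norm_real,
        Real.norm_eq_abs]
      have h5 : e a j * nrm (v j) ^ 2 - ((χ a j : ℤ) : ℝ) =
        (e a j - ((χ a j : ℤ) : ℝ)) + e a j * (nrm (v j) ^ 2 - 1) := by ring
      rw [h5]
      refine (abs_add_le _ _).trans ?_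
      rw [abs_mul]
      have h6 := mul_le_mul (he1 a j) (hv j) (abs_nonneg _) (by linarith)
      nlinarith [hχ a ha j]
    have h7 := norm_sub_le_norm_sub_add_norm_sub (expv S (pauliString a))
      (∑ j, (p j : ℂ) * (expv (v j) (pauliString a) * expv (v j) 1))
      (∑ j, (p j : ℂ) * ((((χ a j : ℤ) : ℝ)) : ℂ))
    linarith
  let G : Finset (J → ℤˣ) := Finset.univ.filter fun τ => ∃ a, H a ∧ σ a = τ
  have hG : ∀ τ, τ ∈ G ↔ ∃ a, H a ∧ σ a = τ := fun τ => by simp [G]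
  refine ⟨G, ?_, ?_, ?_, ?_⟩
  · refine (hG 1).2 ⟨0, ⟨fun _ _ => rfl, 0, fun _ _ => rfl, ?_⟩, ?_⟩
    · rw [pauliString_zero, Matrix.mul_one, expv_one, hnS]; norm_num
    · have h0 : ∀ j, χ 0 j = 1 := fun j => by
        have : 0 ≤ e 0 j := by
          simp only [e]
          rw [pauliString_zero, expv_one, Complex.ofReal_re]
          positivity
        simp only [χ, sgn, if_pos this]
      funext j
      simp [σ, h0]
  · intro τ hτ τ' hτ'
    obtain ⟨a, ha, rfl⟩ := (hG τ).1 hτ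
    obtain ⟨a', ha', rfl⟩ := (hG τ').1 hτ'
    obtain ⟨z, a'', -, -, h, h'⟩ := hmul a a' ha ha'
    exact (hG _).2 ⟨a'', h, h'⟩
  · -- Pauli strings with the same sign vector act on `S` in the same way up to a phase
    have hprop : ∀ a a', H a → H a' → σ a = σ a' →
        ∃ z : ℂ, pauliString a' *ᵥ S = z • pauliString a *ᵥ S := by
      intro a a' ha ha' hσ
      obtain ⟨z, a'', hz, haa, h, h'⟩ := hmul a a' ha ha'
      have h1 : σ a'' = 1 := by
        rw [h', hσ]; funext j; exact Int.units_mul_self _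
      have h2 := hmean a'' h
      have h3 : ‖expv S (pauliString a'')‖ = 1 := by
        rcases hS.norm_expv a'' with h0 | h0
        · rw [h0, h1] at h2
          simp [hsum] at h2
          linarith
        · exact h0
      have h4 := mulVec_eq_smul_of_norm_expv hnS (hPP a'') h3
      refine ⟨z * expv S (pauliString a''), ?_⟩
      have h5 : pauliString a' = pauliString a * (z • pauliString a'') := by
        rw [← haa, ← Matrix.mul_assoc, pauliString_mul_self, Matrix.one_mul]
      conv_lhs => rw [h5, ← mulVec_mulVec, smul_mulVec, h4, smul_smul, mulVec_smul]
    have hrep : ∀ τ : G, ∃ a, H a ∧ σ a = τ.1 := fun τ => (hG _).1 τ.2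
    choose rep hrepH hrepσ using hrep
    have hl : ∀ a, ∃ z : ℂ, ∀ (ha : H a),
        pauliString a *ᵥ S = z • pauliString (rep ⟨σ a, (hG _).2 ⟨a, ha, rfl⟩⟩) *ᵥ S := fun a => by
      by_cases ha : H a
      · obtain ⟨z, hz⟩ := hprop _ a (hrepH ⟨σ a, (hG _).2 ⟨a, ha, rfl⟩⟩) ha (hrepσ _)
        exact ⟨z, fun _ => hz⟩
      · exact ⟨0, fun h => absurd h ha⟩
    choose l hl using hl
    choose x hx hx0 using fun j => exists_pauliString_expansion (hX j)
    choose y hy hy0 using fun j => exists_pauliString_expansion (hY j)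
    -- `M` has full rank, being diagonally dominant; Pauli strings without a partner do not contribute
    -- to it, and the others contribute through their sign vectors
    let M : Matrix J J ℂ := fun j k => expv S (X j * Y k)
    let B : Matrix J G ℂ := fun j τ => ∑ a, if H a ∧ σ a = τ.1 then x j a * star (l a) else 0
    let F : Matrix G J ℂ := fun τ k => star (pauliString (rep τ) *ᵥ S) ⬝ᵥ (Y k *ᵥ S)
    have hMBF : M = B * F := by
      ext j k
      have h1 : M j k = ∑ a, x j a * (star (pauliString a *ᵥ S) ⬝ᵥ (Y k *ᵥ S)) := by
        simp only [M]
        rw [hx j, Finset.sum_mul, expv_sum]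
        refine Finset.sum_congr rfl fun a _ => ?_
        rw [smul_mul_assoc, expv_smul, expv_mul, pauliString_conjTranspose]
      rw [h1, Matrix.mul_apply]
      simp only [B, F, Finset.sum_mul]
      rw [Finset.sum_comm]
      refine Finset.sum_congr rfl fun a _ => ?_
      by_cases ha : H a
      · rw [Finset.sum_eq_single ⟨σ a, (hG _).2 ⟨a, ha, rfl⟩⟩]
        · rw [if_pos ⟨ha, rfl⟩]
          conv_lhs => rw [hl a ha, star_smul, smul_dotProduct]
          rw [smul_eq_mul, mul_assoc]
        · intro τ _ hτ
          rw [if_neg, zero_mul]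
          rintro ⟨-, h⟩
          exact hτ (Subtype.ext h.symm)
        · simp
      · rw [Finset.sum_eq_zero fun τ _ => by rw [if_neg fun h => ha h.1, zero_mul]]
        by_cases hs : SuppIn A a
        · have h2 : star (pauliString a *ᵥ S) ⬝ᵥ (Y k *ᵥ S) = 0 := by
            conv_lhs => rw [← pauliString_conjTranspose a, ← expv_mul, hy k, Finset.mul_sum,
              expv_sum]
            refine Finset.sum_eq_zero fun c _ => ?_
            rw [mul_smul_comm, expv_smul]
            by_cases hc : SuppIn C c
            · by_cases h0 : expv S (pauliString a * pauliString c) = 0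
              · rw [h0, mul_zero]
              · exact absurd ⟨hs, c, hc, h0⟩ ha
            · rw [hy0 k c hc, zero_mul]
          rw [h2, mul_zero]
        · rw [hx0 j a hs, zero_mul]
    have hdet : M.det ≠ 0 := det_ne_zero_of_sum_row_lt_diag hM
    have hrank : M.rank = Fintype.card J :=
      Matrix.rank_of_isUnit _ ((Matrix.isUnit_iff_isUnit_det _).2 (isUnit_iff_ne_zero.2 hdet))
    rw [← hrank, hMBF]
    exact (Matrix.rank_mul_le_left _ _).trans
      ((Matrix.rank_le_card_width _).trans_eq (Fintype.card_coe G))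
  · intro τ hτ hτ1
    obtain ⟨a, ha, rfl⟩ := (hG τ).1 hτ
    have h1 := hmean a ha
    rcases hS.norm_expv a with h0 | h0
    · rw [h0, zero_sub, abs_neg, abs_abs] at h1
      exact h1
    · exfalso
      rw [h0] at h1
      -- a nontrivial sign vector takes both signs, so that its mean is at most `1 - 2m`
      obtain ⟨j, hj⟩ : ∃ j, σ a j ≠ 1 := by
        by_contra! h
        exact hτ1 (funext h)
      have hj' : σ a j = -1 := (Int.units_eq_one_or _).resolve_left hj
      have hj0 : σ a j₀ = 1 := Int.units_mul_self _
      have hle : ∀ i, -p i ≤ p i * ((σ a i : ℤ) : ℝ) ∧ p i * ((σ a i : ℤ) : ℝ) ≤ p i := fun i => by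
        rcases sgn_cast (σ a i) with h | h <;> rw [h] <;> constructor <;> linarith [hp0 i]
      have hup : ∑ i, p i * ((σ a i : ℤ) : ℝ) ≤ 1 - 2 * m := by
        have h2 : ∑ i ∈ Finset.univ.erase j, p i * ((σ a i : ℤ) : ℝ) ≤
          ∑ i ∈ Finset.univ.erase j, p i := Finset.sum_le_sum fun i _ => (hle i).2
        rw [← Finset.add_sum_erase _ _ (Finset.mem_univ j)] at hsum ⊢
        rw [hj']
        simp only [Units.val_neg, Units.val_one, Int.cast_neg, Int.cast_one]
        linarith [hp j]
      have hlo : -(1 - 2 * m) ≤ ∑ i, p i * ((σ a i : ℤ) : ℝ) := by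
        have h2 : ∑ i ∈ Finset.univ.erase j₀, -p i ≤
          ∑ i ∈ Finset.univ.erase j₀, p i * ((σ a i : ℤ) : ℝ) :=
            Finset.sum_le_sum fun i _ => (hle i).1
        rw [Finset.sum_neg_distrib] at h2
        rw [← Finset.add_sum_erase _ _ (Finset.mem_univ j₀)] at hsum ⊢
        rw [hj0]
        simp only [Units.val_one, Int.cast_one]
        linarith [hp j₀]
      have h3 := abs_le.2 ⟨hlo, hup⟩
      have h4 := (abs_le.1 h1).2
      linarith

end Core

/-! ### Operators on a chain composed of two parts -/

section Append

variable {β : Type*} [Fintype β] {m n : ℕ}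

/-- The tensor product of operators on the two parts of a chain. -/
def opAppend (S : Matrix (Fin m → β) (Fin m → β) ℂ) (T : Matrix (Fin n → β) (Fin n → β) ℂ) :
    Matrix (Fin (m + n) → β) (Fin (m + n) → β) ℂ :=
  fun x y => S (fun k => x (Fin.castAdd n k)) (fun k => y (Fin.castAdd n k)) *
    T (fun k => x (Fin.natAdd m k)) (fun k => y (Fin.natAdd m k))

/-- The tensor product of vectors on the two parts of a chain. -/
def vecAppend (u : (Fin m → β) → ℂ) (w : (Fin n → β) → ℂ) : (Fin (m + n) → β) → ℂ :=
  fun x => u (fun k => x (Fin.castAdd n k)) * w (fun k => x (Fin.natAdd m k))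

lemma sum_append {E : Type*} [AddCommMonoid E] (f : (Fin (m + n) → β) → E) :
    ∑ x, f x = ∑ x : Fin m → β, ∑ y : Fin n → β, f (Fin.append x y) := by
  rw [← Fintype.sum_prod_type', ← (Fin.appendEquiv m n).sum_comp]
  rfl

lemma opAppend_mul (S S' : Matrix (Fin m → β) (Fin m → β) ℂ)
    (T T' : Matrix (Fin n → β) (Fin n → β) ℂ) :
    opAppend S T * opAppend S' T' = opAppend (S * S') (T * T') := by
  ext x y
  rw [Matrix.mul_apply, sum_append]
  simp only [opAppend, Fin.append_left, Fin.append_right, Matrix.mul_apply, Finset.sum_mul_sum]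
  exact Finset.sum_congr rfl fun _ _ => Finset.sum_congr rfl fun _ _ => by ring

lemma opAppend_conjTranspose (S : Matrix (Fin m → β) (Fin m → β) ℂ)
    (T : Matrix (Fin n → β) (Fin n → β) ℂ) : (opAppend S T)ᴴ = opAppend Sᴴ Tᴴ := by
  ext x y
  simp [opAppend, Matrix.conjTranspose_apply]

lemma opAppend_one [DecidableEq β] :
    opAppend (1 : Matrix (Fin m → β) (Fin m → β) ℂ) (1 : Matrix (Fin n → β) (Fin n → β) ℂ) = 1 := by
  ext x y
  simp only [opAppend, Matrix.one_apply, mul_ite, mul_one, mul_zero, ← ite_and]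
  refine if_congr ?_ rfl rfl
  rw [funext_iff, funext_iff, funext_iff]
  constructor
  · rintro ⟨h, h'⟩ k
    exact Fin.addCases h' h k
  · exact fun h => ⟨fun k => h _, fun k => h _⟩

lemma opAppend_mulVec (S : Matrix (Fin m → β) (Fin m → β) ℂ)
    (T : Matrix (Fin n → β) (Fin n → β) ℂ) (u : (Fin m → β) → ℂ) (w : (Fin n → β) → ℂ) :
    opAppend S T *ᵥ vecAppend u w = vecAppend (S *ᵥ u) (T *ᵥ w) := by
  ext x
  rw [Matrix.mulVec, dotProduct, sum_append]
  simp only [opAppend, vecAppend, Fin.append_left, Fin.append_right, Matrix.mulVec, dotProduct,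
    Finset.sum_mul_sum]
  exact Finset.sum_congr rfl fun _ _ => Finset.sum_congr rfl fun _ _ => by ring

lemma nrm_vecAppend (u : (Fin m → β) → ℂ) (w : (Fin n → β) → ℂ) :
    nrm (vecAppend u w) = nrm u * nrm w := by
  have h : star (vecAppend u w) ⬝ᵥ vecAppend u w = (star u ⬝ᵥ u) * (star w ⬝ᵥ w) := by
    simp only [dotProduct]
    rw [sum_append]
    simp only [vecAppend, Pi.star_apply, Fin.append_left, Fin.append_right, Finset.sum_mul_sum,
      star_mul']
    exact Finset.sum_congr rfl fun _ _ => Finset.sum_congr rfl fun _ _ => by ring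
  simp only [star_dotProduct_self] at h
  refine (pow_left_inj₀ (nrm_nonneg _) (mul_nonneg (nrm_nonneg _) (nrm_nonneg _)) two_ne_zero).1 ?_
  rw [mul_pow]
  exact_mod_cast h

variable [DecidableEq β] [Nonempty β]

lemma OpBound.of_opAppend_one {c : ℝ} {S : Matrix (Fin m → β) (Fin m → β) ℂ}
    (h : OpBound c (opAppend S (1 : Matrix (Fin n → β) (Fin n → β) ℂ))) : OpBound c S := fun w => by
  let e : (Fin n → β) → ℂ := Pi.single (Classical.arbitrary _) 1
  have he : nrm e = 1 := by simp [nrm, e]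
  have := h (vecAppend w e)
  rwa [opAppend_mulVec, nrm_vecAppend, nrm_vecAppend, one_mulVec, he, mul_one, mul_one] at this

lemma OpBound.of_one_opAppend {c : ℝ} {T : Matrix (Fin n → β) (Fin n → β) ℂ}
    (h : OpBound c (opAppend (1 : Matrix (Fin m → β) (Fin m → β) ℂ) T)) : OpBound c T := fun w => by
  let e : (Fin m → β) → ℂ := Pi.single (Classical.arbitrary _) 1
  have he : nrm e = 1 := by simp [nrm, e]
  have := h (vecAppend e w)
  rwa [opAppend_mulVec, nrm_vecAppend, nrm_vecAppend, one_mulVec, he, one_mul, one_mul] at this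

lemma prodOp_append (M : Fin (m + n) → Matrix β β ℂ) :
    prodOp M = opAppend (prodOp fun k => M (Fin.castAdd n k)) (prodOp fun k => M (Fin.natAdd m k)) := by
  ext x y
  simp only [prodOp, opAppend, Fin.prod_univ_add]

lemma exists_opAppend_one {R : Set (Fin (m + n))} (hR : ∀ k, Fin.natAdd m k ∉ R)
    {T : Matrix (Fin (m + n) → β) (Fin (m + n) → β) ℂ} (hT : T ∈ Loc R) :
    ∃ S ∈ Loc (β := β) (Fin.castAdd n ⁻¹' R), T = opAppend S 1 := by
  induction hT using Submodule.span_induction with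
  | mem T hT =>
    obtain ⟨M, hM, rfl⟩ := hT
    refine ⟨_, prodOp_mem_Loc (M := fun k => M (Fin.castAdd n k)) fun k hk => hM _ hk, ?_⟩
    rw [prodOp_append]
    congr 1
    rw [← prodOp_one]
    congr 1
    funext k
    exact hM _ (hR k)
  | zero => exact ⟨0, zero_mem _, by ext; simp [opAppend]⟩
  | add T T' _ _ h h' =>
    obtain ⟨S, hS, rfl⟩ := h
    obtain ⟨S', hS', rfl⟩ := h'
    exact ⟨S + S', add_mem hS hS', by ext; simp [opAppend, add_mul]⟩
  | smul r T _ h =>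
    obtain ⟨S, hS, rfl⟩ := h
    exact ⟨r • S, Submodule.smul_mem _ _ hS, by ext; simp [opAppend, mul_assoc]⟩

lemma exists_one_opAppend {R : Set (Fin (m + n))} (hR : ∀ k, Fin.castAdd n k ∉ R)
    {T : Matrix (Fin (m + n) → β) (Fin (m + n) → β) ℂ} (hT : T ∈ Loc R) :
    ∃ S ∈ Loc (β := β) (Fin.natAdd m ⁻¹' R), T = opAppend 1 S := by
  induction hT using Submodule.span_induction with
  | mem T hT =>
    obtain ⟨M, hM, rfl⟩ := hT
    refine ⟨_, prodOp_mem_Loc (M := fun k => M (Fin.natAdd m k)) fun k hk => hM _ hk, ?_⟩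
    rw [prodOp_append]
    congr 1
    rw [← prodOp_one]
    congr 1
    funext k
    exact hM _ (hR k)
  | zero => exact ⟨0, zero_mem _, by ext; simp [opAppend]⟩
  | add T T' _ _ h h' =>
    obtain ⟨S, hS, rfl⟩ := h
    obtain ⟨S', hS', rfl⟩ := h'
    exact ⟨S + S', add_mem hS hS', by ext; simp [opAppend, mul_add]⟩
  | smul r T _ h =>
    obtain ⟨S, hS, rfl⟩ := h
    exact ⟨r • S, Submodule.smul_mem _ _ hS, by ext; simp [opAppend, mul_left_comm]⟩

end Append

/-! ### Transfer matrices with insertions -/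

section Transfer

variable {β : Type} [Fintype β] [DecidableEq β] {κ κ' : Type} [Fintype κ] [DecidableEq κ]
  [Fintype κ'] [DecidableEq κ'] {m n : ℕ}

/-- The product of the matrices of a tensor along an open chain. -/
def word (A : β → Matrix κ κ ℂ) (x : Fin m → β) : Matrix κ κ ℂ := (List.ofFn fun n => A (x n)).prod

/-- The vector on an open chain generated by a tensor for fixed bond indices at the ends. -/
def openMps (A : β → Matrix κ κ ℂ) (m : ℕ) (a c : κ) : (Fin m → β) → ℂ := fun x => word A x a c

/-- The transfer matrix of a chain of `m` sites with the operator `T` between the two layers. -/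
def insertion (A : β → Matrix κ κ ℂ) (B : β → Matrix κ' κ' ℂ)
    (T : Matrix (Fin m → β) (Fin m → β) ℂ) : Matrix (κ × κ') (κ × κ') ℂ :=
  ∑ x, ∑ y, T y x • (word A x ⊗ₖ (word B y).map star)

variable (A : β → Matrix κ κ ℂ) (B : β → Matrix κ' κ' ℂ)

lemma star_mps_dotProduct_mulVec (T : Matrix (Fin m → β) (Fin m → β) ℂ) :
    star (mps B m) ⬝ᵥ (T *ᵥ mps A m) = (insertion A B T).trace := by
  have h : ∀ M : Matrix κ' κ' ℂ, (M.map star).trace = star M.trace := fun M => by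
    simp [Matrix.trace]
  simp only [insertion, Matrix.trace_sum, Matrix.trace_smul, Matrix.trace_kronecker, h]
  rw [Finset.sum_comm]
  simp only [dotProduct, Matrix.mulVec, Finset.mul_sum]
  refine Finset.sum_congr rfl fun y _ => Finset.sum_congr rfl fun x _ => ?_
  simp only [Pi.star_apply, smul_eq_mul]
  change star (word B y).trace * (T y x * (word A x).trace) = _
  ring

lemma insertion_apply (T : Matrix (Fin m → β) (Fin m → β) ℂ) (a c : κ × κ') :
    insertion A B T a c = star (openMps B m a.2 c.2) ⬝ᵥ (T *ᵥ openMps A m a.1 c.1) := by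
  simp only [insertion, Matrix.sum_apply, Matrix.smul_apply, Matrix.kroneckerMap_apply,
    Matrix.map_apply]
  rw [Finset.sum_comm]
  simp only [dotProduct, Matrix.mulVec, Finset.mul_sum]
  refine Finset.sum_congr rfl fun y _ => Finset.sum_congr rfl fun x _ => ?_
  simp only [Pi.star_apply, smul_eq_mul, openMps]
  ring

lemma word_append (x : Fin m → β) (y : Fin n → β) :
    word A (Fin.append x y) = word A x * word A y := by
  have h : ∀ k : Fin m, Fin.append x y (Fin.castLE (Nat.le_add_right m n) k) = x k :=
    Fin.append_left x y
  simp only [word, List.ofFn_add, List.prod_append, h, Fin.append_right]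

lemma insertion_opAppend (S : Matrix (Fin m → β) (Fin m → β) ℂ)
    (T : Matrix (Fin n → β) (Fin n → β) ℂ) :
    insertion A B (opAppend S T) = insertion A B S * insertion A B T := by
  have hmap : ∀ M M' : Matrix κ' κ' ℂ, (M * M').map star = M.map star * M'.map star :=
    fun M M' => Matrix.map_mul (f := starRingEnd ℂ)
  simp only [insertion, Finset.sum_mul_sum]
  rw [sum_append]
  refine Finset.sum_congr rfl fun x _ => Finset.sum_congr rfl fun x' _ => ?_
  rw [sum_append]
  refine Finset.sum_congr rfl fun y _ => Finset.sum_congr rfl fun y' _ => ?_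
  simp only [opAppend, Fin.append_left, Fin.append_right, word_append, hmap,
    Matrix.mul_kronecker_mul, smul_mul_smul_comm]

lemma insertion_one : insertion A B (1 : Matrix (Fin m → β) (Fin m → β) ℂ) = transfer A B ^ m := by
  induction m with
  | zero =>
    simp only [insertion, word]
    simp
  | succ m ih =>
    rw [← opAppend_one, insertion_opAppend, ih, pow_succ]
    congr 1
    simp only [insertion, Matrix.one_apply, ite_smul, one_smul, zero_smul, Finset.sum_ite_eq',
      Finset.mem_univ, if_true]
    rw [transfer, ← (Equiv.funUnique (Fin 1) β).symm.sum_comp]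
    refine Finset.sum_congr rfl fun x _ => ?_
    simp [word]

lemma star_openMps_dotProduct (a c : κ × κ') :
    star (openMps B m a.2 c.2) ⬝ᵥ openMps A m a.1 c.1 = (transfer A B ^ m) a c := by
  rw [← insertion_one, insertion_apply, one_mulVec]

lemma star_mps_dotProduct : star (mps B m) ⬝ᵥ mps A m = (transfer A B ^ m).trace := by
  rw [← insertion_one, ← star_mps_dotProduct_mulVec, one_mulVec]

end Transfer

/-! ### Correlations of matrix product states near a fixed point -/

section TraceLimits

variable {ι : Type*} [Fintype ι] [DecidableEq ι]

lemma norm_trace_mul_sub_le {C : ℝ} {M : Matrix ι ι ℂ} (hM : ∀ a b, ‖M a b‖ ≤ C)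
    (G G' : Matrix ι ι ℂ) :
    ‖(M * G).trace - (M * G').trace‖ ≤ C * ∑ a, ∑ b, ‖G b a - G' b a‖ := by
  rw [← Matrix.trace_sub, ← Matrix.mul_sub]
  simp only [Matrix.trace, Matrix.diag, Matrix.mul_apply, Matrix.sub_apply, Finset.mul_sum]
  refine norm_sum_le_of_le _ fun a _ => norm_sum_le_of_le _ fun b _ => ?_
  rw [norm_mul]
  exact mul_le_mul_of_nonneg_right (hM a b) (norm_nonneg _)

lemma norm_trace_mul_mul_sub_le {C : ℝ} {M M' : Matrix ι ι ℂ} (hM : ∀ a b, ‖M a b‖ ≤ C)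
    (hM' : ∀ a b, ‖M' a b‖ ≤ C) (G₁ G₂ G : Matrix ι ι ℂ) :
    ‖(M * (G₁ * (M' * G₂))).trace - (M * (G * (M' * G))).trace‖ ≤
      C * ∑ a, ∑ b, ∑ c, C * ∑ d, ‖G₁ b c * G₂ d a - G b c * G d a‖ := by
  have e : ∀ G₁ G₂ : Matrix ι ι ℂ, (M * (G₁ * (M' * G₂))).trace =
      ∑ a, ∑ b, M a b * ∑ c, ∑ d, M' c d * (G₁ b c * G₂ d a) := fun G₁ G₂ => by
    simp only [Matrix.trace, Matrix.diag, Matrix.mul_apply, Finset.mul_sum]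
    refine Finset.sum_congr rfl fun a _ => Finset.sum_congr rfl fun b _ =>
      Finset.sum_congr rfl fun c _ => Finset.sum_congr rfl fun d _ => by ring
  rw [e, e]
  simp only [← Finset.sum_sub_distrib, ← mul_sub]
  rw [Finset.mul_sum]
  refine norm_sum_le_of_le _ fun a _ => ?_
  rw [Finset.mul_sum]
  refine norm_sum_le_of_le _ fun b _ => ?_
  rw [norm_mul]
  refine mul_le_mul (hM a b) (norm_sum_le_of_le _ fun c _ => ?_) (norm_nonneg _)
    ((norm_nonneg _).trans (hM a b))
  rw [Finset.mul_sum]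
  refine norm_sum_le_of_le _ fun d _ => ?_
  rw [norm_mul]
  exact mul_le_mul_of_nonneg_right (hM' c d) (norm_nonneg _)

/-- Separation by powers of `E`, which converge to a matrix `G` of rank at most one, makes traces
factorize, uniformly for bounded insertions. -/
lemma eventually_trace_factor {E G : Matrix ι ι ℂ}
    (hE : Tendsto (fun n : ℕ => E ^ n) atTop (𝓝 G))
    (hG : ∀ M M' : Matrix ι ι ℂ, (M * (G * (M' * G))).trace = (M * G).trace * (M' * G).trace)
    (C : ℝ) {δ : ℝ} (hδ : 0 < δ) :
    ∀ᶠ L : ℕ in atTop, ∀ g₁ g₂ g₃ g₄ : ℕ, L ≤ g₁ → L ≤ g₂ → L ≤ g₃ → L ≤ g₄ →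
      ∀ M M' : Matrix ι ι ℂ, (∀ a b, ‖M a b‖ ≤ C) → (∀ a b, ‖M' a b‖ ≤ C) →
      ‖(M * (E ^ g₁ * (M' * E ^ g₂))).trace - (M * G).trace * (M' * G).trace‖ ≤ δ ∧
      ‖(M * G).trace * (M' * G).trace - (M * E ^ g₃).trace * (M' * E ^ g₄).trace‖ ≤ δ := by
  have hent : ∀ a b, Tendsto (fun n : ℕ => (E ^ n) a b) atTop (𝓝 (G a b)) := fun a b =>
    (tendsto_pi_nhds.1 ((tendsto_pi_nhds.1 hE) a)) b
  -- the error terms of the two estimates above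
  have h1 : Tendsto (fun n : ℕ => |C| * ∑ a, ∑ b, ‖(E ^ n) b a - G b a‖) atTop (𝓝 0) := by
    have : Tendsto (fun n : ℕ => |C| * ∑ a, ∑ b, ‖(E ^ n) b a - G b a‖) atTop
        (𝓝 (|C| * ∑ a, ∑ b, ‖G b a - G b a‖)) :=
      (tendsto_finsetSum _ fun a _ => tendsto_finsetSum _ fun b _ =>
        ((hent b a).sub_const _).norm).const_mul _
    simpa using this
  have h2 : Tendsto (fun g : ℕ × ℕ => |C| * ∑ a, ∑ b, ∑ c, |C| * ∑ d,
      ‖(E ^ g.1) b c * (E ^ g.2) d a - G b c * G d a‖) (atTop ×ˢ atTop) (𝓝 0) := by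
    have : Tendsto (fun g : ℕ × ℕ => |C| * ∑ a, ∑ b, ∑ c, |C| * ∑ d,
        ‖(E ^ g.1) b c * (E ^ g.2) d a - G b c * G d a‖) (atTop ×ˢ atTop)
        (𝓝 (|C| * ∑ a, ∑ b, ∑ c, |C| * ∑ d, ‖G b c * G d a - G b c * G d a‖)) :=
      (tendsto_finsetSum _ fun a _ => tendsto_finsetSum _ fun b _ => tendsto_finsetSum _ fun c _ =>
        (tendsto_finsetSum _ fun d _ => ((((hent b c).comp tendsto_fst).mul
          ((hent d a).comp tendsto_snd)).sub_const _).norm).const_mul _).const_mul _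
    simpa using this
  set W : ℝ := |C| * ∑ a, ∑ b, ‖G b a‖ with hW
  have hW0 : 0 ≤ W := mul_nonneg (abs_nonneg _)
    (Finset.sum_nonneg fun _ _ => Finset.sum_nonneg fun _ _ => norm_nonneg _)
  set η : ℝ := min 1 (δ / (2 * W + 2)) with hη
  have hη0 : 0 < η := lt_min one_pos (by positivity)
  have hη1 : η ≤ 1 := min_le_left _ _
  have hηδ : η * (2 * W + 2) ≤ δ := by
    rw [← le_div_iff₀ (by positivity)]; exact min_le_right _ _
  rw [prod_atTop_atTop_eq] at h2
  obtain ⟨⟨n₁, n₂⟩, hn⟩ := eventually_atTop.1 (h2.eventually (ge_mem_nhds hη0))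
  obtain ⟨n₃, hn₃⟩ := eventually_atTop.1 (h1.eventually (ge_mem_nhds hη0))
  filter_upwards [eventually_ge_atTop (n₁ + n₂ + n₃)] with L hL g₁ g₂ g₃ g₄ hg₁ hg₂ hg₃ hg₄ M M' hM hM'
  replace hM : ∀ a b, ‖M a b‖ ≤ |C| := fun a b => (hM a b).trans (le_abs_self _)
  replace hM' : ∀ a b, ‖M' a b‖ ≤ |C| := fun a b => (hM' a b).trans (le_abs_self _)
  have k1 := (norm_trace_mul_mul_sub_le hM hM' (E ^ g₁) (E ^ g₂) G).trans
    (hn (g₁, g₂) ⟨by change n₁ ≤ g₁; omega, by change n₂ ≤ g₂; omega⟩)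
  have k2 := (norm_trace_mul_sub_le hM (E ^ g₃) G).trans (hn₃ g₃ (by omega))
  have k3 := (norm_trace_mul_sub_le hM' (E ^ g₄) G).trans (hn₃ g₄ (by omega))
  have k4 : ‖(M * G).trace‖ ≤ W := by
    simpa using norm_trace_mul_sub_le hM G 0
  have k5 : ‖(M' * G).trace‖ ≤ W := by
    simpa using norm_trace_mul_sub_le hM' G 0
  rw [hG] at k1
  set x := (M * G).trace
  set y := (M' * G).trace
  set x' := (M * E ^ g₃).trace
  set y' := (M' * E ^ g₄).trace
  set z := (M * (E ^ g₁ * (M' * E ^ g₂))).trace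
  refine ⟨k1.trans (by nlinarith), ?_⟩
  have e : x * y - x' * y' = -((x' - x) * (y' - y)) - x * (y' - y) - (x' - x) * y := by ring
  rw [e]
  calc _ ≤ ‖x' - x‖ * ‖y' - y‖ + ‖x‖ * ‖y' - y‖ + ‖x' - x‖ * ‖y‖ := by
        refine (norm_sub_le _ _).trans (add_le_add ((norm_sub_le _ _).trans (add_le_add
          ?_ ?_)) ?_) <;> simp only [norm_mul, norm_neg, le_refl]
    _ ≤ η * η + W * η + η * W := by gcongr
    _ ≤ δ := by nlinarith

end TraceLimits

section FixedPoint

variable {b : ℕ} (P : RGFixedPoint b)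

lemma RGFixedPoint.tensor_apply (j : Fin b) (s : P.Site) (a c : Fin (P.dim j)) :
    P.tensor j s a c = if s = (⟨j, a⟩, ⟨j, c⟩) then ((Real.sqrt (P.wt ⟨j, c⟩) : ℝ) : ℂ) else 0 :=
  rfl

lemma RGFixedPoint.transfer_tensor_ne {j k : Fin b} (h : j ≠ k) :
    transfer (P.tensor j) (P.tensor k) = 0 := by
  ext a c
  simp only [transfer, Matrix.sum_apply, Matrix.kroneckerMap_apply, Matrix.map_apply,
    Matrix.zero_apply]
  refine Finset.sum_eq_zero fun s _ => ?_
  simp only [RGFixedPoint.tensor_apply]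
  by_cases h1 : s = (⟨j, a.1⟩, ⟨j, c.1⟩)
  · rw [if_neg (c := s = (⟨k, a.2⟩, ⟨k, c.2⟩)), star_zero, mul_zero]
    rintro rfl
    simp only [Prod.mk.injEq, Sigma.mk.injEq] at h1
    exact h h1.1.1.symm
  · rw [if_neg h1, zero_mul]

/-- The fixed-point transfer matrix of a single block has rank one. -/
lemma RGFixedPoint.transfer_tensor_self (j : Fin b) :
    transfer (P.tensor j) (P.tensor j) = Matrix.vecMulVec (fun a => if a.1 = a.2 then 1 else 0)
      (fun c => if c.1 = c.2 then ((P.wt ⟨j, c.1⟩ : ℝ) : ℂ) else 0) := by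
  ext a c
  simp only [transfer, Matrix.sum_apply, Matrix.kroneckerMap_apply, Matrix.map_apply,
    RGFixedPoint.tensor_apply, Matrix.vecMulVec_apply]
  rw [Finset.sum_eq_single (⟨j, a.1⟩, ⟨j, c.1⟩)]
  · rw [if_pos rfl]
    by_cases h1 : a.1 = a.2
    · by_cases h2 : c.1 = c.2
      · rw [if_pos h1, if_pos h2, if_pos (by rw [h1, h2]), ← h2, one_mul]
        simp only [Complex.star_def, Complex.conj_ofReal]
        rw [← Complex.ofReal_mul, Real.mul_self_sqrt (P.wt_pos _).le]
      · rw [if_neg h2, if_neg, star_zero, mul_zero, mul_zero]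
        simp [h2]
    · rw [if_neg h1, if_neg, star_zero, mul_zero, zero_mul]
      simp [h1]
  · intro s _ hs
    rw [if_neg hs, zero_mul]
  · simp

lemma RGFixedPoint.trace_transfer_tensor (j : Fin b) :
    (transfer (P.tensor j) (P.tensor j)).trace = 1 := by
  rw [P.transfer_tensor_self, Matrix.trace_vecMulVec, dotProduct, Fintype.sum_prod_type]
  have := congrArg (fun x : ℝ => (x : ℂ)) (P.wt_sum j)
  simpa using this

lemma RGFixedPoint.trace_factor (j k : Fin b)
    (M M' : Matrix (Fin (P.dim j) × Fin (P.dim k)) (Fin (P.dim j) × Fin (P.dim k)) ℂ) :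
    (M * (transfer (P.tensor j) (P.tensor k) * (M' * transfer (P.tensor j) (P.tensor k)))).trace =
      (M * transfer (P.tensor j) (P.tensor k)).trace *
        (M' * transfer (P.tensor j) (P.tensor k)).trace := by
  by_cases h : j = k
  · subst h
    rw [P.transfer_tensor_self]
    generalize (fun a : Fin (P.dim j) × Fin (P.dim j) => if a.1 = a.2 then (1 : ℂ) else 0) = r
    generalize (fun c : Fin (P.dim j) × Fin (P.dim j) =>
      if c.1 = c.2 then ((P.wt ⟨j, c.1⟩ : ℝ) : ℂ) else 0) = l
    have h : ∀ v, Matrix.vecMulVec r l *ᵥ v = (l ⬝ᵥ v) • r := fun v => by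
      ext a
      simp only [Matrix.mulVec, Matrix.vecMulVec_apply, dotProduct, Pi.smul_apply, smul_eq_mul,
        Finset.sum_mul]
      exact Finset.sum_congr rfl fun _ _ => by ring
    simp only [Matrix.mul_vecMulVec, Matrix.trace_vecMulVec, h, Matrix.mulVec_smul,
      smul_dotProduct, smul_eq_mul]
    rw [dotProduct_comm l, mul_comm]
  · simp [P.transfer_tensor_ne h]

variable {β : Type} [Fintype β] [DecidableEq β]

/-- The tensors `B j`, with the bond spaces of the fixed point, flow to the fixed-point tensors
under blocking. -/
def RGFixedPoint.IsLimitOf (B : ∀ j, β → Matrix (Fin (P.dim j)) (Fin (P.dim j)) ℂ) : Prop :=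
  ∀ j k, Tendsto (fun n : ℕ => transfer (B j) (B k) ^ n) atTop
    (𝓝 (transfer (P.tensor j) (P.tensor k)))

variable {P} {B : ∀ j, β → Matrix (Fin (P.dim j)) (Fin (P.dim j)) ℂ}

namespace RGFixedPoint.IsLimitOf

lemma tendsto_apply (hB : P.IsLimitOf B) (j k : Fin b) (a c) :
    Tendsto (fun n : ℕ => (transfer (B j) (B k) ^ n) a c) atTop
      (𝓝 (transfer (P.tensor j) (P.tensor k) a c)) :=
  tendsto_pi_nhds.1 (tendsto_pi_nhds.1 (hB j k) a) c

lemma tendsto_inner (hB : P.IsLimitOf B) (j k : Fin b) :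
    Tendsto (fun N => star (mps (B k) N) ⬝ᵥ mps (B j) N) atTop
      (𝓝 (if j = k then 1 else 0)) := by
  simp only [star_mps_dotProduct]
  have h : Tendsto (fun n : ℕ => (transfer (B j) (B k) ^ n).trace) atTop
      (𝓝 (transfer (P.tensor j) (P.tensor k)).trace) :=
    tendsto_finsetSum _ fun a _ => hB.tendsto_apply j k a a
  split_ifs with hjk
  · subst hjk
    rwa [P.trace_transfer_tensor] at h
  · rwa [P.transfer_tensor_ne hjk, Matrix.trace_zero] at h

lemma exists_nrm_openMps_le (hB : P.IsLimitOf B) :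
    ∃ K : ℝ, 0 ≤ K ∧ ∀ j m a c, nrm (openMps (B j) m a c) ≤ K := by
  have h : ∀ i : Σ j, Fin (P.dim j) × Fin (P.dim j), ∃ K : ℝ, ∀ m,
      nrm (openMps (B i.1) m i.2.1 i.2.2) ^ 2 ≤ K := fun i => by
    obtain ⟨K, hK⟩ := (hB.tendsto_apply i.1 i.1 (i.2.1, i.2.1) (i.2.2, i.2.2)).norm.bddAbove_range
    refine ⟨K, fun m => ?_⟩
    have h1 := hK ⟨m, rfl⟩
    simp only at h1
    rw [← star_openMps_dotProduct, star_dotProduct_self, Complex.norm_real,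
      Real.norm_of_nonneg (sq_nonneg _)] at h1
    exact h1
  choose f hf using h
  refine ⟨∑ i, (1 + |f i|), Finset.sum_nonneg fun i _ => by positivity, fun j m a c => ?_⟩
  have h1 := hf ⟨j, a, c⟩ m
  have h2 : (1 + |f ⟨j, a, c⟩|) ≤ ∑ i, (1 + |f i|) :=
    Finset.single_le_sum (f := fun i => 1 + |f i|) (fun i _ => by positivity) (Finset.mem_univ _)
  refine le_trans ?_ h2
  have h3 := nrm_nonneg (openMps (B j) m a c)
  have h4 := le_abs_self (f ⟨j, a, c⟩)
  simp only at h1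
  nlinarith

lemma exists_norm_insertion_le (hB : P.IsLimitOf B) (c : ℝ) : ∃ C : ℝ, ∀ j k m
    (T : Matrix (Fin m → β) (Fin m → β) ℂ), OpBound c T →
    ∀ a a', ‖insertion (B j) (B k) T a a'‖ ≤ C := by
  obtain ⟨K, hK0, hK⟩ := hB.exists_nrm_openMps_le
  refine ⟨K * (|c| * K), fun j k m T hT a a' => ?_⟩
  rw [insertion_apply]
  refine ((hT.mono (le_abs_self c)).norm_le _ _).trans ?_
  have := hK k m a.2 a'.2
  have := hK j m a.1 a'.1
  have := nrm_nonneg (openMps (B j) m a.1 a'.1)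
  gcongr

/-- Asymptotically, distinct blocks are locally orthogonal and the single blocks have no
correlations between distant intervals. The ring is divided into `13` parts: the intervals consist of
five parts each and are separated by at least one part on both sides. -/
theorem eventually_factor [Nonempty β] (hB : P.IsLimitOf B) (c : ℝ) {δ : ℝ} (hδ : 0 < δ) :
    ∀ᶠ L : ℕ in atTop, ∀ N : ℕ, 13 * L ≤ N → ∀ X Y : Matrix (Fin N → β) (Fin N → β) ℂ,
      X ∈ Loc (β := β) {n : Fin N | L ≤ n.val ∧ n.val < 6 * L} →
      Y ∈ Loc (β := β) {n : Fin N | 7 * L ≤ n.val ∧ n.val < 12 * L} →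
      OpBound c X → OpBound c Y → ∀ j k,
      ‖star (mps (B k) N) ⬝ᵥ ((X * Y) *ᵥ mps (B j) N) -
        (if j = k then expv (mps (B j) N) X * expv (mps (B j) N) Y else 0)‖ ≤ δ := by
  obtain ⟨C, hC⟩ := hB.exists_norm_insertion_le c
  have h1 := eventually_all.2 fun j => eventually_all.2 fun k =>
    eventually_trace_factor (hB j k) (P.trace_factor j k) C (half_pos hδ)
  filter_upwards [h1] with L hL N hN X Y hX hY hXc hYc j k
  obtain ⟨n, rfl⟩ : ∃ n, N = L + (5 * L + (L + (5 * L + n))) := ⟨N - 12 * L, by omega⟩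
  obtain ⟨X₁, hX₁, rfl⟩ := exists_one_opAppend (fun k hk => by
    simp only [Set.mem_ofPred_eq, Fin.val_castAdd] at hk; omega) hX
  obtain ⟨X₂, -, rfl⟩ := exists_opAppend_one (fun k hk => by
    simp only [Set.mem_preimage, Set.mem_ofPred_eq, Fin.val_natAdd] at hk; omega) hX₁
  obtain ⟨Y₁, hY₁, rfl⟩ := exists_one_opAppend (fun k hk => by
    simp only [Set.mem_ofPred_eq, Fin.val_castAdd] at hk; omega) hY
  obtain ⟨Y₂, hY₂, rfl⟩ := exists_one_opAppend (fun k hk => by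
    simp only [Set.mem_preimage, Set.mem_ofPred_eq, Fin.val_natAdd, Fin.val_castAdd] at hk
    omega) hY₁
  obtain ⟨Y₃, hY₃, rfl⟩ := exists_one_opAppend (fun k hk => by
    simp only [Set.mem_preimage, Set.mem_ofPred_eq, Fin.val_natAdd, Fin.val_castAdd] at hk
    omega) hY₂
  obtain ⟨Y₄, -, rfl⟩ := exists_opAppend_one (fun k hk => by
    simp only [Set.mem_preimage, Set.mem_ofPred_eq, Fin.val_natAdd] at hk; omega) hY₃
  have hXb := hC j k _ X₂ hXc.of_one_opAppend.of_opAppend_one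
  have hYb := hC j k _ Y₄
    hYc.of_one_opAppend.of_one_opAppend.of_one_opAppend.of_opAppend_one
  obtain ⟨k1, k2⟩ := hL j k L (n + L) (L + (5 * L + n) + L) (n + (L + (5 * L + L))) le_rfl
    (by omega) (by omega) (by omega) _ _ hXb hYb
  have e1 : star (mps (B k) (L + (5 * L + (L + (5 * L + n))))) ⬝ᵥ
      ((opAppend (1 : Matrix (Fin L → β) (Fin L → β) ℂ)
        (opAppend X₂ (1 : Matrix (Fin (L + (5 * L + n)) → β) (Fin (L + (5 * L + n)) → β) ℂ)) *
      opAppend 1 (opAppend 1 (opAppend 1 (opAppend Y₄ 1)))) *ᵥ mps (B j) _) =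
      (insertion (B j) (B k) X₂ * (transfer (B j) (B k) ^ L *
        (insertion (B j) (B k) Y₄ * transfer (B j) (B k) ^ (n + L)))).trace := by
    rw [opAppend_mul, opAppend_mul, Matrix.mul_one, Matrix.mul_one, Matrix.one_mul,
      star_mps_dotProduct_mulVec]
    simp only [insertion_opAppend, insertion_one]
    rw [Matrix.trace_mul_comm]
    simp only [Matrix.mul_assoc, pow_add]
  rw [e1]
  split_ifs with hjk
  · subst hjk
    have e2 : expv (mps (B j) (L + (5 * L + (L + (5 * L + n)))))
        (opAppend (1 : Matrix (Fin L → β) (Fin L → β) ℂ) (opAppend X₂ 1)) =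
        (insertion (B j) (B j) X₂ * transfer (B j) (B j) ^ (L + (5 * L + n) + L)).trace := by
      rw [expv, star_mps_dotProduct_mulVec]
      simp only [insertion_opAppend, insertion_one]
      rw [Matrix.trace_mul_comm]
      simp only [Matrix.mul_assoc, pow_add]
    have e3 : expv (mps (B j) (L + (5 * L + (L + (5 * L + n)))))
        (opAppend (1 : Matrix (Fin L → β) (Fin L → β) ℂ)
          (opAppend (1 : Matrix (Fin (5 * L) → β) (Fin (5 * L) → β) ℂ)
            (opAppend (1 : Matrix (Fin L → β) (Fin L → β) ℂ) (opAppend Y₄ 1)))) =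
        (insertion (B j) (B j) Y₄ * transfer (B j) (B j) ^ (n + (L + (5 * L + L)))).trace := by
      rw [expv, star_mps_dotProduct_mulVec]
      simp only [insertion_opAppend, insertion_one]
      simp only [← Matrix.mul_assoc]
      rw [Matrix.mul_assoc, Matrix.trace_mul_comm]
      simp only [Matrix.mul_assoc, pow_add]
    rw [e2, e3]
    refine (norm_sub_le_norm_sub_add_norm_sub _ _ _).trans ((add_le_add k1 k2).trans_eq ?_)
    ring
  · rw [P.transfer_tensor_ne hjk, Matrix.mul_zero, Matrix.trace_zero, zero_mul] at k1
    exact k1.trans (half_le_self hδ.le)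

end RGFixedPoint.IsLimitOf

end FixedPoint

/-! ### Local operators that distinguish the blocks -/

section Probe

variable {β : Type} [Fintype β] [DecidableEq β]

/-- The projection onto `a`, up to normalization, on the middle part of a chain. -/
def probe (s : ℕ) {L : ℕ} (r : ℕ) (a : (Fin L → β) → ℂ) :
    Matrix (Fin (s + (L + r)) → β) (Fin (s + (L + r)) → β) ℂ :=
  opAppend 1 (opAppend (Matrix.vecMulVec a (star a)) 1)

variable (s : ℕ) {L : ℕ} (r : ℕ) (a : (Fin L → β) → ℂ)

lemma opBound_probe {K : ℝ} (ha : nrm a ≤ K) : OpBound (K ^ 2) (probe s r a) := by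
  refine OpBound.mono (pow_le_pow_left₀ (nrm_nonneg a) ha 2)
    (opBound_of_mul_self (sq_nonneg (nrm a)) ?_ ?_)
  · rw [probe, opAppend_conjTranspose, opAppend_conjTranspose, conjTranspose_one, conjTranspose_one,
      conjTranspose_vecMulVec, star_star]
  · have h : Matrix.vecMulVec a (star a) * Matrix.vecMulVec a (star a) =
        ((nrm a ^ 2 : ℝ) : ℂ) • Matrix.vecMulVec a (star a) := by
      ext x y
      rw [← star_dotProduct_self]
      simp only [Matrix.mul_apply, Matrix.vecMulVec_apply, Matrix.smul_apply, smul_eq_mul,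
        dotProduct, Finset.sum_mul]
      exact Finset.sum_congr rfl fun _ _ => by ring
    rw [probe, opAppend_mul, opAppend_mul, Matrix.mul_one, Matrix.mul_one, h]
    ext x y
    simp only [opAppend, Matrix.smul_apply, smul_eq_mul]
    ring

lemma isEntryLocal_probe :
    IsEntryLocal {n : Fin (s + (L + r)) | s ≤ n.val ∧ n.val < s + L} (probe s r a) := by
  constructor
  · rintro x y ⟨k, hk, hne⟩
    simp only [probe, opAppend, Matrix.one_apply]
    by_cases h : k.val < s
    · rw [if_neg, zero_mul]
      exact fun h' => hne (congrFun h' ⟨k.val, h⟩)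
    · have hk2 : s + L ≤ k.val := by
        simp only [Set.mem_ofPred_eq] at hk; omega
      rw [if_neg (c := (fun i : Fin r => x _) = _), mul_zero, mul_zero]
      intro h'
      have h2 := congrFun h' ⟨k.val - (s + L), by omega⟩
      have e : Fin.natAdd s (Fin.natAdd L (⟨k.val - (s + L), by omega⟩ : Fin r)) = k :=
        Fin.ext (by simp only [Fin.val_natAdd]; omega)
      rw [e] at h2
      exact hne h2
  · intro x y x' y' h h'
    have m1 : ∀ k : Fin L, s ≤ (Fin.natAdd s (Fin.castAdd r k)).val ∧
        (Fin.natAdd s (Fin.castAdd r k)).val < s + L := fun k => by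
      simp only [Fin.val_natAdd, Fin.val_castAdd]; omega
    have m2 : ∀ k : Fin s, ¬ (s ≤ (Fin.castAdd (L + r) k).val ∧
        (Fin.castAdd (L + r) k).val < s + L) := fun k => by
      simp only [Fin.val_castAdd]; omega
    have m3 : ∀ k : Fin r, ¬ (s ≤ (Fin.natAdd s (Fin.natAdd L k)).val ∧
        (Fin.natAdd s (Fin.natAdd L k)).val < s + L) := fun k => by
      simp only [Fin.val_natAdd]; omega
    simp only [probe, opAppend, Matrix.one_apply, Matrix.vecMulVec_apply]
    have e1 : (fun k : Fin s => x (Fin.castAdd (L + r) k)) = fun k => y (Fin.castAdd (L + r) k) :=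
      funext fun k => (h' _ (m2 k)).1
    have e2 : (fun k : Fin s => x' (Fin.castAdd (L + r) k)) = fun k => y' (Fin.castAdd (L + r) k) :=
      funext fun k => (h' _ (m2 k)).2
    have e3 : (fun k : Fin r => x (Fin.natAdd s (Fin.natAdd L k))) =
        fun k => y (Fin.natAdd s (Fin.natAdd L k)) := funext fun k => (h' _ (m3 k)).1
    have e4 : (fun k : Fin r => x' (Fin.natAdd s (Fin.natAdd L k))) =
        fun k => y' (Fin.natAdd s (Fin.natAdd L k)) := funext fun k => (h' _ (m3 k)).2
    simp only [e1, e2, e3, e4, fun k => (h _ (m1 k)).1, fun k => (h _ (m1 k)).2]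

variable {b : ℕ} {P : RGFixedPoint b} {B : ∀ j, β → Matrix (Fin (P.dim j)) (Fin (P.dim j)) ℂ}

/-- For each block there is a bounded operator on a long interval whose expectation value is positive
in this block and asymptotically zero in the others: the projection onto an open-chain vector. -/
theorem RGFixedPoint.IsLimitOf.exists_probe (hB : P.IsLimitOf B) : ∃ (c : ℝ) (w : Fin b → ℝ),
    0 ≤ c ∧ (∀ j, 0 < w j) ∧ ∀ δ : ℝ, 0 < δ → ∀ᶠ L : ℕ in atTop, ∀ N s : ℕ, s + 2 * L ≤ N → ∀ j,
      ∃ T : Matrix (Fin N → β) (Fin N → β) ℂ,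
        IsEntryLocal {n : Fin N | s ≤ n.val ∧ n.val < s + L} T ∧ OpBound c T ∧
        ∀ k, ‖expv (mps (B k) N) T - (if k = j then (w j : ℂ) else 0)‖ ≤ δ := by
  obtain ⟨K, hK0, hK⟩ := hB.exists_nrm_openMps_le
  have hne : ∀ j, Nonempty (Fin (P.dim j)) := fun j => by
    by_contra h
    rw [not_nonempty_iff] at h
    simpa using P.wt_sum j
  let i : ∀ j, Fin (P.dim j) := fun j => Classical.choice (hne j)
  -- one weight for each of the two overlaps of the block with the open chain, and one for the closure
  -- of the ring
  let w : Fin b → ℝ := fun j => P.wt ⟨j, i j⟩ ^ 3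
  refine ⟨K ^ 2, w, sq_nonneg K, fun j => pow_pos (P.wt_pos _) 3, fun δ hδ => ?_⟩
  -- the chain vector of the block `j`; inserting its projection into the block `k` factorizes into
  -- powers of the mixed transfer matrix, which vanish in the limit for `k ≠ j`
  let a : ∀ (_ : Fin b) (L : ℕ), (Fin L → β) → ℂ := fun j L => openMps (B j) L (i j) (i j)
  let I : ∀ (j k : Fin b) (L : ℕ), Matrix (Fin (P.dim k) × Fin (P.dim k)) _ ℂ := fun j k L =>
    insertion (B k) (B k) (Matrix.vecMulVec (a j L) (star (a j L)))
  have hI : ∀ j k L x y, I j k L x y = star ((transfer (B k) (B j) ^ L) (x.2, i j) (y.2, i j)) *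
      (transfer (B k) (B j) ^ L) (x.1, i j) (y.1, i j) := fun j k L x y => by
    rw [← star_openMps_dotProduct, ← star_openMps_dotProduct, ← star_dotProduct]
    simp only [I]
    rw [insertion_apply]
    simp only [dotProduct, Matrix.mulVec, Matrix.vecMulVec_apply, Finset.mul_sum, Finset.sum_mul,
      Pi.star_apply]
    rw [Finset.sum_comm]
    exact Finset.sum_congr rfl fun _ _ => Finset.sum_congr rfl fun _ _ => by simp only [a]; ring
  have hlim : ∀ j k, Tendsto (fun g : ℕ × ℕ => (I j k g.1 * transfer (B k) (B k) ^ g.2).trace)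
      (atTop ×ˢ atTop) (𝓝 (if k = j then (w j : ℂ) else 0)) := fun j k => by
    have h : Tendsto (fun g : ℕ × ℕ => (I j k g.1 * transfer (B k) (B k) ^ g.2).trace)
        (atTop ×ˢ atTop) (𝓝 (∑ x, ∑ y,
          star (transfer (P.tensor k) (P.tensor j) (x.2, i j) (y.2, i j)) *
          transfer (P.tensor k) (P.tensor j) (x.1, i j) (y.1, i j) *
          transfer (P.tensor k) (P.tensor k) y x)) := by
      simp only [Matrix.trace, Matrix.diag, Matrix.mul_apply, hI]
      exact tendsto_finsetSum _ fun x _ => tendsto_finsetSum _ fun y _ =>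
        ((((hB.tendsto_apply k j _ _).star.comp tendsto_fst).mul
          ((hB.tendsto_apply k j _ _).comp tendsto_fst)).mul
          ((hB.tendsto_apply k k _ _).comp tendsto_snd))
    convert h using 2
    split_ifs with hkj
    · subst hkj
      rw [P.transfer_tensor_self]
      simp only [Matrix.vecMulVec_apply]
      rw [Finset.sum_eq_single (i k, i k), Finset.sum_eq_single (i k, i k)]
      · simp [w]; ring
      · intro y _ hy
        by_cases h1 : y.1 = i k
        · have h2 : y.2 ≠ i k := fun h2 => hy (Prod.ext h1 h2)
          simp [h2]
        · simp [h1]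
      · simp
      · intro x _ hx
        refine Finset.sum_eq_zero fun y _ => ?_
        by_cases h1 : x.1 = i k
        · have h2 : x.2 ≠ i k := fun h2 => hx (Prod.ext h1 h2)
          simp [h2]
        · simp [h1]
      · simp
    · simp [P.transfer_tensor_ne hkj]
  simp only [prod_atTop_atTop_eq] at hlim
  have h1 : ∀ᶠ L : ℕ in atTop, ∀ j k, ∀ g, L ≤ g →
      ‖(I j k L * transfer (B k) (B k) ^ g).trace - (if k = j then (w j : ℂ) else 0)‖ ≤ δ := by
    refine eventually_all.2 fun j => eventually_all.2 fun k => ?_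
    obtain ⟨⟨n₁, n₂⟩, hn⟩ := eventually_atTop.1
      ((hlim j k).eventually (Metric.closedBall_mem_nhds _ hδ))
    filter_upwards [eventually_ge_atTop (n₁ + n₂)] with L hL g hg
    have := hn (L, g) ⟨by change n₁ ≤ L; omega, by change n₂ ≤ g; omega⟩
    rwa [dist_eq_norm] at this
  filter_upwards [h1] with L hL N s hN j
  obtain ⟨r, rfl⟩ : ∃ r, N = s + (L + r) := ⟨N - s - L, by omega⟩
  refine ⟨probe s r (a j L), isEntryLocal_probe _ _ _, opBound_probe _ _ _ (hK _ _ _ _), fun k => ?_⟩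
  have e : expv (mps (B k) (s + (L + r))) (probe s r (a j L)) =
      (I j k L * transfer (B k) (B k) ^ (r + s)).trace := by
    rw [expv, probe, star_mps_dotProduct_mulVec]
    simp only [insertion_opAppend, insertion_one]
    rw [Matrix.trace_mul_comm]
    simp only [I, Matrix.mul_assoc, pow_add]
  rw [e]
  exact hL j k _ (by omega)

end Probe

/-! ### Sites of several qubits -/

section Sites

variable {N q : ℕ}

/-- Basis labels of `N * q` qubits as labels of `N` sites. -/
def siteEquiv (N q : ℕ) : Bits (N * q) ≃ (Fin N → Bits q) where
  toFun x n k := x (finProdFinEquiv (n, k))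
  invFun y i := y (finProdFinEquiv.symm i).1 (finProdFinEquiv.symm i).2
  left_inv x := by funext i; exact congrArg x (finProdFinEquiv.apply_symm_apply i)
  right_inv y := by funext n k; simp

lemma mem_interval_iff (s t : ℕ) (n : Fin N) (k : Fin q) :
    finProdFinEquiv (n, k) ∈ interval (N * q) (s * q) (t * q) ↔ s ≤ n.val ∧ n.val < t := by
  have hk := k.2
  simp only [interval, Set.mem_ofPred_eq, finProdFinEquiv_apply_val]
  constructor
  · rintro ⟨h1, h2⟩
    constructor
    · by_contra! h
      nlinarith [Nat.mul_le_mul_right q (Nat.succ_le_of_lt h)]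
    · by_contra! h
      nlinarith [Nat.mul_le_mul_right q h]
  · rintro ⟨h1, h2⟩
    constructor
    · nlinarith [Nat.mul_le_mul_right q h1]
    · nlinarith [Nat.mul_le_mul_right q (Nat.succ_le_of_lt h2)]

/-- Operators on the qubits of an interval of sites, as operators on the sites. -/
lemma submatrix_siteEquiv_mem_Loc {s t : ℕ} {T : QOp (N * q)}
    (hT : T ∈ Loc (β := Fin 2) (interval (N * q) (s * q) (t * q))) :
    T.submatrix (siteEquiv N q).symm (siteEquiv N q).symm ∈
      Loc (β := Bits q) {n : Fin N | s ≤ n.val ∧ n.val < t} := by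
  induction hT using Submodule.span_induction with
  | mem T hT =>
    obtain ⟨M, hM, rfl⟩ := hT
    have e : (prodOp M).submatrix (siteEquiv N q).symm (siteEquiv N q).symm =
        prodOp fun n : Fin N => prodOp fun k : Fin q => M (finProdFinEquiv (n, k)) := by
      ext x y
      simp only [prodOp, Matrix.submatrix_apply]
      rw [← finProdFinEquiv.prod_comp, Fintype.prod_prod_type]
      have h : ∀ (z : Fin N → Bits q) n k,
          (siteEquiv N q).symm z (finProdFinEquiv (n, k)) = z n k := fun z n k => by
        change z (finProdFinEquiv.symm (finProdFinEquiv (n, k))).1 _ = _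
        rw [Equiv.symm_apply_apply]
      simp only [h]
    rw [e]
    refine prodOp_mem_Loc fun n hn => ?_
    rw [← prodOp_one]
    congr 1
    funext k
    exact hM _ fun h => hn ((mem_interval_iff s t n k).1 h)
  | zero => simp
  | add T T' _ _ h h' => exact add_mem h h'
  | smul c T _ h => exact Submodule.smul_mem _ c h

lemma IsEntryLocal.submatrix_siteEquiv {s t : ℕ} {T : Matrix (Fin N → Bits q) (Fin N → Bits q) ℂ}
    (hT : IsEntryLocal {n : Fin N | s ≤ n.val ∧ n.val < t} T) :
    IsEntryLocal (interval (N * q) (s * q) (t * q))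
      (T.submatrix (siteEquiv N q) (siteEquiv N q)) := by
  constructor
  · rintro x y ⟨i, hi, hne⟩
    obtain ⟨⟨n, k⟩, rfl⟩ := finProdFinEquiv.surjective i
    exact hT.1 _ _ ⟨n, fun h => hi ((mem_interval_iff s t n k).2 h), fun h => hne (congrFun h k)⟩
  · intro x y x' y' h h'
    refine hT.2 _ _ _ _ (fun n hn => ⟨?_, ?_⟩) (fun n hn => ⟨?_, ?_⟩) <;> funext k
    · exact (h _ ((mem_interval_iff s t n k).2 hn)).1
    · exact (h _ ((mem_interval_iff s t n k).2 hn)).2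
    · exact (h' _ fun hh => hn ((mem_interval_iff s t n k).1 hh)).1
    · exact (h' _ fun hh => hn ((mem_interval_iff s t n k).1 hh)).2

lemma prod_ofFn_sum {ι R : Type*} [Fintype ι] [Semiring R] (f : Fin N → ι → R) :
    (List.ofFn fun n => ∑ i, f n i).prod = ∑ i : Fin N → ι, (List.ofFn fun n => f n (i n)).prod := by
  induction N with
  | zero => simp
  | succ N ih =>
    rw [List.ofFn_succ, List.prod_cons, ih, Finset.sum_mul_sum, ← (Fin.consEquiv _).sum_comp,
      Fintype.sum_prod_type]
    simp [List.ofFn_succ, Fin.consEquiv]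

/-- Encoding the sites of a matrix product state into qubits changes the tensor only. -/
lemma encode_mps {ι κ : Type} [Fintype ι] [DecidableEq ι] [Fintype κ] [DecidableEq κ]
    (V : ι → QState q) (A : ι → Matrix κ κ ℂ) :
    encode V (mps A N) = mps (fun x => ∑ i, V i x • A i) N ∘ siteEquiv N q := by
  funext x
  have h : ∀ (m : ℕ) (c : Fin m → ℂ) (M : Fin m → Matrix κ κ ℂ),
      (List.ofFn fun n => c n • M n).prod = (∏ n, c n) • (List.ofFn M).prod := fun m c M => by
    induction m with
    | zero => simp
    | succ m ih =>
      rw [List.ofFn_succ, List.prod_cons, ih, List.ofFn_succ (f := M), List.prod_cons,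
        Fin.prod_univ_succ, smul_mul_smul_comm]
  simp only [encode, mps, Function.comp, prod_ofFn_sum, Matrix.trace_sum, h, Matrix.trace_smul,
    smul_eq_mul]
  exact Finset.sum_congr rfl fun i _ => mul_comm _ _

lemma transfer_sum_smul {ι κ κ' : Type} [Fintype ι] [DecidableEq ι] [Fintype κ] [Fintype κ']
    (V : ι → QState q) (A : ι → Matrix κ κ ℂ) (A' : ι → Matrix κ' κ' ℂ)
    (hV : ∀ s t, A s ≠ 0 → A' t ≠ 0 → star (V t) ⬝ᵥ V s = if s = t then 1 else 0) :
    transfer (fun x => ∑ i, V i x • A i) (fun x => ∑ i, V i x • A' i) = transfer A A' := by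
  ext a c
  simp only [transfer, Matrix.sum_apply, Matrix.kroneckerMap_apply, Matrix.map_apply,
    Matrix.smul_apply, smul_eq_mul, star_sum, star_mul', Finset.sum_mul_sum]
  rw [Finset.sum_comm]
  refine Finset.sum_congr rfl fun s _ => ?_
  rw [Finset.sum_comm]
  by_cases hs : A s = 0
  · simp [hs]
  have e : ∀ t, ∑ x, V s x * A s a.1 c.1 * (star (V t x) * star (A' t a.2 c.2)) =
      if s = t then A s a.1 c.1 * star (A' t a.2 c.2) else 0 := fun t => by
    by_cases ht : A' t = 0
    · simp [ht]
    · have h : ∑ x, V s x * A s a.1 c.1 * (star (V t x) * star (A' t a.2 c.2)) =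
          A s a.1 c.1 * star (A' t a.2 c.2) * (star (V t) ⬝ᵥ V s) := by
        rw [dotProduct, Finset.mul_sum]
        exact Finset.sum_congr rfl fun _ _ => by simp only [Pi.star_apply]; ring
      rw [h, hV s t hs ht, mul_ite, mul_one, mul_zero]
  rw [Finset.sum_congr rfl fun t _ => e t, Finset.sum_ite_eq, if_pos (Finset.mem_univ s)]

end Sites

/-! ### Stabilizer states close to circuits applied to matrix product states -/

section Close

variable {X : Type*} [Fintype X]

/-- Expectation values in states with large overlap are close. The vector `ψ` is normalized only
approximately; `ε` is the bound on `pureDist ψ S`. -/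
lemma norm_expv_sub_expv_le {ψ S : X → ℂ} (hS : nrm S = 1) {ε r c : ℝ} (hr0 : 0 ≤ r) (hr1 : r ≤ 1)
    (hov : 1 - ε ^ 2 ≤ ‖star ψ ⬝ᵥ S‖ ^ 2) (h : |nrm ψ ^ 2 - 1| + ε ^ 2 ≤ r ^ 2) (hc : 0 ≤ c)
    {T : Matrix X X ℂ} (hT : OpBound c T) : ‖expv S T - expv ψ T‖ ≤ 5 * c * r := by
  set z := star S ⬝ᵥ ψ with hz
  have hzs : star ψ ⬝ᵥ S = star z := by rw [hz, ← star_dotProduct]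
  have hzn : ‖star ψ ⬝ᵥ S‖ = ‖z‖ := by rw [hzs, norm_star]
  rw [hzn] at hov
  have h1 := le_abs_self (nrm ψ ^ 2 - 1)
  have hψ : nrm ψ ≤ 3 / 2 := by
    nlinarith [nrm_nonneg ψ, sq_nonneg ε]
  have hz1 : ‖z‖ ≤ nrm ψ := by
    have := norm_star_dotProduct_le S ψ
    rwa [hS, one_mul] at this
  have hnu : nrm (ψ - z • S) ≤ r := by
    have e : nrm (ψ - z • S) ^ 2 = nrm ψ ^ 2 - ‖z‖ ^ 2 := by
      rw [nrm_sub_sq, dotProduct_smul, hzs, smul_eq_mul, nrm_smul, hS, Complex.star_def,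
        Complex.mul_conj, Complex.normSq_eq_norm_sq, Complex.ofReal_re]
      ring
    nlinarith [nrm_nonneg (ψ - z • S)]
  have e : expv S T - expv ψ T = -(star (ψ - z • S) ⬝ᵥ (T *ᵥ ψ)) -
      star (z • S) ⬝ᵥ (T *ᵥ (ψ - z • S)) - ((‖z‖ ^ 2 - 1 : ℝ) : ℂ) * expv S T := by
    have e1 : star z * z = ((‖z‖ ^ 2 : ℝ) : ℂ) := by
      rw [Complex.star_def, ← Complex.normSq_eq_conj_mul_self, Complex.normSq_eq_norm_sq]
    have e2 : star (z • S) ⬝ᵥ (T *ᵥ (z • S)) = ((‖z‖ ^ 2 : ℝ) : ℂ) * expv S T := by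
      rw [star_smul, smul_dotProduct, mulVec_smul, dotProduct_smul, ← e1, expv]
      simp only [smul_eq_mul]; ring
    rw [mulVec_sub, dotProduct_sub, e2, star_sub, sub_dotProduct, ← expv]
    push_cast; ring
  rw [e]
  have b1 : ‖star (ψ - z • S) ⬝ᵥ (T *ᵥ ψ)‖ ≤ r * (c * (3 / 2)) :=
    (hT.norm_le _ _).trans (mul_le_mul hnu (mul_le_mul_of_nonneg_left hψ hc)
      (mul_nonneg hc (nrm_nonneg ψ)) hr0)
  have b2 : ‖star (z • S) ⬝ᵥ (T *ᵥ (ψ - z • S))‖ ≤ 3 / 2 * (c * r) := by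
    refine (hT.norm_le _ _).trans ?_
    rw [nrm_smul, hS, mul_one]
    have := nrm_nonneg (ψ - z • S)
    have := hz1.trans hψ
    gcongr
  have b3 : ‖((‖z‖ ^ 2 - 1 : ℝ) : ℂ) * expv S T‖ ≤ r * c := by
    rw [norm_mul, Complex.norm_real]
    have k1 : ‖expv S T‖ ≤ c := by
      have := hT.norm_le S S
      rwa [hS, one_mul, mul_one] at this
    refine mul_le_mul ?_ k1 (norm_nonneg _) hr0
    rw [Real.norm_eq_abs, abs_le]
    constructor
    · nlinarith [abs_nonneg (nrm ψ ^ 2 - 1)]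
    · nlinarith [norm_nonneg z, sq_nonneg ε]
  have b0 := (norm_sub_le (-(star (ψ - z • S) ⬝ᵥ (T *ᵥ ψ)) - star (z • S) ⬝ᵥ (T *ᵥ (ψ - z • S)))
    (((‖z‖ ^ 2 - 1 : ℝ) : ℂ) * expv S T)).trans (add_le_add_left (norm_sub_le _ _) _)
  rw [norm_neg] at b0
  nlinarith [mul_nonneg hc hr0]

/-- Expectation values in superpositions of nearly orthogonal states. -/
lemma norm_expv_sum_smul_sub_le {b : ℕ} (γ : Fin b → ℂ) (u : Fin b → X → ℂ) (T : Matrix X X ℂ)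
    (d : Fin b → ℂ) {η : ℝ}
    (h : ∀ j k, ‖star (u k) ⬝ᵥ (T *ᵥ u j) - (if j = k then d j else 0)‖ ≤ η) :
    ‖expv (∑ j, γ j • u j) T - ∑ j, ((‖γ j‖ ^ 2 : ℝ) : ℂ) * d j‖ ≤ η * (∑ j, ‖γ j‖) ^ 2 := by
  have e1 : expv (∑ j, γ j • u j) T =
      ∑ k, ∑ j, star (γ k) * γ j * (star (u k) ⬝ᵥ (T *ᵥ u j)) := by
    simp only [expv, star_sum, mulVec_sum, sum_dotProduct, dotProduct_sum, star_smul,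
      smul_dotProduct, mulVec_smul, dotProduct_smul, smul_eq_mul, Finset.mul_sum]
    rw [Finset.sum_comm]
    exact Finset.sum_congr rfl fun _ _ => Finset.sum_congr rfl fun _ _ => by ring
  have e2 : ∑ j, ((‖γ j‖ ^ 2 : ℝ) : ℂ) * d j =
      ∑ k, ∑ j, star (γ k) * γ j * (if j = k then d j else 0) := by
    refine Finset.sum_congr rfl fun k _ => ?_
    simp only [mul_ite, mul_zero, Finset.sum_ite_eq', Finset.mem_univ, if_true]
    rw [Complex.star_def, ← Complex.normSq_eq_conj_mul_self, Complex.normSq_eq_norm_sq]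
  rw [e1, e2]
  simp only [← Finset.sum_sub_distrib, ← mul_sub]
  rw [sq, Finset.sum_mul_sum, Finset.mul_sum]
  refine norm_sum_le_of_le _ fun k _ => ?_
  rw [Finset.mul_sum]
  refine norm_sum_le_of_le _ fun j _ => ?_
  rw [norm_mul, norm_mul, norm_star, mul_comm]
  exact mul_le_mul_of_nonneg_right (h j k) (by positivity)

end Close

lemma IsPolylog.eventually_le {D : ℕ → ℕ} (hD : IsPolylog D) : ∀ᶠ N in atTop, D N ≤ N / 13 := by
  obtain ⟨k, hk⟩ := hD
  have h := hk.trans_isLittleO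
    ((Real.isLittleO_pow_log_id_atTop (n := k)).comp_tendsto tendsto_natCast_atTop_atTop)
  filter_upwards [h.bound (show (0 : ℝ) < 1 / 13 by norm_num)] with N hN
  rw [Nat.le_div_iff_mul_le (by norm_num)]
  simp only [Real.norm_natCast, Function.comp, id] at hN
  have : (D N : ℝ) * 13 ≤ N := by linarith
  exact_mod_cast this

section Circuits

variable {N q D L s t : ℕ} {Q T : QOp (N * q)}

lemma interval_subset_of_le (hD : D ≤ L) :
    interval (N * q) (s * q - D) (t * q + D) ⊆ interval (N * q) ((s - L) * q) ((t + L) * q) := by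
  rintro k ⟨h1, h2⟩
  have hq : 0 < q := by
    rcases Nat.eq_zero_or_pos q with rfl | h
    · exact absurd k.2 (by simp)
    · exact h
  have h3 : D ≤ L * q := hD.trans (Nat.le_mul_of_pos_right L hq)
  refine ⟨?_, ?_⟩
  · rw [Nat.sub_mul]; omega
  · rw [Nat.add_mul]; omega

/-- A circuit of depth at most `L` spreads an interval of sites by at most `L` sites. -/
lemma IsCircuit.conjTranspose_conj_mem_Loc_sites (hQ : IsCircuit D Q) (hD : D ≤ L) (hs : L ≤ s)
    (ht : t + L ≤ N) (hT : T ∈ Loc (β := Fin 2) (interval (N * q) (s * q) (t * q))) :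
    Qᴴ * T * Q ∈ Loc (β := Fin 2) (interval (N * q) ((s - L) * q) ((t + L) * q)) := by
  rcases Nat.eq_zero_or_pos q with rfl | hq
  · exact IsEntryLocal.mem_Loc ⟨fun x y ⟨k, _⟩ => (Fin.elim0 k),
      fun x y x' y' _ _ => by
        rw [show x = x' from funext fun k => Fin.elim0 k,
          show y = y' from funext fun k => Fin.elim0 k]⟩
  · have h3 : D ≤ L * q := hD.trans (Nat.le_mul_of_pos_right L hq)
    have h4 := Nat.mul_le_mul_right q hs
    have h5 := Nat.mul_le_mul_right q ht
    rw [Nat.add_mul] at h5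
    exact Loc_mono (interval_subset_of_le hD)
      (hQ.conjTranspose_conj_mem_Loc (by omega) (by omega) hT)

lemma IsCircuit.conj_mem_Loc_sites (hQ : IsCircuit D Q) (hD : D ≤ L) (hs : L ≤ s)
    (ht : t + L ≤ N) (hT : T ∈ Loc (β := Fin 2) (interval (N * q) (s * q) (t * q))) :
    Q * T * Qᴴ ∈ Loc (β := Fin 2) (interval (N * q) ((s - L) * q) ((t + L) * q)) := by
  rcases Nat.eq_zero_or_pos q with rfl | hq
  · exact IsEntryLocal.mem_Loc ⟨fun x y ⟨k, _⟩ => (Fin.elim0 k),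
      fun x y x' y' _ _ => by
        rw [show x = x' from funext fun k => Fin.elim0 k,
          show y = y' from funext fun k => Fin.elim0 k]⟩
  · have h3 : D ≤ L * q := hD.trans (Nat.le_mul_of_pos_right L hq)
    have h4 := Nat.mul_le_mul_right q hs
    have h5 := Nat.mul_le_mul_right q ht
    rw [Nat.add_mul] at h5
    exact Loc_mono (interval_subset_of_le hD) (hQ.conj_mem_Loc (by omega) (by omega) hT)

end Circuits

lemma OpBound.conj {X : Type*} [Fintype X] [DecidableEq X] {c : ℝ} {T U : Matrix X X ℂ}
    (hT : OpBound c T) (h1 : U * Uᴴ = 1) (h2 : Uᴴ * U = 1) : OpBound c (U * T * Uᴴ) := fun w => by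
  rw [← mulVec_mulVec, ← mulVec_mulVec, nrm_mulVec_of_conjTranspose_mul h2,
    ← nrm_mulVec_of_conjTranspose_mul (U := Uᴴ) (by rwa [conjTranspose_conjTranspose]) w]
  exact hT _

section Main

variable {b q : ℕ} {P : RGFixedPoint b} {B : ∀ j, Bits q → Matrix (Fin (P.dim j)) (Fin (P.dim j)) ℂ}

/-- The state of a block on the qubits. -/
def blockState (B : ∀ j, Bits q → Matrix (Fin (P.dim j)) (Fin (P.dim j)) ℂ) (j : Fin b) (N : ℕ) :
    QState (N * q) := mps (B j) N ∘ siteEquiv N q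

/-- If circuits of small depth bring superpositions of the blocks close to states `S N`, then
correlations between distant regions in `S N` are those of a mixture of uncorrelated states. The
intervals of three of the `13` parts of the ring leave room for light cones of one part on each side,
which turn them into the intervals of `RGFixedPoint.IsLimitOf.eventually_factor`. -/
theorem RGFixedPoint.IsLimitOf.eventually_correlations (hB : P.IsLimitOf B)
    {Ψ : ∀ N, QState (N * q)} {γ : ℕ → Fin b → ℂ} {φ : ℕ → ℕ} (hφ : Tendsto φ atTop atTop)
    (hΨ : ∀ᶠ i in atTop, Ψ (φ i) = ∑ j, γ i j • blockState B j (φ i))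
    {p : Fin b → ℝ} (hp0 : ∀ j, 0 ≤ p j) (hp1 : ∑ j, p j = 1)
    (hγ : ∀ j, Tendsto (fun i => ‖γ i j‖ ^ 2) atTop (𝓝 (p j)))
    {D : ℕ → ℕ} {Q : ∀ N, QOp (N * q)} {S : ∀ N, QState (N * q)} (hD : IsPolylog D)
    (hQ : ∀ N, IsCircuit (D N) (Q N)) (hS : ∀ N, nrm (S N) = 1)
    (hdist : Tendsto (fun i => pureDist (Q (φ i) *ᵥ Ψ (φ i)) (S (φ i))) atTop (𝓝 0))
    {c : ℝ} (hc : 0 ≤ c) {δ : ℝ} (hδ : 0 < δ) :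
    ∀ᶠ i in atTop, ∀ X Y : QOp (φ i * q),
      X ∈ Loc (β := Fin 2) (interval (φ i * q) (2 * (φ i / 13) * q) (5 * (φ i / 13) * q)) →
      Y ∈ Loc (β := Fin 2) (interval (φ i * q) (8 * (φ i / 13) * q) (11 * (φ i / 13) * q)) →
      OpBound c X → OpBound c Y →
      ‖expv (S (φ i)) (X * Y) - ∑ j, (p j : ℂ) *
        (expv (Q (φ i) *ᵥ blockState B j (φ i)) X * expv (Q (φ i) *ᵥ blockState B j (φ i)) Y)‖ ≤
        δ := by
  -- `r` bounds the distance to `S`, `η` the deviations from factorization, `ζ` those of weights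
  obtain ⟨r, hr0, hr1, hrδ⟩ : ∃ r : ℝ, 0 < r ∧ r ≤ 1 ∧ 5 * (c * c) * r ≤ δ / 3 := by
    refine ⟨min 1 (δ / (15 * (c * c + 1))), lt_min one_pos (by positivity), min_le_left _ _, ?_⟩
    have h1 : min 1 (δ / (15 * (c * c + 1))) * (15 * (c * c + 1)) ≤ δ := by
      rw [← le_div_iff₀ (by positivity)]; exact min_le_right _ _
    have h2 : 0 < min 1 (δ / (15 * (c * c + 1))) := lt_min one_pos (by positivity)
    nlinarith
  obtain ⟨η, hη0, hη1, hηδ, hηr⟩ : ∃ η : ℝ, 0 < η ∧ η ≤ 1 ∧ η * (2 * b) ^ 2 ≤ δ / 3 ∧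
      η * (2 * b) ^ 2 ≤ r ^ 2 / 4 := by
    have h0 : 0 < min (min 1 (δ / 3)) (r ^ 2 / 4) :=
      lt_min (lt_min one_pos (by positivity)) (by positivity)
    have h3 : min (min 1 (δ / 3)) (r ^ 2 / 4) / ((2 * b : ℝ) ^ 2 + 1) * (2 * b) ^ 2 ≤
        min (min 1 (δ / 3)) (r ^ 2 / 4) := by
      rw [div_mul_eq_mul_div, div_le_iff₀ (by positivity)]
      nlinarith
    refine ⟨_, div_pos h0 (by positivity : (0 : ℝ) < (2 * b) ^ 2 + 1), ?_,
      h3.trans ((min_le_left _ _).trans (min_le_right _ _)), h3.trans (min_le_right _ _)⟩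
    refine (div_le_self h0.le ?_).trans ((min_le_left _ _).trans (min_le_left _ _))
    nlinarith [sq_nonneg (2 * b : ℝ)]
  obtain ⟨ζ, hζ0, hζr, hζδ⟩ : ∃ ζ : ℝ, 0 < ζ ∧ ζ ≤ r ^ 2 / 4 ∧ ζ * (2 * c * (2 * c)) ≤ δ / 3 := by
    have h0 : 0 < min (r ^ 2 / 4) (δ / (12 * (c * c + 1))) := lt_min (by positivity) (by positivity)
    refine ⟨_, h0, min_le_left _ _, ?_⟩
    have h1 : min (r ^ 2 / 4) (δ / (12 * (c * c + 1))) * (12 * (c * c + 1)) ≤ δ := by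
      rw [← le_div_iff₀ (by positivity)]; exact min_le_right _ _
    nlinarith
  have hL : Tendsto (fun i => φ i / 13) atTop atTop :=
    (Nat.tendsto_div_const_atTop (by norm_num)).comp hφ
  have E1 : ∀ᶠ i in atTop, ∀ j k,
      ‖star (mps (B k) (φ i)) ⬝ᵥ mps (B j) (φ i) - (if j = k then 1 else 0)‖ ≤ η :=
    eventually_all.2 fun j => eventually_all.2 fun k => by
      filter_upwards [((hB.tendsto_inner j k).comp hφ).eventually
        (Metric.closedBall_mem_nhds _ hη0)] with i hi
      rwa [dist_eq_norm] at hi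
  have E2 := hL.eventually (hB.eventually_factor c hη0)
  have E3 : ∀ᶠ i in atTop, ∀ j, ‖γ i j‖ ≤ 2 := eventually_all.2 fun j => by
    have hpj : p j < 4 := by
      have := Finset.single_le_sum (f := p) (fun j _ => hp0 j) (Finset.mem_univ j)
      linarith
    filter_upwards [(hγ j).eventually (gt_mem_nhds hpj)] with i hi
    nlinarith [norm_nonneg (γ i j)]
  have E4 : ∀ᶠ i in atTop, ∑ j, |‖γ i j‖ ^ 2 - p j| ≤ ζ := by
    have : Tendsto (fun i => ∑ j, |‖γ i j‖ ^ 2 - p j|) atTop (𝓝 (∑ j, |p j - p j|)) :=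
      tendsto_finsetSum _ fun j _ => ((hγ j).sub_const _).abs
    simp only [sub_self, abs_zero, Finset.sum_const_zero] at this
    exact this.eventually (ge_mem_nhds hζ0)
  have E5 := hdist.eventually (ge_mem_nhds (half_pos hr0))
  have E6 := hφ.eventually hD.eventually_le
  filter_upwards [E1, E2, E3, E4, E5, E6, hΨ] with i h1 h2 h3 h4 h5 h6 h7 X Y hX hY hXc hYc
  generalize φ i = N at *
  set L := N / 13
  have hLN : 13 * L ≤ N := Nat.mul_div_le N 13
  have hQ1 := (hQ N).mul_conjTranspose
  have hQ2 := (hQ N).conjTranspose_mul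
  have hψ : Q N *ᵥ Ψ N = ∑ j, γ i j • (Q N *ᵥ blockState B j N) := by
    rw [h7, mulVec_sum]
    simp only [mulVec_smul]
  have hG : (∑ j, ‖γ i j‖) ^ 2 ≤ (2 * b : ℝ) ^ 2 := by
    refine pow_le_pow_left₀ (Finset.sum_nonneg fun _ _ => norm_nonneg _) ?_ 2
    refine (Finset.sum_le_sum fun j _ => h3 j).trans_eq ?_
    simp [mul_comm]
  -- inner products in terms of the sites
  have hinner : ∀ (T : QOp (N * q)) j k,
      star (Q N *ᵥ blockState B k N) ⬝ᵥ (T *ᵥ (Q N *ᵥ blockState B j N)) =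
      star (mps (B k) N) ⬝ᵥ (((Q N)ᴴ * T * Q N).submatrix (siteEquiv N q).symm
        (siteEquiv N q).symm *ᵥ mps (B j) N) := fun T j k => by
    rw [← star_comp_dotProduct_mulVec, ← mulVec_mulVec, ← mulVec_mulVec]
    rw [star_dotProduct_mulVec (Q N)ᴴ, conjTranspose_conjTranspose]
    rfl
  have hexp : ∀ (T : QOp (N * q)) j, expv (Q N *ᵥ blockState B j N) T =
      expv (mps (B j) N) (((Q N)ᴴ * T * Q N).submatrix (siteEquiv N q).symm
        (siteEquiv N q).symm) := fun T j => hinner T j j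
  have hnorm : ∀ j, nrm (Q N *ᵥ blockState B j N) ^ 2 ≤ 2 := fun j => by
    have := h1 j j
    rw [if_pos rfl, star_dotProduct_self, ← Complex.ofReal_one, ← Complex.ofReal_sub,
      Complex.norm_real, Real.norm_eq_abs] at this
    rw [nrm_mulVec_of_conjTranspose_mul hQ2, blockState, nrm_comp]
    linarith [(abs_le.1 this).2]
  -- the norm of the superposition
  have hnψ : |nrm (Q N *ᵥ Ψ N) ^ 2 - 1| ≤ r ^ 2 / 2 := by
    have k1 := norm_expv_sum_smul_sub_le (γ i) (fun j => Q N *ᵥ blockState B j N) 1 (fun _ => 1)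
      (η := η) fun j k => by
        rw [hinner, Matrix.mul_one, hQ2, Matrix.submatrix_one_equiv, one_mulVec]
        exact h1 j k
    rw [← hψ, expv_one] at k1
    simp only [mul_one] at k1
    rw [← Complex.ofReal_sum, ← Complex.ofReal_sub, Complex.norm_real, Real.norm_eq_abs] at k1
    have k2 : |∑ j, ‖γ i j‖ ^ 2 - 1| ≤ ζ := by
      rw [← hp1, ← Finset.sum_sub_distrib]
      exact (Finset.abs_sum_le_sum_abs _ _).trans h4
    have k3 := k1.trans ((mul_le_mul_of_nonneg_left hG hη0.le).trans hηr)
    have k4 := abs_sub_le (nrm (Q N *ᵥ Ψ N) ^ 2) (∑ j, ‖γ i j‖ ^ 2) 1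
    linarith
  have hov : 1 - (r / 2) ^ 2 ≤ ‖star (Q N *ᵥ Ψ N) ⬝ᵥ S N‖ ^ 2 := by
    have := (Real.sqrt_le_iff.1 h5).2
    linarith
  have a1 := norm_expv_sub_expv_le (hS N) hr0.le hr1 hov (by nlinarith) (mul_nonneg hc hc)
    (hXc.mul hc hYc)
  -- local operators do not connect different blocks, so the superposition acts as a mixture
  have hX' := (hQ N).conjTranspose_conj_mem_Loc_sites (L := L) h6 (by omega) (by omega) hX
  have hY' := (hQ N).conjTranspose_conj_mem_Loc_sites (L := L) h6 (by omega) (by omega) hY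
  rw [show 2 * L - L = L by omega, show 5 * L + L = 6 * L by omega] at hX'
  rw [show 8 * L - L = 7 * L by omega, show 11 * L + L = 12 * L by omega] at hY'
  have hQ1' : (Q N)ᴴᴴ * (Q N)ᴴ = 1 := by rwa [conjTranspose_conjTranspose]
  have hXc' : OpBound c ((Q N)ᴴ * X * Q N) := by
    have := hXc.conj (U := (Q N)ᴴ) (by rwa [conjTranspose_conjTranspose]) hQ1'
    rwa [conjTranspose_conjTranspose] at this
  have hYc' : OpBound c ((Q N)ᴴ * Y * Q N) := by
    have := hYc.conj (U := (Q N)ᴴ) (by rwa [conjTranspose_conjTranspose]) hQ1'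
    rwa [conjTranspose_conjTranspose] at this
  have a2 := norm_expv_sum_smul_sub_le (γ i) (fun j => Q N *ᵥ blockState B j N) (X * Y)
    (fun j => expv (Q N *ᵥ blockState B j N) X * expv (Q N *ᵥ blockState B j N) Y)
    (η := η) fun j k => by
      have := h2 N hLN _ _ (submatrix_siteEquiv_mem_Loc hX') (submatrix_siteEquiv_mem_Loc hY')
        hXc'.submatrix_symm hYc'.submatrix_symm j k
      rw [Matrix.submatrix_mul_equiv, show (Q N)ᴴ * X * Q N * ((Q N)ᴴ * Y * Q N) =
        (Q N)ᴴ * (X * Y) * Q N by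
          calc _ = (Q N)ᴴ * X * (Q N * (Q N)ᴴ) * Y * Q N := by simp only [Matrix.mul_assoc]
            _ = _ := by rw [hQ1, Matrix.mul_one]; simp only [Matrix.mul_assoc],
        ← hinner] at this
      rw [hexp, hexp]
      exact this
  rw [← hψ] at a2
  have a2' := a2.trans ((mul_le_mul_of_nonneg_left hG hη0.le).trans hηδ)
  have a3 : ‖∑ j, ((‖γ i j‖ ^ 2 : ℝ) : ℂ) *
        (expv (Q N *ᵥ blockState B j N) X * expv (Q N *ᵥ blockState B j N) Y) -
      ∑ j, (p j : ℂ) *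
        (expv (Q N *ᵥ blockState B j N) X * expv (Q N *ᵥ blockState B j N) Y)‖ ≤ δ / 3 := by
    have hb : ∀ j {T : QOp (N * q)}, OpBound c T → ‖expv (Q N *ᵥ blockState B j N) T‖ ≤ 2 * c := by
      intro j T hT
      refine (hT.norm_le _ _).trans ?_
      have := hnorm j
      nlinarith
    rw [← Finset.sum_sub_distrib]
    refine le_trans ?_ ((mul_le_mul_of_nonneg_right h4 (by positivity)).trans hζδ)
    rw [Finset.sum_mul]
    refine norm_sum_le_of_le _ fun j _ => ?_
    rw [← sub_mul, norm_mul, norm_mul, ← Complex.ofReal_sub, Complex.norm_real, Real.norm_eq_abs]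
    exact mul_le_mul_of_nonneg_left (mul_le_mul (hb j hXc) (hb j hYc) (norm_nonneg _)
      (by positivity)) (abs_nonneg _)
  have t1 := norm_sub_le_norm_sub_add_norm_sub (expv (S N) (X * Y)) (expv (Q N *ᵥ Ψ N) (X * Y))
    (∑ j, (p j : ℂ) *
        (expv (Q N *ᵥ blockState B j N) X * expv (Q N *ᵥ blockState B j N) Y))
  have t2 := norm_sub_le_norm_sub_add_norm_sub (expv (Q N *ᵥ Ψ N) (X * Y))
    (∑ j, ((‖γ i j‖ ^ 2 : ℝ) : ℂ) *
        (expv (Q N *ᵥ blockState B j N) X * expv (Q N *ᵥ blockState B j N) Y))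
    (∑ j, (p j : ℂ) *
        (expv (Q N *ᵥ blockState B j N) X * expv (Q N *ᵥ blockState B j N) Y))
  linarith

end Main

/-! ### Short-range nonstabilizerness forces an integer entropy -/

section Entropy

variable {b q : ℕ} {P : RGFixedPoint b} {B : ∀ j, Bits q → Matrix (Fin (P.dim j)) (Fin (P.dim j)) ℂ}

/-- If correlations of operators `X j`, `Y k` are those of a mixture, with weights `p`, of states in
which only `X i` and `Y i` have a nonzero expectation value `w i`, then the matrix of the
correlations is nearly diagonal. -/
lemma norm_sum_mul_sub_le {ι : Type*} [Fintype ι] [DecidableEq ι] {p w : ι → ℝ}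
    (hp0 : ∀ i, 0 ≤ p i) (hp1 : ∑ i, p i = 1) {W θ : ℝ} (hw0 : ∀ i, 0 < w i) (hw : ∀ i, w i ≤ W)
    (hθ0 : 0 ≤ θ) (hθ1 : θ ≤ 1) {x y : ι → ℂ} (j k : ι)
    (hx : ∀ i, ‖x i - (if i = j then (w j : ℂ) else 0)‖ ≤ θ)
    (hy : ∀ i, ‖y i - (if i = k then (w k : ℂ) else 0)‖ ≤ θ) :
    ‖∑ i, (p i : ℂ) * (x i * y i) - (if j = k then ((p j * w j ^ 2 : ℝ) : ℂ) else 0)‖ ≤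
      θ * (2 * W + 1) := by
  have e : (if j = k then ((p j * w j ^ 2 : ℝ) : ℂ) else 0) = ∑ i, (p i : ℂ) *
      ((if i = j then (w j : ℂ) else 0) * (if i = k then (w k : ℂ) else 0)) := by
    rw [Finset.sum_eq_single j]
    · by_cases h : j = k
      · subst h; simp only [if_true]; push_cast; ring
      · simp [h]
    · intro i _ h; simp [h]
    · simp
  have hW : 0 ≤ W := (hw0 j).le.trans (hw j)
  have hn : ∀ l i, ‖(if i = l then (w l : ℂ) else 0)‖ ≤ W := fun l i => by
    split_ifs
    · rw [Complex.norm_real, Real.norm_eq_abs, abs_of_pos (hw0 l)]; exact hw l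
    · simpa using hW
  rw [e, ← Finset.sum_sub_distrib]
  have e2 : θ * (2 * W + 1) = ∑ i, p i * (θ * (2 * W + 1)) := by
    rw [← Finset.sum_mul, hp1, one_mul]
  rw [e2]
  refine norm_sum_le_of_le _ fun i _ => ?_
  rw [← mul_sub, norm_mul, Complex.norm_real, Real.norm_eq_abs, abs_of_nonneg (hp0 i)]
  refine mul_le_mul_of_nonneg_left ?_ (hp0 i)
  set x' : ℂ := if i = j then (w j : ℂ) else 0
  set y' : ℂ := if i = k then (w k : ℂ) else 0
  have e3 : x i * y i - x' * y' = (x i - x') * (y i - y') + (x i - x') * y' + x' * (y i - y') := by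
    ring
  rw [e3]
  refine norm_add₃_le.trans ?_
  rw [norm_mul, norm_mul, norm_mul]
  have h1 := hx i
  have h2 := hy i
  have h3 : ‖x'‖ ≤ W := hn j i
  have h4 : ‖y'‖ ≤ W := hn k i
  have t1 : ‖x i - x'‖ * ‖y i - y'‖ ≤ θ * 1 :=
    mul_le_mul h1 (h2.trans hθ1) (norm_nonneg _) hθ0
  have t2 : ‖x i - x'‖ * ‖y'‖ ≤ θ * W := mul_le_mul h1 h4 (norm_nonneg _) hθ0
  have t3 : ‖x'‖ * ‖y i - y'‖ ≤ W * θ := mul_le_mul h3 h2 (norm_nonneg _) hW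
  linarith

/-- A short-range nonstabilizer family which contains, along a sequence of system sizes,
superpositions of blocks with convergent weights: the limiting weights are uniform on a set whose
cardinality is a power of two. -/
theorem RGFixedPoint.IsLimitOf.exists_shannon_eq_natCast (hB : P.IsLimitOf B)
    {Ψ : ∀ N, QState (N * q)} (hsr : ShortRangeNonstab Ψ) {γ : ℕ → Fin b → ℂ} {φ : ℕ → ℕ}
    (hφ : Tendsto φ atTop atTop)
    (hΨ : ∀ᶠ i in atTop, Ψ (φ i) = ∑ j, γ i j • blockState B j (φ i))
    {p : Fin b → ℝ} (hp0 : ∀ j, 0 ≤ p j) (hp1 : ∑ j, p j = 1)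
    (hγ : ∀ j, Tendsto (fun i => ‖γ i j‖ ^ 2) atTop (𝓝 (p j))) :
    ∃ k : ℕ, shannon p = k := by
  obtain ⟨D, Q, S, hD, hQ, hS, hdist⟩ := hsr 1 one_pos 1 one_pos
  have hS1 := fun N => (hS N).nrm_eq_one
  have hdist' : Tendsto (fun i => pureDist (Q (φ i) *ᵥ Ψ (φ i)) (S (φ i))) atTop (𝓝 0) := by
    refine Tendsto.comp (g := fun N => pureDist (Q N *ᵥ Ψ N) (S N)) ?_ hφ
    refine squeeze_zero' (Eventually.of_forall fun N => Real.sqrt_nonneg _) hdist ?_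
    simp only [Real.rpow_one]
    exact tendsto_const_div_atTop_nhds_zero_nat 1
  -- sums over all blocks are sums over the blocks of positive weight
  have hsub : ∀ {M : Type} [AddCommMonoid M] (f : Fin b → M), (∀ j, p j = 0 → f j = 0) →
      ∑ j : {j // 0 < p j}, f j = ∑ j, f j := fun f hf => by
    rw [← Finset.sum_filter_add_sum_filter_not Finset.univ (fun j => 0 < p j),
      Finset.sum_eq_zero (s := Finset.univ.filter fun j => ¬ 0 < p j), add_zero,
      Finset.sum_subtype (Finset.univ.filter fun j => 0 < p j) (p := fun j => 0 < p j) (by simp)]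
    intro j hj
    exact hf j (le_antisymm (not_lt.1 (Finset.mem_filter.1 hj).2) (hp0 j))
  have hsum : ∑ j : {j // 0 < p j}, p j = 1 := (hsub p fun _ h => h).trans hp1
  have hne : Nonempty {j // 0 < p j} := by
    by_contra h
    rw [not_nonempty_iff] at h
    simp at hsum
  have j₀ := hne.some
  -- with the probes, the correlation matrix tends to `diag (p j * w j ^ 2)`, with entries at least `κ`;
  -- errors of `2 * θ` leave it diagonally dominant
  obtain ⟨c, w, hc, hw, hprobe⟩ := hB.exists_probe
  obtain ⟨j₁, hj₁⟩ := Finite.exists_min fun j : {j // 0 < p j} => p j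
  obtain ⟨j₂, hj₂⟩ := Finite.exists_min fun j : {j // 0 < p j} => p j * w j ^ 2
  obtain ⟨j₃, hj₃⟩ := @Finite.exists_max _ _ _ ⟨j₀.1⟩ _ w
  set m := p j₁
  have hm : 0 < m := j₁.2
  set κ := p j₂ * w j₂ ^ 2
  have hκ : 0 < κ := mul_pos j₂.2 (pow_pos (hw _) 2)
  set W := w j₃
  have hW : 0 < W := hw j₃
  set θ := κ / (4 * (b + 1)) with hθ
  have hθ0 : 0 < θ := by positivity
  obtain ⟨θ', hθ'0, hθ'1, hθ'⟩ : ∃ θ' : ℝ, 0 < θ' ∧ θ' ≤ 1 ∧ θ' * (2 * W + 1) ≤ θ := by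
    refine ⟨min 1 (θ / (2 * W + 1)), lt_min one_pos (by positivity), min_le_left _ _, ?_⟩
    rw [← le_div_iff₀ (by positivity)]
    exact min_le_right _ _
  obtain ⟨k, hk, hpk⟩ := uniform_of_approx_sign_group (p := fun j : {j // 0 < p j} => p j)
      (fun j => j.2) hsum fun ε hε => by
    -- the requirements of `exists_sign_group`
    set δ := min (m ^ 2 / 2400) (ε * m / 9)
    have hδ0 : 0 < δ := lt_min (by positivity) (by positivity)
    have hL : Tendsto (fun i => φ i / 13) atTop atTop :=
      (Nat.tendsto_div_const_atTop (by norm_num)).comp hφ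
    have E1 := hB.eventually_correlations hφ hΨ hp0 hp1 hγ hD hQ hS1 hdist' zero_le_one hδ0
    have E2 := hB.eventually_correlations hφ hΨ hp0 hp1 hγ hD hQ hS1 hdist' hc hθ0
    have E3 := hL.eventually (hprobe θ' hθ'0)
    have E4 : ∀ᶠ i in atTop, ∀ j, ‖star (mps (B j) (φ i)) ⬝ᵥ mps (B j) (φ i) - 1‖ ≤ δ :=
      eventually_all.2 fun j => by
        have := hB.tendsto_inner j j
        rw [if_pos rfl] at this
        filter_upwards [(this.comp hφ).eventually (Metric.closedBall_mem_nhds _ hδ0)] with i hi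
        rwa [dist_eq_norm] at hi
    have E5 := hφ.eventually hD.eventually_le
    obtain ⟨i, h1, h2, h3, h4, h5⟩ := (E1.and (E2.and (E3.and (E4.and E5)))).exists
    generalize φ i = N at *
    set L := N / 13
    have hLN : 13 * L ≤ N := Nat.mul_div_le N 13
    have hQ1 := (hQ N).mul_conjTranspose
    have hQ2 := (hQ N).conjTranspose_mul
    set e := siteEquiv N q
    -- the probes, evolved by the circuit
    have hT : ∀ s, L ≤ s → s + 2 * L ≤ N → ∀ j, ∃ X : QOp (N * q),
        X ∈ Loc (β := Fin 2) (interval (N * q) ((s - L) * q) ((s + L + L) * q)) ∧ OpBound c X ∧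
        ∀ k, ‖expv (Q N *ᵥ blockState B k N) X - (if k = j then (w j : ℂ) else 0)‖ ≤ θ' := by
      intro s hs hsN j
      obtain ⟨T, hT1, hT2, hT3⟩ := h3 N s hsN j
      refine ⟨Q N * T.submatrix e e * (Q N)ᴴ, (hQ N).conj_mem_Loc_sites h5 hs (by omega)
        hT1.submatrix_siteEquiv.mem_Loc, OpBound.conj ?_ hQ1 hQ2, fun k => ?_⟩
      · exact hT2.submatrix_symm (e := e.symm)
      · rw [expv_conj]
        rw [show (Q N)ᴴ * (Q N * T.submatrix e e * (Q N)ᴴ) * Q N = T.submatrix e e by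
          calc _ = ((Q N)ᴴ * Q N) * T.submatrix e e * ((Q N)ᴴ * Q N) := by
                simp only [Matrix.mul_assoc]
            _ = _ := by rw [hQ2, Matrix.mul_one, Matrix.one_mul]]
        have : expv (blockState B k N) (T.submatrix e e) = expv (mps (B k) N) T := by
          rw [expv, blockState, star_comp_dotProduct_mulVec, Matrix.submatrix_submatrix]
          simp [expv, e]
        rw [this]
        exact hT3 k
    -- probes on one part of the ring spread to the three parts used for the correlations
    choose X hX1 hX2 hX3 using hT (3 * L) (by omega) (by omega)
    choose Y hY1 hY2 hY3 using hT (9 * L) (by omega) (by omega)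
    rw [show 3 * L - L = 2 * L by omega, show 3 * L + L + L = 5 * L by omega] at hX1
    rw [show 9 * L - L = 8 * L by omega, show 9 * L + L + L = 11 * L by omega] at hY1
    have hXY : ∀ j k : Fin b,
        ‖expv (S N) (X j * Y k) - (if j = k then ((p j * w j ^ 2 : ℝ) : ℂ) else 0)‖ ≤ 2 * θ := by
      intro j k
      have a1 := h2 (X j) (Y k) (hX1 j) (hY1 k) (hX2 j) (hY2 k)
      have a2 := (norm_sum_mul_sub_le hp0 hp1 hw hj₃ hθ'0.le hθ'1 j k (hX3 j) (hY3 k)).trans hθ'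
      have a3 := norm_sub_le_norm_sub_add_norm_sub (expv (S N) (X j * Y k))
        (∑ i, (p i : ℂ) * (expv (Q N *ᵥ blockState B i N) (X j) *
          expv (Q N *ᵥ blockState B i N) (Y k)))
        (if j = k then ((p j * w j ^ 2 : ℝ) : ℂ) else 0)
      linarith
    have hδm : 9 * (δ / m) ≤ ε := by
      have : δ ≤ ε * m / 9 := min_le_right _ _
      rw [mul_div_assoc', div_le_iff₀ hm]
      linarith
    obtain ⟨G, hG1, hG2, hG3, hG4⟩ := exists_sign_group j₀ hm hj₁ hsum hδ0.le (min_le_left _ _)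
      (v := fun j => Q N *ᵥ blockState B j N) (fun j => by
        have := h4 j
        rwa [star_dotProduct_self, ← Complex.ofReal_one, ← Complex.ofReal_sub, Complex.norm_real,
          Real.norm_eq_abs, ← nrm_comp e, ← nrm_mulVec_of_conjTranspose_mul hQ2] at this)
      (hS N) (A := interval (N * q) (2 * L * q) (5 * L * q))
      (C := interval (N * q) (8 * L * q) (11 * L * q))
      (Set.disjoint_left.2 fun x hx hx' => by
        have := Nat.mul_le_mul_right q (show 5 * L ≤ 8 * L by omega)
        have := hx.2
        have := hx'.1
        omega)
      (fun a a' ha ha' => by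
        have := h1 _ _ ha.mem_Loc ha'.mem_Loc
          (opBound_of_conjTranspose_mul (pauliString_conjTranspose_mul a))
          (opBound_of_conjTranspose_mul (pauliString_conjTranspose_mul a'))
        rwa [← hsub (fun j => (p j : ℂ) *
          (expv (Q N *ᵥ blockState B j N) (pauliString a) *
            expv (Q N *ᵥ blockState B j N) (pauliString a'))) fun j hj => by simp [hj]] at this)
      (X := fun j => X j) (Y := fun j => Y j) (fun j => hX1 j) (fun j => hY1 j) (fun j => by
        have d1 : ∑ k ∈ Finset.univ.erase j, ‖expv (S N) (X j * Y k)‖ ≤ b * (2 * θ) := by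
          refine (Finset.sum_le_card_nsmul _ _ (2 * θ) fun k hk => ?_).trans ?_
          · have := hXY j k
            rwa [if_neg (fun h => (Finset.mem_erase.1 hk).1 (Subtype.ext h).symm), sub_zero] at this
          · rw [nsmul_eq_mul]
            refine mul_le_mul_of_nonneg_right ?_ (by positivity)
            refine Nat.cast_le.2 ((Finset.card_erase_le).trans ?_)
            exact (Fintype.card_subtype_le _).trans_eq (Fintype.card_fin b)
        have d2 := hXY j j
        rw [if_pos rfl, norm_sub_rev] at d2
        have d3 := norm_le_norm_add_norm_sub (expv (S N) (X j * Y j))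
          ((p j * w j ^ 2 : ℝ) : ℂ)
        rw [norm_sub_rev, Complex.norm_real, Real.norm_eq_abs] at d3
        have d4 : κ ≤ p j * w j ^ 2 := hj₂ j
        have d5 := le_abs_self (p j * w j ^ 2)
        have d6 : θ * (4 * (b + 1)) = κ := div_mul_cancel₀ _ (by positivity)
        refine d1.trans_lt ?_
        nlinarith)
    exact ⟨G, hG1, hG2, hG3, fun σ h h' => (hG4 σ h h').trans hδm⟩
  exact ⟨k, shannon_of_uniform hk hp0 fun j hj => hpk ⟨j, hj⟩⟩

end Entropy

/-! ### The two families of states as superpositions of blocks -/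

section Encode

variable {ι : Type} [Fintype ι] [DecidableEq ι] {q N b : ℕ}

lemma encode_sum_smul (V : ι → QState q) (c : Fin b → ℂ) (u : Fin b → (Fin N → ι) → ℂ) :
    encode V (∑ j, c j • u j) = ∑ j, c j • encode V (u j) := by
  funext x
  simp only [encode, Finset.sum_apply, Pi.smul_apply, smul_eq_mul, Finset.sum_mul, Finset.mul_sum]
  rw [Finset.sum_comm]
  exact Finset.sum_congr rfl fun _ _ => Finset.sum_congr rfl fun _ _ => by ring

variable {P : RGFixedPoint b}

/-- The encoding of sites into qubits turns tensors on the sites into tensors on the qubits. -/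
lemma exists_blockState_of_isLimitOf {C : ∀ j, ι → Matrix (Fin (P.dim j)) (Fin (P.dim j)) ℂ}
    (hC : P.IsLimitOf C) (V : ι → QState q)
    (hV : ∀ j k s t, C j s ≠ 0 → C k t ≠ 0 → star (V t) ⬝ᵥ V s = if s = t then 1 else 0) :
    ∃ B : ∀ j, Bits q → Matrix (Fin (P.dim j)) (Fin (P.dim j)) ℂ, P.IsLimitOf B ∧
      ∀ (c : Fin b → ℂ) N, encode V (∑ j, c j • mps (C j) N) = ∑ j, c j • blockState B j N := by
  refine ⟨fun j x => ∑ i, V i x • C j i, fun j k => ?_, fun c N => ?_⟩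
  · rw [transfer_sum_smul V _ _ (hV j k)]
    exact hC j k
  · rw [encode_sum_smul]
    exact Finset.sum_congr rfl fun j _ => by rw [encode_mps]; rfl

end Encode

section FixedPoint

variable {b : ℕ} (P : RGFixedPoint b)

lemma RGFixedPoint.isLimitOf_tensor : P.IsLimitOf P.tensor := fun j k => by
  refine tendsto_const_nhds.congr' ?_
  filter_upwards [eventually_ge_atTop 1] with n hn
  rcases eq_or_ne j k with rfl | h
  · have h2 : transfer (P.tensor j) (P.tensor j) * transfer (P.tensor j) (P.tensor j) =
        transfer (P.tensor j) (P.tensor j) := by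
      have ht := P.trace_transfer_tensor j
      rw [P.transfer_tensor_self, Matrix.trace_vecMulVec, dotProduct_comm] at ht
      rw [P.transfer_tensor_self, Matrix.vecMulVec_mul_vecMulVec, ht, one_smul]
    exact (IsIdempotentElem.pow_eq h2 (by omega)).symm
  · rw [P.transfer_tensor_ne h, zero_pow (by omega)]

lemma RGFixedPoint.prod_tensor_apply (j : Fin b) {m : ℕ} (i : Fin (m + 1) → P.Site)
    (a c : Fin (P.dim j)) :
    (List.ofFn fun n => P.tensor j (i n)).prod a c =
      if (i 0).1 = ⟨j, a⟩ ∧ (i (Fin.last m)).2 = ⟨j, c⟩ then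
        (∏ n : Fin m, P.ω j (i n.castSucc).2 (i n.succ).1) * ((Real.sqrt (P.wt ⟨j, c⟩) : ℝ) : ℂ)
      else 0 := by
  induction m generalizing a with
  | zero =>
    simp [RGFixedPoint.tensor_apply, Prod.ext_iff]
  | succ m ih =>
    rw [List.ofFn_succ, List.prod_cons, Matrix.mul_apply]
    simp only [ih, RGFixedPoint.tensor_apply, ← Fin.succ_last]
    rw [Fin.prod_univ_succ]
    simp only [Fin.castSucc_zero, Fin.succ_zero_eq_one, Fin.succ_castSucc]
    by_cases h : (i 0).1 = ⟨j, a⟩ ∧ (i (Fin.last m).succ).2 = ⟨j, c⟩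
    · rw [if_pos h]
      by_cases h' : (i 0).2 = (i 1).1 ∧ (i 0).2.1 = j
      · obtain ⟨⟨j', e⟩, he⟩ : ∃ x, (i 0).2 = x := ⟨_, rfl⟩
        obtain rfl : j' = j := by rw [← h'.2, he]
        rw [Finset.sum_eq_single e]
        · rw [if_pos (Prod.ext h.1 he), if_pos ⟨by rw [← he]; exact h'.1.symm, h.2⟩, RGFixedPoint.ω,
            if_pos h', he, mul_assoc]
        · intro e' _ hne
          rw [if_neg, zero_mul]
          intro h3
          rw [h3] at he
          simp only [Sigma.mk.injEq, heq_eq_eq, true_and] at he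
          exact hne he
        · simp
      · rw [RGFixedPoint.ω, if_neg h', zero_mul, zero_mul]
        refine Finset.sum_eq_zero fun e _ => ?_
        by_cases h1 : i 0 = (⟨j, a⟩, ⟨j, e⟩)
        · refine mul_eq_zero_of_right _ (if_neg fun h3 => h' ?_)
          refine ⟨?_, by rw [h1]⟩
          rw [h1]; exact h3.1.symm
        · rw [if_neg h1, zero_mul]
    · rw [if_neg h]
      refine Finset.sum_eq_zero fun e _ => ?_
      by_cases h1 : i 0 = (⟨j, a⟩, ⟨j, e⟩)
      · exact mul_eq_zero_of_right _ (if_neg fun h3 => h ⟨by rw [h1], h3.2⟩)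
      · rw [if_neg h1, zero_mul]

/-- `|Ω_j⟩` is the matrix product state of `P.tensor j`. -/
lemma RGFixedPoint.Ω_eq_mps (j : Fin b) {N : ℕ} (hN : 0 < N) : P.Ω j N = mps (P.tensor j) N := by
  obtain ⟨m, rfl⟩ : ∃ m, N = m + 1 := ⟨N - 1, by omega⟩
  funext i
  rw [RGFixedPoint.Ω, mps, Fin.prod_univ_castSucc]
  simp only [Matrix.trace, Matrix.diag_apply, P.prod_tensor_apply]
  have e1 : ∀ n : Fin m, next n.castSucc = n.succ := fun n => by
    rw [next, finRotate_apply, Fin.coeSucc_eq_succ]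
  have e2 : next (Fin.last m) = 0 := finRotate_last
  simp only [e1, e2]
  by_cases h : (i (Fin.last m)).2 = (i 0).1 ∧ (i (Fin.last m)).2.1 = j
  · obtain ⟨⟨j', e⟩, he⟩ : ∃ x, (i (Fin.last m)).2 = x := ⟨_, rfl⟩
    obtain rfl : j' = j := by rw [← h.2, he]
    rw [Finset.sum_eq_single e]
    · rw [if_pos ⟨by rw [← he]; exact h.1.symm, he⟩, RGFixedPoint.ω, if_pos h, he]
    · intro e' _ hne
      rw [if_neg]
      rintro ⟨-, h3⟩
      rw [h3] at he
      simp only [Sigma.mk.injEq, heq_eq_eq, true_and] at he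
      exact hne he
    · simp
  · rw [RGFixedPoint.ω, if_neg h, mul_zero]
    refine (Finset.sum_eq_zero fun e _ => if_neg fun h3 => h ⟨?_, ?_⟩).symm
    · rw [h3.1, h3.2]
    · rw [h3.2]

lemma RGFixedPoint.state_eq {N : ℕ} (hN : 0 < N) :
    P.state N = ∑ j, P.α N j • mps (P.tensor j) N := by
  funext i
  simp only [RGFixedPoint.state, Finset.sum_apply, Pi.smul_apply, smul_eq_mul, P.Ω_eq_mps _ hN]

/-- Along a subsequence, the weights of the blocks in the fixed point converge. -/
lemma RGFixedPoint.exists_tendsto_norm_sq : ∃ (p : Fin b → ℝ) (φ : ℕ → ℕ),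
    Tendsto φ atTop atTop ∧ (∀ j, 0 ≤ p j) ∧ ∑ j, p j = 1 ∧
    ∀ j, Tendsto (fun i => ‖P.α (φ i) j‖ ^ 2) atTop (𝓝 (p j)) := by
  have hK : IsCompact (Set.univ.pi fun _ : Fin b => Set.Icc (0 : ℝ) 1) :=
    isCompact_univ_pi fun _ => isCompact_Icc
  have hmem : ∀ᶠ N in atTop, (fun j => ‖P.α N j‖ ^ 2) ∈
      Set.univ.pi fun _ : Fin b => Set.Icc (0 : ℝ) 1 := by
    filter_upwards [P.normalized] with N hN j _
    refine ⟨by positivity, ?_⟩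
    rw [← hN]
    exact Finset.single_le_sum (f := fun j => ‖P.α N j‖ ^ 2) (fun _ _ => by positivity)
      (Finset.mem_univ j)
  obtain ⟨p, hp, φ, hφ, hlim⟩ := hK.tendsto_subseq' hmem.frequently
  have hlim' := fun j => tendsto_pi_nhds.1 hlim j
  refine ⟨p, φ, hφ.tendsto_atTop, fun j => (hp j trivial).1, ?_, hlim'⟩
  refine tendsto_nhds_unique (tendsto_finsetSum _ fun j _ => hlim' j) ?_
  refine tendsto_const_nhds.congr' ?_
  filter_upwards [hφ.tendsto_atTop.eventually P.normalized] with i hi using hi.symm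

end FixedPoint

section Gauge

variable {ι κ κ' : Type} [Fintype ι] [DecidableEq ι] [Fintype κ] [DecidableEq κ]
  [Fintype κ'] [DecidableEq κ']

lemma mps_conj {X : Matrix κ κ' ℂ} {Y : Matrix κ' κ ℂ} (hXY : X * Y = 1) (hYX : Y * X = 1)
    (A : ι → Matrix κ κ ℂ) (N : ℕ) : mps (fun i => Y * A i * X) N = mps A N := by
  have h : ∀ l : List ι, (l.map fun i => Y * A i * X).prod = Y * (l.map A).prod * X := fun l => by
    induction l with
    | nil => simp [hYX]
    | cons i l ih =>
      rw [List.map_cons, List.prod_cons, ih, List.map_cons, List.prod_cons]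
      calc Y * A i * X * (Y * (l.map A).prod * X) = Y * A i * (X * Y) * (l.map A).prod * X := by
            simp only [Matrix.mul_assoc]
        _ = _ := by rw [hXY, Matrix.mul_one]; simp only [Matrix.mul_assoc]
  funext i
  have e1 : (List.ofFn fun n => Y * A (i n) * X) = (List.ofFn i).map fun i => Y * A i * X := by
    rw [List.map_ofFn]; rfl
  have e2 : (List.ofFn fun n => A (i n)) = (List.ofFn i).map A := by rw [List.map_ofFn]; rfl
  rw [mps, mps, e1, e2, h, Matrix.mul_assoc, Matrix.trace_mul_comm, Matrix.mul_assoc, hXY,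
    Matrix.mul_one]

lemma transfer_conj {κ₁ κ₂ κ₁' κ₂' : Type} [Fintype κ₁] [Fintype κ₂] [Fintype κ₁'] [Fintype κ₂']
    (X : Matrix κ₁ κ₁' ℂ) (Y : Matrix κ₁' κ₁ ℂ) (X' : Matrix κ₂ κ₂' ℂ) (Y' : Matrix κ₂' κ₂ ℂ)
    (A : ι → Matrix κ₁ κ₁ ℂ) (A' : ι → Matrix κ₂ κ₂ ℂ) :
    transfer (fun i => Y * A i * X) (fun i => Y' * A' i * X') =
      (Y ⊗ₖ Y'.map star) * transfer A A' * (X ⊗ₖ X'.map star) := by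
  have h : ∀ {l m n : Type} [Fintype m] (M : Matrix l m ℂ) (M' : Matrix m n ℂ),
      (M * M').map star = M.map star * M'.map star := fun M M' => by
    ext; simp [Matrix.mul_apply]
  simp only [transfer, h, Matrix.mul_kronecker_mul, Matrix.mul_sum, Matrix.sum_mul]

end Gauge

section CanonicalForm

variable {d b : ℕ} {F : CanonicalForm d b} {P : RGFixedPoint b}

lemma CanonicalForm.mps_tensor (N : ℕ) :
    mps F.tensor N = ∑ j, (∑ k, F.μ j k ^ N) • mps (F.A j) N := by
  have h : ∀ l : List (Fin d), (l.map F.tensor).prod = Matrix.blockDiagonal' fun j =>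
      (Matrix.diagonal (F.μ j) ^ l.length) ⊗ₖ (l.map (F.A j)).prod := fun l => by
    induction l with
    | nil => simp [← Matrix.blockDiagonal'_one]; rfl
    | cons i l ih =>
      rw [List.map_cons, List.prod_cons, ih, CanonicalForm.tensor, ← Matrix.blockDiagonal'_mul]
      congr 1
      funext j
      rw [← Matrix.mul_kronecker_mul, List.length_cons, pow_succ', List.map_cons, List.prod_cons]
  funext i
  have e : ∀ {κ : Type} (A : Fin d → Matrix κ κ ℂ),
      (List.ofFn fun n => A (i n)) = (List.ofFn i).map A := fun A => by rw [List.map_ofFn]; rfl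
  simp only [mps, Finset.sum_apply, Pi.smul_apply, smul_eq_mul]
  rw [e, h, Matrix.trace_blockDiagonal']
  refine Finset.sum_congr rfl fun j _ => ?_
  rw [Matrix.trace_kronecker, Matrix.diagonal_pow, Matrix.trace_diagonal, List.length_ofFn, e]
  rfl

/-- In a suitable gauge, the normal blocks flow to the tensors of the fixed point. -/
lemma CanonicalForm.HasRGFixedPoint.exists_isLimitOf (h : F.HasRGFixedPoint P) :
    ∃ C : ∀ j, Fin d → Matrix (Fin (P.dim j)) (Fin (P.dim j)) ℂ, P.IsLimitOf C ∧
      ∀ j N, mps (C j) N = mps (F.A j) N := by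
  obtain ⟨⟨X, Y, hXY, hlim⟩, -⟩ := h
  refine ⟨fun j i => Y j * F.A j i * X j, fun j k => ?_, fun j N =>
    mps_conj (hXY j).1 (hXY j).2 _ N⟩
  have hstar : ∀ {l m n : Type} [Fintype m] (M : Matrix l m ℂ) (M' : Matrix m n ℂ),
      M.map star * M'.map star = (M * M').map star := fun M M' => by
    ext; simp [Matrix.mul_apply]
  have e1 : (X j ⊗ₖ (X k).map star) * (Y j ⊗ₖ (Y k).map star) = 1 := by
    rw [← Matrix.mul_kronecker_mul, hstar, (hXY j).1, (hXY k).1, Matrix.map_one _ (by simp) (by simp),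
      Matrix.one_kronecker_one]
  have e2 : (Y j ⊗ₖ (Y k).map star) * (X j ⊗ₖ (X k).map star) = 1 := by
    rw [← Matrix.mul_kronecker_mul, hstar, (hXY j).2, (hXY k).2, Matrix.map_one _ (by simp) (by simp),
      Matrix.one_kronecker_one]
  have hpow : ∀ n : ℕ, transfer (fun i => Y j * F.A j i * X j) (fun i => Y k * F.A k i * X k) ^ n =
      (Y j ⊗ₖ (Y k).map star) * transfer (F.A j) (F.A k) ^ n * (X j ⊗ₖ (X k).map star) := fun n => by
    rw [transfer_conj]
    generalize Y j ⊗ₖ (Y k).map star = Y' at *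
    generalize X j ⊗ₖ (X k).map star = X' at *
    induction n with
    | zero => rw [pow_zero, pow_zero, Matrix.mul_one, e2]
    | succ n ih =>
      rw [pow_succ, ih, pow_succ]
      calc _ = Y' * transfer (F.A j) (F.A k) ^ n * (X' * Y') * transfer (F.A j) (F.A k) * X' := by
            simp only [Matrix.mul_assoc]
        _ = _ := by rw [e1, Matrix.mul_one]; simp only [Matrix.mul_assoc]
  simp only [hpow]
  have e3 : transfer (P.tensor j) (P.tensor k) = (Y j ⊗ₖ (Y k).map star) *
      transfer (fun s => X j * P.tensor j s * Y j) (fun s => X k * P.tensor k s * Y k) *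
      (X j ⊗ₖ (X k).map star) := by
    rw [transfer_conj, show ∀ Y' X' M, Y' * (X' * M * Y') * X' = (Y' * X') * M * (Y' * X') by
      intros; simp only [Matrix.mul_assoc]]
    rw [e2, Matrix.one_mul, Matrix.mul_one]
  rw [e3]
  exact (((continuous_const.matrix_mul continuous_id).matrix_mul continuous_const).tendsto _).comp
    (hlim j k)

/-- Along a subsequence, the phases of all `μ j k` of modulus one align, so that the coefficient of a
block tends to their number `m j`, whether or not the smaller `μ j k` are kept. -/
lemma CanonicalForm.exists_tendsto_sum_pow (F : CanonicalForm d b) :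
    ∃ (m : Fin b → ℝ) (φ : ℕ → ℕ), Tendsto φ atTop atTop ∧ 0 < ∑ j, m j ^ 2 ∧
      (∀ j, Tendsto (fun i => ∑ k, F.μ j k ^ φ i) atTop (𝓝 (m j : ℂ))) ∧
      ∀ j, Tendsto (fun i => ∑ k, if ‖F.μ j k‖ = 1 then F.μ j k ^ φ i else 0) atTop
        (𝓝 (m j : ℂ)) := by
  obtain ⟨φ, hφ, hz⟩ := exists_tendsto_pow_one
    (fun x : {x : Σ j, Fin (F.mult j) // ‖F.μ x.1 x.2‖ = 1} => F.μ x.1.1 x.1.2) fun x => x.2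
  refine ⟨fun j => ∑ k, if ‖F.μ j k‖ = 1 then 1 else 0, φ, hφ, ?_, fun j => ?_, fun j => ?_⟩
  · obtain ⟨j, k, h⟩ := F.norm_eq
    refine Finset.sum_pos' (fun _ _ => sq_nonneg _) ⟨j, Finset.mem_univ j, pow_pos ?_ 2⟩
    exact Finset.sum_pos' (fun k _ => by split_ifs <;> norm_num)
      ⟨k, Finset.mem_univ k, by rw [if_pos h]; exact one_pos⟩
  · push_cast
    refine tendsto_finsetSum _ fun k _ => ?_
    split_ifs with h
    · simpa using hz ⟨⟨j, k⟩, h⟩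
    · simpa [Function.comp_def] using (tendsto_pow_atTop_nhds_zero_of_norm_lt_one
        (lt_of_le_of_ne (F.norm_le j k) h)).comp hφ
  · push_cast
    refine tendsto_finsetSum _ fun k _ => ?_
    split_ifs with h
    · simpa using hz ⟨⟨j, k⟩, h⟩
    · simp

end CanonicalForm

section Weights

variable {b : ℕ} {P : RGFixedPoint b}

/-- The weights of the blocks in the fixed point along a sequence of aligned phases. -/
lemma RGFixedPoint.tendsto_norm_sq_α {φ : ℕ → ℕ} (hφ : Tendsto φ atTop atTop)
    {β : ℕ → Fin b → ℂ} (hα : ∀ᶠ N in atTop, ∃ c : ℂ, ∀ j, P.α N j = c * β N j) {m : Fin b → ℝ}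
    (hm : 0 < ∑ j, m j ^ 2) (hβ : ∀ j, Tendsto (fun i => β (φ i) j) atTop (𝓝 (m j : ℂ)))
    (j : Fin b) :
    Tendsto (fun i => ‖P.α (φ i) j‖ ^ 2) atTop (𝓝 (m j ^ 2 / ∑ k, m k ^ 2)) := by
  have h2 : ∀ j, Tendsto (fun i => ‖β (φ i) j‖ ^ 2) atTop (𝓝 (m j ^ 2)) := fun j => by
    simpa using ((hβ j).norm.pow 2)
  refine ((h2 j).div (tendsto_finsetSum _ fun k _ => h2 k) hm.ne').congr' ?_
  filter_upwards [hφ.eventually hα, hφ.eventually P.normalized] with i ⟨c, hc⟩ h1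
  simp only [hc, norm_mul, mul_pow, ← Finset.mul_sum] at h1 ⊢
  rw [Pi.div_apply, div_eq_iff (right_ne_zero_of_mul_eq_one h1), mul_right_comm, h1, one_mul]

/-- The weights of asymptotically orthonormal states in a normalized superposition. -/
lemma tendsto_norm_sq_of_normalized {X : ℕ → Type} [∀ i, Fintype (X i)]
    {u : ∀ i, Fin b → X i → ℂ}
    (hu : ∀ j k, Tendsto (fun i => star (u i k) ⬝ᵥ u i j) atTop (𝓝 (if j = k then 1 else 0)))
    {c : ℕ → ℂ} {β : ℕ → Fin b → ℂ} {m : Fin b → ℝ} (hm : 0 < ∑ j, m j ^ 2)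
    (hβ : ∀ j, Tendsto (fun i => β i j) atTop (𝓝 (m j : ℂ)))
    (h1 : ∀ᶠ i in atTop, nrm (c i • ∑ j, β i j • u i j) = 1) (j : Fin b) :
    Tendsto (fun i => ‖c i * β i j‖ ^ 2) atTop (𝓝 (m j ^ 2 / ∑ k, m k ^ 2)) := by
  have h2 : Tendsto (fun i => ‖β i j‖ ^ 2) atTop (𝓝 (m j ^ 2)) := by
    simpa using ((hβ j).norm.pow 2)
  have h3 : Tendsto (fun i => nrm (∑ j, β i j • u i j) ^ 2) atTop (𝓝 (∑ k, m k ^ 2)) := by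
    have e : ∀ i, nrm (∑ j, β i j • u i j) ^ 2 =
        (∑ j, ∑ k, star (β i k) * β i j * (star (u i k) ⬝ᵥ u i j)).re := fun i => by
      rw [← Complex.ofReal_re (nrm _ ^ 2), ← star_dotProduct_self]
      simp only [star_sum, sum_dotProduct, dotProduct_sum, star_smul, smul_dotProduct,
        dotProduct_smul, smul_eq_mul, Finset.mul_sum, mul_assoc, mul_left_comm]
    have h4 : Tendsto (fun i => ∑ j, ∑ k, star (β i k) * β i j * (star (u i k) ⬝ᵥ u i j)) atTop
        (𝓝 (∑ j, ∑ k, star (m k : ℂ) * m j * (if j = k then 1 else 0))) :=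
      tendsto_finsetSum _ fun j _ => tendsto_finsetSum _ fun k _ =>
        (((hβ k).star).mul (hβ j)).mul (hu j k)
    have h5 : ∑ j, ∑ k, star (m k : ℂ) * m j * (if j = k then 1 else 0) =
        ((∑ k, m k ^ 2 : ℝ) : ℂ) := by
      simp [sq]
    rw [h5] at h4
    simp only [e]
    exact (Complex.continuous_re.tendsto _).comp h4
  refine (h2.div h3 hm.ne').congr' ?_
  filter_upwards [h1] with i hi
  rw [nrm_smul] at hi
  have hi2 : ‖c i‖ ^ 2 * nrm (∑ j, β i j • u i j) ^ 2 = 1 := by rw [← mul_pow, hi, one_pow]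
  rw [Pi.div_apply, div_eq_iff (right_ne_zero_of_mul_eq_one hi2), norm_mul, mul_pow, mul_right_comm, hi2, one_mul]

end Weights

end LRN

theorem theorem1 {b : ℕ} (P : LRN.RGFixedPoint b) (l : ℝ)
    (hlim : Tendsto (fun N => LRN.shannon fun j => ‖P.α N j‖ ^ 2) atTop (𝓝 l))
    (hl : ∀ r : ℕ, l ≠ (r : ℝ)) :
    -- matrix product states with the RG fixed point `P`
    (∀ (d χ : ℕ) (A : Fin d → Matrix (Fin χ) (Fin χ) ℂ) (F : LRN.CanonicalForm d b),
      (∀ N : ℕ, 0 < N → LRN.mps A N = LRN.mps F.tensor N) →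
      F.HasRGFixedPoint P →
      ∀ φ : ∀ N : ℕ, (Fin N → Fin d) → ℂ,
        (∀ᶠ N : ℕ in atTop, star (φ N) ⬝ᵥ φ N = 1 ∧ ∃ c : ℂ, φ N = c • LRN.mps A N) →
        ∀ (q : ℕ) (V : Fin d → LRN.QState q),
          (∀ s t, star (V s) ⬝ᵥ V t = if s = t then 1 else 0) →
          LRN.LongRangeNonstab fun N => LRN.encode V (φ N)) ∧
    -- the RG fixed point itself, up to a local isometry
    (∀ (q : ℕ) (V : P.Site → LRN.QState q),
      (∀ s t : P.Site, s.1.1 = s.2.1 → t.1.1 = t.2.1 →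
        star (V s) ⬝ᵥ V t = if s = t then 1 else 0) →
      LRN.LongRangeNonstab fun N => LRN.encode V (P.state N)) := by
  have hshannon : ∀ (p : Fin b → ℝ) (φ : ℕ → ℕ), Tendsto φ atTop atTop →
      (∀ j, Tendsto (fun i => ‖P.α (φ i) j‖ ^ 2) atTop (𝓝 (p j))) → LRN.shannon p = l :=
    fun p φ hφ hp => tendsto_nhds_unique
      ((LRN.continuous_shannon.tendsto p).comp (tendsto_pi_nhds.2 hp)) (hlim.comp hφ)
  constructor
  · intro d χ A F hA hF φ hφ q V hV hsr
    obtain ⟨C, hC, hCA⟩ := hF.exists_isLimitOf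
    obtain ⟨B, hB, hVB⟩ := LRN.exists_blockState_of_isLimitOf hC V fun j k s t _ _ => by
      rw [hV t s]; exact if_congr eq_comm rfl rfl
    obtain ⟨m, ν, hν, hm, hβ, hβ'⟩ := F.exists_tendsto_sum_pow
    have hφ' : ∀ᶠ N in atTop, ∃ c : ℂ,
        φ N = c • ∑ j, (∑ k, F.μ j k ^ N) • LRN.mps (C j) N := by
      filter_upwards [hφ, eventually_gt_atTop 0] with N ⟨_, c, hc⟩ hN
      refine ⟨c, ?_⟩
      rw [hc, hA N hN, F.mps_tensor]
      simp only [hCA]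
    obtain ⟨c, hc⟩ : ∃ c : ℕ → ℂ, ∀ᶠ N in atTop,
        φ N = c N • ∑ j, (∑ k, F.μ j k ^ N) • LRN.mps (C j) N :=
      hφ'.choice
    obtain ⟨r, hr⟩ := hB.exists_shannon_eq_natCast hsr
      (γ := fun i j => c (ν i) * ∑ k, F.μ j k ^ ν i) (p := fun j => m j ^ 2 / ∑ k, m k ^ 2) hν
      (by
        filter_upwards [hν.eventually hc] with i hi
        rw [hi, ← hVB, Finset.smul_sum]
        simp only [smul_smul])
      (fun j => div_nonneg (sq_nonneg _) hm.le)
      (by rw [← Finset.sum_div, div_self hm.ne'])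
      (LRN.tendsto_norm_sq_of_normalized
        (fun j k => (hC.tendsto_inner j k).comp hν) hm hβ (by
          filter_upwards [hν.eventually hc, hν.eventually hφ] with i hi hi'
          have h1 := hi'.1
          rw [hi, LRN.star_dotProduct_self, ← Complex.ofReal_one, Complex.ofReal_inj] at h1
          exact (pow_eq_one_iff_of_nonneg (LRN.nrm_nonneg _) two_ne_zero).1 h1))
    exact hl r ((hshannon _ ν hν
      (LRN.RGFixedPoint.tendsto_norm_sq_α hν hF.2 hm hβ')).symm.trans hr)
  · intro q V hV hsr
    obtain ⟨B, hB, hVB⟩ := LRN.exists_blockState_of_isLimitOf P.isLimitOf_tensor V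
      fun j k s t hs ht => by
        have h : ∀ j s, P.tensor j s ≠ 0 → s.1.1 = s.2.1 := fun j s hs => by
          by_contra hne
          refine hs (Matrix.ext fun a c => ?_)
          rw [LRN.RGFixedPoint.tensor_apply, if_neg (fun h => hne (by rw [h]))]
          rfl
        rw [hV t s (h k t ht) (h j s hs)]
        exact if_congr eq_comm rfl rfl
    obtain ⟨p, ν, hν, hp0, hp1, hp⟩ := P.exists_tendsto_norm_sq
    obtain ⟨r, hr⟩ := hB.exists_shannon_eq_natCast hsr (γ := fun i => P.α (ν i)) hν
      (by
        filter_upwards [hν.eventually (eventually_gt_atTop 0)] with i hi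
        rw [P.state_eq hi, hVB]) hp0 hp1 hp
    exact hl r ((hshannon p ν hν hp).symm.trans hr)
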